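/- Let $\lambda_0=0.56\ldots$ be the unique real number with $e^{-\lambda_0}=\lambda_0$, let $\Lambda$ be the von Mangoldt function and write $\log^+ y=\max(\log y,0)$ (with $\log^+0=0$). There is an absolute constant $C$ such that the following holds. Let $q\ge 1$ be an integer such that the Generalized Riemann Hypothesis holds for all Dirichlet $L$-functions modulo $q$ (for every Dirichlet character $\psi$ modulo $q$, each zero of $L(s,\psi)$ with $0<\operatorname{Re}s<1$ satisfies $\operatorname{Re}s=1/2$), and let $\chi$ be a non-principal Dirichlet character modulo $q$. Then for all real $\lambda\ge\lambda_0$ and $x\ge 2$, and all real $T,t,\sigma$ with $|t|\le T$ and $\frac12\le\sigma\le\frac12+\frac{\lambda}{\log x}$, $$\log|L(\sigma+it,\chi)|\le \operatorname{Re}\sum_{2\le n\le x}\frac{\chi(n)\Lambda(n)}{n^{\frac12+\frac{\lambda}{\log x}+it}\log n}\,\frac{\log(x/n)}{\log x}+\frac{1+\lambda}{2}\,\frac{\log q+\log^+T}{\log x}+\frac{C}{\log x},$$ where the left-hand side is read as $-\infty$ (so that the inequality holds trivially) if $L(\sigma+it,\chi)=0$. -/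

import Mathlib

/-- The Generalized Riemann Hypothesis for all Dirichlet `L`-functions modulo `q`: for every
Dirichlet character `ψ` modulo `q`, each zero of `L(s, ψ)` in the open critical strip
`0 < Re s < 1` lies on the line `Re s = 1/2`. -/
def GRHModulus (q : ℕ) [NeZero q] : Prop :=
  ∀ (ψ : DirichletCharacter ℂ q) (s : ℂ),
    ψ.LFunction s = 0 → 0 < s.re → s.re < 1 → s.re = 1 / 2

/-- The weighted sum over `n ≤ x` of
`χ(n) Λ(n) / (n ^ (1/2 + lam / log x + i t) log n) · log (x / n) / log x`.
(The term `n = 1` is `0`, since `Λ(1) = 0`.) -/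
noncomputable def weightedPrimePowerSum {q : ℕ} (χ : DirichletCharacter ℂ q)
    (lam x t : ℝ) : ℂ :=
  ∑ n ∈ Finset.Icc 1 ⌊x⌋₊,
    χ (n : ZMod q) * (ArithmeticFunction.vonMangoldt n : ℂ) /
        ((n : ℂ) ^ (((1 / 2 + lam / Real.log x : ℝ) : ℂ) + (t : ℂ) * Complex.I) *
          (Real.log (n : ℝ) : ℂ)) *
      ((Real.log (x / (n : ℝ)) / Real.log x : ℝ) : ℂ)

/-! Write X = log x, δ = λ/X and P(s) for the sum over n ≤ x of χ(n)Λ(n)n^(-s) (X - log n)/log n.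
The proof replaces the usual sum over zeros by two positivity facts.

Monotonicity. For primitive χ with completed function ξ, the quotient ξ(1/2 - h + z)/ξ(1/2 + h + z)
is holomorphic on Re z ≥ 0 under GRH. The functional equation gives it modulus exactly q^h on Re z =
0, so Phragmén–Lindelöf bounds it by q^h on the half plane (`norm_completedRatio_le`). Chaining
shifts shows that q^(s/2) ξ(s) grows in modulus with Re s ≥ 1/2. The missing Euler factors of an
imprimitive character are paid for by q/conductor (`GRHModulus.norm_LFunction_mono`). With Gamma
estimates this yields a comparison of log|L| along a horizontal segment at cost (d/2)(log q + log⁺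
t), with no additive constant (`GRHModulus.log_norm_LFunction_le`), and the lower bound Re L'/L(s) ≥
-(log q + log|s+1| + 2)/2 (`GRHModulus.neg_re_logDeriv_LFunction_le`).

Positive kernel. Let T(s) be the analytic continuation of the series of χ(n)Λ(n)n^(-s) (log n - X)⁺.
A multiple c = e^(-(a+v)X)/a of a Poisson kernel dominates the kernel that produces this tail.
Integrating L'/L(s - a + iy) against the nonnegative difference gives 2π(c L'/L(s) + T(s+v)).
Inserting the lower bound for Re L'/L gives -Re T(s+v) ≤ cM, where M = Re L'/L(s) + (log q +
log|s+1|)/2 + O(1) (`exists_neg_re_tailFunction_le`). Since T is the derivative of X log L + L'/L -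
P, integrating over v ≥ 0 yields X log|L(s)| + Re L'/L(s) - Re P(s) ≤ e^(-aX)/(aX) · M. At Re s =
1/2 + δ let a tend to δ. The factor becomes e^(-λ)/λ, which is at most 1 exactly when λ ≥ λ₀. As M ≥
0, the factor may be dropped, and Re L'/L(s) cancels (`exists_log_norm_LFunction_le`).

Dividing by X and moving from 1/2 + δ back to σ by monotonicity costs at most δ/2 times log q + log⁺
T; the two contributions add up to (1 + λ)/2. For δ > 7/2 trivial bounds suffice. -/

section

/-! ### Growth of the Gamma function along horizontal segments. -/

open Complex Filter Topology

/-- The function `v / (v² + y²)`, the real part of `1 / (v + i y)`. -/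
noncomputable def reInvKernel (y v : ℝ) : ℝ := v / (v ^ 2 + y ^ 2)

lemma reInvKernel_le_iff {y a b : ℝ} (ha : 0 < a) (hb : 0 < b) :
    reInvKernel y a ≤ reInvKernel y b ↔ 0 ≤ (b - a) * (y ^ 2 - a * b) := by
  unfold reInvKernel
  rw [div_le_div_iff₀ (by positivity) (by positivity), ← sub_nonneg]
  exact iff_of_eq (by ring_nf)

lemma reInvKernel_mono {y a b : ℝ} (ha : 0 < a) (hab : a ≤ b) (hb : b ≤ |y|) :
    reInvKernel y a ≤ reInvKernel y b := by
  rw [reInvKernel_le_iff ha (ha.trans_le hab)]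
  refine mul_nonneg (by linarith) ?_
  have : a * b ≤ |y| * |y| := mul_le_mul (hab.trans hb) hb (ha.le.trans hab) (abs_nonneg _)
  nlinarith [sq_abs y]

lemma reInvKernel_anti {y a b : ℝ} (ha : 0 < a) (hab : a ≤ b) (hy : |y| ≤ a) :
    reInvKernel y b ≤ reInvKernel y a := by
  rw [reInvKernel_le_iff (ha.trans_le hab) ha]
  refine mul_nonneg_of_nonpos_of_nonpos (by linarith) ?_
  have : |y| * |y| ≤ b * a := mul_le_mul (hy.trans hab) hy (abs_nonneg _) (ha.le.trans hab)
  nlinarith [sq_abs y]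

/-- The kernel rises up to |y| and falls afterwards, so its mean over [v, v+1] exceeds its value at
v by at most its gain on the rising part. The `min`/`max` clamp the interval to that part, so that
the gains telescope when summed. -/
lemma half_log_sub_le_reInvKernel {y v : ℝ} (hv : 0 < v) :
    1 / 2 * Real.log ((v + 1) ^ 2 + y ^ 2) - 1 / 2 * Real.log (v ^ 2 + y ^ 2) ≤
      reInvKernel y v +
        (reInvKernel y (min (v + 1) (max v |y|)) - reInvKernel y (min v (max v |y|))) := by
  have hd : ∀ u ∈ Set.Icc v (v + 1),
      HasDerivAt (fun u : ℝ ↦ 1 / 2 * Real.log (u ^ 2 + y ^ 2)) (reInvKernel y u) u := by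
    intro u hu
    have hu0 : 0 < u := hv.trans_le hu.1
    have h0 : u ^ 2 + y ^ 2 ≠ 0 := by positivity
    have := (((hasDerivAt_pow 2 u).add_const (y ^ 2)).log h0).const_mul (1 / 2 : ℝ)
    refine this.congr_deriv ?_
    unfold reInvKernel
    field_simp
    norm_num
  obtain ⟨ξ, hξ, h⟩ := exists_hasDerivAt_eq_slope (fun u : ℝ ↦ 1 / 2 * Real.log (u ^ 2 + y ^ 2))
    (reInvKernel y) (by linarith : v < v + 1)
    (fun u hu ↦ (hd u hu).continuousAt.continuousWithinAt)
    (fun u hu ↦ hd u ⟨hu.1.le, hu.2.le⟩)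
  simp only [add_sub_cancel_left, div_one] at h
  rw [← h]
  have hξ0 : 0 < ξ := hv.trans hξ.1
  rcases le_total |y| v with hy | hy
  · rw [max_eq_left hy, min_eq_right (by linarith), min_self, sub_self, add_zero]
    exact reInvKernel_anti hv hξ.1.le hy
  · rw [max_eq_right hy, min_eq_left hy, add_sub_cancel]
    rcases le_total ξ |y| with h1 | h1
    · exact reInvKernel_mono hξ0 (le_min hξ.2.le h1) (min_le_right _ _)
    · rw [min_eq_right (h1.trans hξ.2.le)]
      exact reInvKernel_anti (hv.trans_le hy) h1 le_rfl

/-- The excess in the comparison of `∑ (x+k)/((x+k)²+y²)` with the corresponding integral. -/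
noncomputable def reInvExcess (x y : ℝ) : ℝ := if |y| ≤ x then 0 else 1 / (2 * |y|)

/-- The telescoped gain is at most the peak value 1/(2|y|), and it is zero when the peak lies to the
left of x. This is a finite form of Re ψ(z) ≤ log|z| + excess for the digamma function. -/
lemma sum_reInvKernel_ge {x : ℝ} (hx : 0 < x) (y : ℝ) (N : ℕ) :
    1 / 2 * Real.log ((x + N) ^ 2 + y ^ 2) - 1 / 2 * Real.log (x ^ 2 + y ^ 2) - reInvExcess x y ≤
      ∑ k ∈ Finset.range N, reInvKernel y (x + k) := by
  have key : ∀ N : ℕ, 1 / 2 * Real.log ((x + N) ^ 2 + y ^ 2) - 1 / 2 * Real.log (x ^ 2 + y ^ 2) ≤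
      ∑ k ∈ Finset.range N, reInvKernel y (x + k) +
        (reInvKernel y (min (x + N) (max x |y|)) - reInvKernel y (min x (max x |y|))) := by
    intro N
    induction N with
    | zero => simp
    | succ N ih =>
      rw [Finset.sum_range_succ]
      have h := half_log_sub_le_reInvKernel (y := y) (v := x + N) (by positivity)
      push_cast
      rw [← add_assoc x]
      -- The one-step gain is clamped at max (x+N) |y|, the telescoping one at max x |y|. Beyond the
      -- peak both gains vanish; before it the two clamps coincide.
      have e : reInvKernel y (min (x + N + 1) (max (x + N) |y|)) -
          reInvKernel y (min (x + N) (max (x + N) |y|)) ≤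
          reInvKernel y (min (x + N + 1) (max x |y|)) -
          reInvKernel y (min (x + N) (max x |y|)) := by
        have hN : (0 : ℝ) ≤ N := N.cast_nonneg
        rcases le_total |y| (x + N) with hy | hy
        · have : max x |y| ≤ x + N := max_le (by linarith) hy
          rw [max_eq_left hy, min_eq_right this, min_eq_right (by linarith : max x |y| ≤ x + N + 1),
            min_eq_right (by linarith), min_self]
          simp
        · rw [max_eq_right hy, max_eq_right (by linarith)]
      linarith
  refine (sub_le_sub_right (key N) _).trans ?_
  have hN : (0 : ℝ) ≤ N := N.cast_nonneg
  suffices reInvKernel y (min (x + N) (max x |y|)) - reInvKernel y (min x (max x |y|)) ≤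
      reInvExcess x y by linarith
  unfold reInvExcess
  split_ifs with hy
  · rw [max_eq_left hy, min_self, min_eq_right (by linarith), sub_self]
  · push Not at hy
    have hy0 : 0 < |y| := hx.trans hy
    have h1 : 0 ≤ reInvKernel y (min x (max x |y|)) := by
      rw [min_eq_left (le_max_left _ _)]; unfold reInvKernel; positivity
    have h2 : reInvKernel y (min (x + N) (max x |y|)) ≤ reInvKernel y |y| := by
      rw [max_eq_right hy.le]
      exact reInvKernel_mono (lt_min (by positivity) hy0) (min_le_right _ _) le_rfl
    have h3 : reInvKernel y |y| = 1 / (2 * |y|) := by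
      unfold reInvKernel
      rw [← sq_abs y]; field_simp; norm_num
    linarith

lemma log_norm_eq_half_log (z : ℂ) :
    Real.log ‖z‖ = 1 / 2 * Real.log (z.re ^ 2 + z.im ^ 2) := by
  have : z.re ^ 2 + z.im ^ 2 = ‖z‖ ^ 2 := by
    rw [← Complex.normSq_eq_norm_sq, Complex.normSq_apply]; ring
  rw [this, Real.log_pow]; push_cast; ring

/-- Comparison of the Gamma function along a horizontal segment. -/
lemma norm_Gamma_add_le {z : ℂ} (hz : 0 < z.re) {h B : ℝ} (hh : 0 ≤ h)
    (hB : ∀ u ∈ Set.Icc 0 h, Real.log ‖z + u‖ + reInvExcess (z.re + u) z.im ≤ B) :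
    ‖Gamma (z + h)‖ ≤ ‖Gamma z‖ * Real.exp (h * B) := by
  have hne : ∀ u ∈ Set.Icc 0 h, ∀ k : ℕ, z + u + k ≠ 0 := by
    intro u hu k h0
    have := congrArg Complex.re h0
    simp at this
    have hk : (0 : ℝ) ≤ k := k.cast_nonneg
    linarith [hu.1]
  have main : ∀ N : ℕ, 0 < N → ‖GammaSeq (z + h) N‖ ≤ ‖GammaSeq z N‖ * Real.exp (h * B) := by
    intro N hN
    have hN0 : (0 : ℝ) < N := by exact_mod_cast hN
    set F : ℝ → ℝ := fun u ↦ u * (Real.log N - B) -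
      ∑ k ∈ Finset.range (N + 1), 1 / 2 * Real.log ((z.re + u + k) ^ 2 + z.im ^ 2) with hF
    have hderiv : ∀ u ∈ Set.Icc 0 h, HasDerivAt F (Real.log N - B -
        ∑ k ∈ Finset.range (N + 1), reInvKernel z.im (z.re + u + k)) u := by
      intro u hu
      refine HasDerivAt.sub ?_ (HasDerivAt.fun_sum fun k _ ↦ ?_)
      · simpa using (hasDerivAt_id u).mul_const (Real.log N - B)
      · have hp : 0 < z.re + u + k := by have := hu.1; positivity
        have h0 : (z.re + u + k) ^ 2 + z.im ^ 2 ≠ 0 := by positivity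
        have h1 : HasDerivAt (fun u : ℝ ↦ z.re + u + k) 1 u :=
          ((hasDerivAt_id u).const_add z.re).add_const (k : ℝ)
        have := (((h1.pow 2).add_const (z.im ^ 2)).log h0).const_mul (1 / 2 : ℝ)
        refine this.congr_deriv ?_
        unfold reInvKernel
        simp
        field_simp
    have hanti : AntitoneOn F (Set.Icc 0 h) := by
      refine antitoneOn_of_deriv_nonpos (convex_Icc 0 h)
        (fun u hu ↦ (hderiv u hu).continuousAt.continuousWithinAt)
        (fun u hu ↦ (hderiv u (interior_subset hu)).differentiableAt.differentiableWithinAt) ?_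
      intro u hu
      replace hu := interior_subset hu
      rw [(hderiv u hu).deriv]
      have h1 := sum_reInvKernel_ge (x := z.re + u) (by linarith [hu.1]) z.im (N + 1)
      have h2 := hB u hu
      have h3 := log_norm_eq_half_log (z + u)
      simp only [add_re, ofReal_re, add_im, ofReal_im, add_zero] at h3
      -- The upper end of the comparison integral absorbs the log N coming from N^(z+u).
      have h4 : Real.log N ≤ 1 / 2 * Real.log ((z.re + u + (N + 1 : ℕ)) ^ 2 + z.im ^ 2) := by
        have : Real.log ((N : ℝ) ^ 2) ≤ Real.log ((z.re + u + (N + 1 : ℕ)) ^ 2 + z.im ^ 2) := by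
          apply Real.log_le_log (by positivity)
          have : (N : ℝ) ≤ z.re + u + (N + 1 : ℕ) := by push_cast; linarith [hu.1]
          nlinarith [sq_nonneg z.im]
        rw [Real.log_pow] at this
        push_cast at this ⊢
        linarith
      linarith
    have hval : ∀ u ∈ Set.Icc 0 h, Real.log ‖GammaSeq (z + u) N‖ =
        F u + u * B + z.re * Real.log N + Real.log N.factorial := by
      intro u hu
      have hn : (N : ℂ) ≠ 0 := by exact_mod_cast hN.ne'
      rw [GammaSeq, norm_div, norm_mul, norm_prod, Real.log_div, Real.log_mul, Real.log_prod]
      · rw [show ‖(N : ℂ) ^ (z + u)‖ = (N : ℝ) ^ (z.re + u) by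
          rw [Complex.norm_natCast_cpow_of_pos hN]; simp]
        rw [Real.log_rpow hN0]
        have : ∀ k ∈ Finset.range (N + 1), Real.log ‖z + u + k‖ =
            1 / 2 * Real.log ((z.re + u + k) ^ 2 + z.im ^ 2) := by
          intro k _
          rw [log_norm_eq_half_log]
          simp
        rw [Finset.sum_congr rfl this]
        simp only [Complex.norm_natCast, F]
        ring
      · intro k _; exact norm_ne_zero_iff.mpr (hne u hu k)
      · exact norm_ne_zero_iff.mpr (by simp [hn, Complex.cpow_eq_zero_iff])
      · simp [Nat.factorial_ne_zero]
      · exact mul_ne_zero (norm_ne_zero_iff.mpr (by simp [hn, Complex.cpow_eq_zero_iff]))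
          (by simp [Nat.factorial_ne_zero])
      · exact Finset.prod_ne_zero_iff.mpr fun k _ ↦ norm_ne_zero_iff.mpr (hne u hu k)
    have hpos : ∀ u ∈ Set.Icc 0 h, 0 < ‖GammaSeq (z + u) N‖ := by
      intro u hu
      have hn : (N : ℂ) ≠ 0 := by exact_mod_cast hN.ne'
      rw [norm_pos_iff, GammaSeq]
      refine div_ne_zero (mul_ne_zero (by simp [hn, Complex.cpow_eq_zero_iff])
        (by simp [Nat.factorial_ne_zero])) ?_
      exact Finset.prod_ne_zero_iff.mpr fun k _ ↦ hne u hu k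
    have h0 : (0 : ℝ) ∈ Set.Icc 0 h := ⟨le_rfl, hh⟩
    have h1 : h ∈ Set.Icc 0 h := ⟨hh, le_rfl⟩
    have hle := hanti h0 h1 hh
    have e0 := hval 0 h0
    have e1 := hval h h1
    have p0 := hpos 0 h0
    have p1 := hpos h h1
    simp only [ofReal_zero, add_zero] at e0 p0
    rw [← Real.exp_log p1, ← Real.exp_log p0, ← Real.exp_add]
    apply Real.exp_le_exp.mpr
    linarith
  refine le_of_tendsto_of_tendsto (GammaSeq_tendsto_Gamma (z + h)).norm
    ((GammaSeq_tendsto_Gamma z).norm.mul_const _) ?_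
  filter_upwards [eventually_gt_atTop 0] with N hN using main N hN

/-- In Euler's product each factor satisfies |z+h+k|/|z+k| ≤ (Re z+h+k)/(Re z+k), because |z+h+k| ≤
|z+k| + h and |z+k| ≥ Re z + k. Decay of Γ(z)/Γ(z+h) is thus reduced to the real axis. -/
lemma norm_Gamma_div_le {z : ℂ} (hz : 0 < z.re) {h : ℝ} (hh : 0 ≤ h) :
    ‖Gamma z‖ * Real.Gamma (z.re + h) ≤ ‖Gamma (z + h)‖ * Real.Gamma z.re := by
  have main : ∀ N : ℕ, 0 < N → ‖GammaSeq z N‖ * Real.GammaSeq (z.re + h) N ≤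
      ‖GammaSeq (z + h) N‖ * Real.GammaSeq z.re N := by
    intro N hN
    have hN0 : (0 : ℝ) < N := by exact_mod_cast hN
    rw [GammaSeq, GammaSeq, Real.GammaSeq, Real.GammaSeq, norm_div, norm_div, norm_mul, norm_mul,
      norm_prod, norm_prod, Complex.norm_natCast_cpow_of_pos hN, Complex.norm_natCast_cpow_of_pos hN]
    have hk : ∀ k : ℕ, 0 < z.re + k := fun k ↦ by positivity
    have hne : ∀ k : ℕ, 0 < ‖z + k‖ := fun k ↦ norm_pos_iff.mpr fun h0 ↦ by
      have := congrArg Complex.re h0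
      simp at this
      linarith [hk k]
    have hne' : ∀ k : ℕ, 0 < ‖z + h + k‖ := fun k ↦ norm_pos_iff.mpr fun h0 ↦ by
      have := congrArg Complex.re h0
      simp at this
      linarith [hk k]
    have hprod : (∏ k ∈ Finset.range (N + 1), ‖z + h + k‖) *
        ∏ k ∈ Finset.range (N + 1), (z.re + k) ≤
        (∏ k ∈ Finset.range (N + 1), ‖z + k‖) *
        ∏ k ∈ Finset.range (N + 1), (z.re + h + k) := by
      rw [← Finset.prod_mul_distrib, ← Finset.prod_mul_distrib]
      refine Finset.prod_le_prod (fun k _ ↦ mul_nonneg (norm_nonneg _) (hk k).le) fun k _ ↦ ?_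
      have h1 : ‖z + h + k‖ ≤ ‖z + k‖ + h := by
        rw [show z + h + k = (z + k) + h by ring]
        refine (norm_add_le _ _).trans ?_
        simp [abs_of_nonneg hh]
      have h2 : z.re + k ≤ ‖z + k‖ := by
        refine le_trans ?_ (Complex.re_le_norm _); simp
      nlinarith [hk k]
    have hp1 : 0 < ∏ k ∈ Finset.range (N + 1), ‖z + k‖ := Finset.prod_pos fun k _ ↦ hne k
    have hp2 : 0 < ∏ k ∈ Finset.range (N + 1), ‖z + h + k‖ := Finset.prod_pos fun k _ ↦ hne' k
    have hp3 : 0 < ∏ k ∈ Finset.range (N + 1), (z.re + k) := Finset.prod_pos fun k _ ↦ hk k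
    have hp4 : 0 < ∏ k ∈ Finset.range (N + 1), (z.re + h + k) :=
      Finset.prod_pos fun k _ ↦ by linarith [hk k]
    rw [div_mul_div_comm, div_mul_div_comm]
    simp only [Complex.norm_natCast, add_re, ofReal_re]
    rw [div_le_div_iff₀ (by positivity) (by positivity)]
    have : (0 : ℝ) ≤ N ^ z.re * N.factorial * (N ^ (z.re + h) * N.factorial) := by positivity
    nlinarith [mul_le_mul_of_nonneg_left hprod this]
  refine le_of_tendsto_of_tendsto
    ((GammaSeq_tendsto_Gamma z).norm.mul (Real.GammaSeq_tendsto_Gamma _))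
    ((GammaSeq_tendsto_Gamma _).norm.mul (Real.GammaSeq_tendsto_Gamma _)) ?_
  filter_upwards [eventually_gt_atTop 0] with N hN using main N hN

/-- The constant must not exceed log π, which cancels against the π in (q/π)^(d/2). Anything left
over would cost a multiple of λ/log x after a shift by λ/log x, which is not O(1/log x) uniformly in
λ. The range of x is that of (Re s + a)/2 for 1/2 ≤ Re s ≤ 4 and 0 ≤ a ≤ 1. -/
lemma log_norm_add_reInvExcess_le {x y t : ℝ} (hx : 1 / 4 ≤ x) (hx' : x ≤ 5 / 2) (hy : y = t / 2)
    {z : ℂ} (hz : z.re = x) (hz' : z.im = y) :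
    Real.log ‖z‖ + reInvExcess x y ≤ Real.log Real.pi + Real.posLog t := by
  have hpi := Real.pi_gt_d2
  have hsq : ‖z‖ ^ 2 = x ^ 2 + y ^ 2 := by
    rw [← Complex.normSq_eq_norm_sq, Complex.normSq_apply, hz, hz']; ring
  have hpos : 0 < ‖z‖ := by
    rw [norm_pos_iff]; rintro rfl; simp at hz; linarith
  have hpl : Real.posLog t = max 0 (Real.log |t|) := by rw [Real.posLog, Real.log_abs]
  unfold reInvExcess
  split_ifs with h
  · rw [add_zero]
    have hy2 : y ^ 2 ≤ x ^ 2 := by nlinarith [sq_abs y, abs_nonneg y]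
    have hn : ‖z‖ ≤ Real.pi * max 1 |t| := by
      rcases le_total |t| 1 with h1 | h1
      · rw [max_eq_left h1, mul_one]
        have : y ^ 2 ≤ 1 / 4 := by rw [hy]; nlinarith [sq_abs t, abs_nonneg t]
        nlinarith
      · rw [max_eq_right h1]
        have : ‖z‖ ≤ 3.14 * |t| := by
          apply abs_le_of_sq_le_sq' _ (by positivity) |>.2
          have : y ^ 2 = |t| ^ 2 / 4 := by rw [sq_abs, hy]; ring
          nlinarith
        nlinarith
    have hm : Real.log (max 1 |t|) = max 0 (Real.log |t|) := by
      rcases le_total |t| 1 with h1 | h1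
      · rw [max_eq_left h1, Real.log_one, max_eq_left (Real.log_nonpos (abs_nonneg _) h1)]
      · rw [max_eq_right h1, max_eq_right (Real.log_nonneg h1)]
    rw [hpl, ← hm, ← Real.log_mul (by positivity) (by positivity)]
    exact Real.log_le_log hpos hn
  · push Not at h
    have ht : |t| = 2 * |y| := by rw [hy, abs_div]; simp; ring
    have ht' : 1 / 2 < |t| := by linarith
    -- Here x < |y|, so |z| ≤ √2 |y| = |t|/√2, and 1/√2 < 0.71.
    have hn : ‖z‖ ≤ |t| * (71 / 100) := by
      apply abs_le_of_sq_le_sq' _ (by positivity) |>.2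
      nlinarith [sq_abs y, abs_nonneg y]
    have hl : Real.log ‖z‖ ≤ Real.log |t| + Real.log (71 / 100) := by
      rw [← Real.log_mul (by positivity) (by norm_num)]
      exact Real.log_le_log hpos hn
    have hc : Real.log (71 / 100) + 1.48 ≤ Real.log Real.pi := by
      have h1 : (1.48 : ℝ) ≤ Real.log (3.14 / (71 / 100)) := by
        rw [Real.le_log_iff_exp_le (by norm_num)]
        have : Real.exp 1.48 = Real.exp 1 * Real.exp 0.48 := by rw [← Real.exp_add]; norm_num
        have h2 : Real.exp 0.48 ≤ 1.6161 := by
          have := Real.exp_bound' (x := 0.48) (by norm_num) (by norm_num) (n := 6) (by norm_num)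
          refine this.trans ?_
          norm_num [Finset.sum_range_succ, Nat.factorial]
        rw [this]
        nlinarith [Real.exp_one_lt_d9, Real.exp_pos 1, Real.exp_pos 0.48]
      rw [Real.log_div (by norm_num) (by norm_num)] at h1
      have := Real.log_le_log (by norm_num) hpi.le
      linarith
    rw [← ht]
    rcases le_total |t| 1 with h1 | h1
    · have h2 : Real.log |t| + 1 / |t| ≤ 1.48 := by
        have h3 : Real.log (2 * |t|) ≤ 2 * |t| - 1 := Real.log_le_sub_one_of_pos (by positivity)
        rw [Real.log_mul (by norm_num) (by positivity)] at h3
        have h4 : 1 / |t| ≤ 3 - 2 * |t| := by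
          rw [div_le_iff₀ (by positivity)]; nlinarith
        have := Real.log_two_gt_d9
        linarith
      rw [hpl]
      linarith [le_max_left 0 (Real.log |t|)]
    · have h2 : 1 / |t| ≤ 1 := by rw [div_le_one (by positivity)]; exact h1
      rw [hpl]
      linarith [le_max_right 0 (Real.log |t|)]

lemma norm_Gamma_add_le_pi {s : ℂ} {a : ℝ} (ha : 0 ≤ a) (ha' : a ≤ 1) (hs : 1 / 2 ≤ s.re) {h : ℝ}
    (hh : 0 ≤ h) (hsh : s.re + h ≤ 4) :
    ‖Gamma ((s + h + a) / 2)‖ ≤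
      ‖Gamma ((s + a) / 2)‖ * Real.exp (h / 2 * (Real.log Real.pi + Real.posLog s.im)) := by
  have e : (s + h + a) / 2 = (s + a) / 2 + ((h / 2 : ℝ) : ℂ) := by push_cast; ring
  rw [e]
  have hre : ((s + a) / 2).re = (s.re + a) / 2 := by simp
  have him : ((s + a) / 2).im = s.im / 2 := by simp
  refine norm_Gamma_add_le (by rw [hre]; positivity) (by positivity) fun u hu ↦ ?_
  rw [hre, him]
  refine log_norm_add_reInvExcess_le ?_ ?_ rfl ?_ ?_
  · linarith [hu.1]
  · linarith [hu.2]
  · simp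
  · simp

/-- A cruder variant without an upper bound on Re s, meant for h → 0, where the constant is
harmless. The excess is at most 2 because |y| > 1/4 whenever it is nonzero. -/
lemma norm_Gamma_add_le_log {s : ℂ} {a : ℝ} (ha : 0 ≤ a) (ha' : a ≤ 1) (hs : 1 / 2 ≤ s.re) {h : ℝ}
    (hh : 0 ≤ h) :
    ‖Gamma ((s + h + a) / 2)‖ ≤
      ‖Gamma ((s + a) / 2)‖ * Real.exp (h / 2 * (Real.log ‖s + h + 1‖ + 2)) := by
  have e : (s + h + a) / 2 = (s + a) / 2 + ((h / 2 : ℝ) : ℂ) := by push_cast; ring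
  rw [e]
  have hre : ((s + a) / 2).re = (s.re + a) / 2 := by simp
  have him : ((s + a) / 2).im = s.im / 2 := by simp
  refine norm_Gamma_add_le (by rw [hre]; positivity) (by positivity) fun u hu ↦ ?_
  rw [hre, him]
  have hu1 := hu.1
  have hu2 := hu.2
  refine add_le_add (Real.log_le_log ?_ ?_) ?_
  · rw [norm_pos_iff]; intro h0
    have := congrArg Complex.re h0
    simp at this
    linarith
  · rw [← sq_le_sq₀ (norm_nonneg _) (norm_nonneg _), ← Complex.normSq_eq_norm_sq,
      ← Complex.normSq_eq_norm_sq, Complex.normSq_apply, Complex.normSq_apply]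
    simp
    nlinarith [mul_self_nonneg s.im]
  · unfold reInvExcess
    split_ifs with h'
    · norm_num
    · push Not at h'
      rw [div_le_iff₀ (by linarith)]
      linarith

/-- Log-convexity of Γ at x + 1 = h(x+h) + (1-h)(x+h+1), followed by the recurrence at x and at x+h.
-/
lemma Gamma_ratio_le {x h : ℝ} (hx : 0 < x) (hh : 0 < h) (hh' : h < 1) :
    Real.Gamma x ≤ Real.Gamma (x + h) * ((x + h) ^ (1 - h) / x) := by
  have h1 := Real.Gamma_mul_add_mul_le_rpow_Gamma_mul_rpow_Gamma (s := x + h) (t := x + h + 1)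
    (a := h) (b := 1 - h) (by linarith) (by linarith) hh (by linarith) (by ring)
  rw [show h * (x + h) + (1 - h) * (x + h + 1) = x + 1 by ring, Real.Gamma_add_one hx.ne',
    Real.Gamma_add_one (by linarith), Real.mul_rpow (by linarith) (Real.Gamma_nonneg_of_nonneg
    (by linarith))] at h1
  have hG : 0 < Real.Gamma (x + h) := Real.Gamma_pos_of_pos (by linarith)
  rw [show Real.Gamma (x + h) ^ h * ((x + h) ^ (1 - h) * Real.Gamma (x + h) ^ (1 - h)) =
    (Real.Gamma (x + h) ^ h * Real.Gamma (x + h) ^ (1 - h)) * (x + h) ^ (1 - h) by ring,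
    ← Real.rpow_add hG, show h + (1 - h) = 1 by ring, Real.rpow_one] at h1
  rw [← mul_div_assoc, le_div_iff₀ hx]
  linarith

/-- Decay of the ratio `Γ(z) / Γ(z + h)` in the right half plane. -/
lemma norm_Gamma_ratio_le {z : ℂ} (hz : 0 < z.re) {h : ℝ} (hh : 0 < h) (hh' : h < 1) :
    ‖Gamma z‖ ≤ ‖Gamma (z + h)‖ * ((z.re + h) ^ (1 - h) / z.re) := by
  have h1 := norm_Gamma_div_le hz hh.le
  have h2 := Gamma_ratio_le hz hh hh'
  have hG : 0 < Real.Gamma (z.re + h) := Real.Gamma_pos_of_pos (by linarith)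
  refine le_of_mul_le_mul_right ?_ hG
  nlinarith [mul_le_mul_of_nonneg_left h2 (norm_nonneg (Gamma (z + h)))]

end

/-! ### Dirichlet L-functions: growth for Re s > 0, conjugation, and the functional equation in
modulus. -/

section

open Complex Filter Topology MeasureTheory

lemma sum_range_natCast_zmod {q : ℕ} [NeZero q] (f : ZMod q → ℂ) :
    ∑ k ∈ Finset.range q, f (k : ZMod q) = ∑ j, f j := by
  refine Finset.sum_nbij' (fun k ↦ (k : ZMod q)) (fun j ↦ j.val) ?_ ?_ ?_ ?_ ?_
  · simp
  · intro j _; simpa using ZMod.val_lt j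
  · intro k hk; exact ZMod.val_cast_of_lt (by simpa using hk)
  · simp
  · simp

lemma exists_norm_sum_character_le {q : ℕ} [NeZero q] {χ : DirichletCharacter ℂ q} (hχ : χ ≠ 1) :
    ∃ C : ℝ, 0 < C ∧ ∀ n : ℕ, ‖∑ k ∈ Finset.Icc 1 n, χ (k : ZMod q)‖ ≤ C := by
  have hper : ∀ n, ∑ k ∈ Finset.range (n + q), χ (k : ZMod q) =
      ∑ k ∈ Finset.range n, χ (k : ZMod q) := by
    intro n
    rw [Finset.sum_range_add]
    have := sum_range_natCast_zmod (fun j ↦ χ ((n : ZMod q) + j))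
    push_cast
    rw [this, show ∑ j, χ ((n : ZMod q) + j) = ∑ j, χ j from
      Equiv.sum_comp (Equiv.addLeft (n : ZMod q)) (fun j ↦ χ j), χ.sum_eq_zero_of_ne_one hχ, add_zero]
  have hmod : ∀ n, ∑ k ∈ Finset.range n, χ (k : ZMod q) =
      ∑ k ∈ Finset.range (n % q), χ (k : ZMod q) := by
    intro n
    induction n using Nat.strong_induction_on with
    | _ n ih =>
      rcases lt_or_ge n q with h | h
      · rw [Nat.mod_eq_of_lt h]
      · have h1 := ih (n - q) (Nat.sub_lt_self (NeZero.pos q) h)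
        have h2 := hper (n - q)
        rw [Nat.sub_add_cancel h] at h2
        rw [h2, h1, Nat.mod_eq_sub_mod h]
  have hbd : ∀ n, ‖∑ k ∈ Finset.range n, χ (k : ZMod q)‖ ≤ q := by
    intro n
    rw [hmod]
    refine (norm_sum_le _ _).trans ?_
    refine (Finset.sum_le_card_nsmul _ _ 1 fun k _ ↦ χ.norm_le_one _).trans ?_
    simp only [Finset.card_range, nsmul_eq_mul, mul_one]
    exact_mod_cast (Nat.mod_lt _ (NeZero.pos q)).le
  refine ⟨q + 1, by positivity, fun n ↦ ?_⟩
  have : ∑ k ∈ Finset.Icc 1 n, χ (k : ZMod q) =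
      ∑ k ∈ Finset.range (n + 1), χ (k : ZMod q) - χ 0 := by
    rw [Finset.range_eq_Ico, Finset.sum_eq_sum_Ico_succ_bot (Nat.succ_pos n)]
    simp
    rfl
  rw [this]
  refine (norm_sub_le _ _).trans (add_le_add (hbd _) (χ.norm_le_one _))

lemma re_pos_isPreconnected (c : ℝ) : IsPreconnected {s : ℂ | c < s.re} :=
  (convex_halfSpace_re_gt c).isPreconnected

lemma re_gt_isOpen (c : ℝ) : IsOpen {s : ℂ | c < s.re} :=
  isOpen_lt continuous_const continuous_re

/-- Two functions holomorphic on `c < Re s` which agree for large `Re s` agree. -/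
lemma eqOn_re_gt_of_eqOn {f g : ℂ → ℂ} {c d : ℝ} (hcd : c ≤ d)
    (hf : DifferentiableOn ℂ f {s | c < s.re}) (hg : DifferentiableOn ℂ g {s | c < s.re})
    (h : ∀ s : ℂ, d < s.re → f s = g s) : ∀ s : ℂ, c < s.re → f s = g s := by
  have hmem : ((d + 1 : ℝ) : ℂ) ∈ {s : ℂ | d < s.re} := by simp
  have hmem' : ((d + 1 : ℝ) : ℂ) ∈ {s : ℂ | c < s.re} := by
    simp only [Set.mem_ofPred_eq, ofReal_re]; linarith
  refine (hf.analyticOnNhd (re_gt_isOpen c)).eqOn_of_preconnected_of_eventuallyEq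
    (hg.analyticOnNhd (re_gt_isOpen c)) (re_pos_isPreconnected c) hmem' ?_
  filter_upwards [(re_gt_isOpen d).mem_nhds hmem] with s hs using h s hs

/-- Abel summation gives L(s) = s ∫ S(t) t^(-s-1) dt over t > 1, with bounded character sums S.
Written as a Mellin transform at -s, the right side is holomorphic for Re s > 0, so the identity
extends there from Re s > 1. -/
lemma exists_norm_LFunction_le {q : ℕ} [NeZero q] {χ : DirichletCharacter ℂ q} (hχ : χ ≠ 1) :
    ∃ C : ℝ, 0 < C ∧ ∀ s : ℂ, 0 < s.re → ‖χ.LFunction s‖ ≤ C * ‖s‖ / s.re := by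
  obtain ⟨C, hC, hS⟩ := exists_norm_sum_character_le hχ
  set S : ℝ → ℂ := fun t ↦ ∑ k ∈ Finset.Icc 1 ⌊t⌋₊, χ (k : ZMod q) with hSdef
  have hSm : Measurable S := by
    have : Measurable (fun n : ℕ ↦ ∑ k ∈ Finset.Icc 1 n, χ (k : ZMod q)) := measurable_from_nat
    exact this.comp Nat.measurable_floor
  set g : ℝ → ℂ := Set.indicator (Set.Ioi 1) S with hg
  have hgb : ∀ t, ‖g t‖ ≤ C := fun t ↦
    (norm_indicator_le_norm_self S t).trans (hS _)
  have hmel : ∀ s : ℂ, mellin g (-s) = ∫ t in Set.Ioi (1 : ℝ), S t * (t : ℂ) ^ (-(s + 1)) := by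
    intro s
    rw [mellin]
    have : ∀ t : ℝ, (t : ℂ) ^ (-s - 1) • g t =
        Set.indicator (Set.Ioi 1) (fun t ↦ S t * (t : ℂ) ^ (-(s + 1))) t := by
      intro t
      rw [hg]
      by_cases ht : t ∈ Set.Ioi (1 : ℝ)
      · rw [Set.indicator_of_mem ht, Set.indicator_of_mem ht, smul_eq_mul, mul_comm]
        ring_nf
      · rw [Set.indicator_of_notMem ht, Set.indicator_of_notMem ht, smul_zero]
    simp_rw [this]
    rw [setIntegral_indicator measurableSet_Ioi]
    congr 2
    ext t; simp
  have hdiff : ∀ s : ℂ, 0 < s.re → DifferentiableAt ℂ (mellin g) (-s) := by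
    intro s hs
    refine mellin_differentiableAt_of_isBigO_rpow (a := 0) (b := -s.re - 1) ?_ ?_ ?_ ?_ ?_
    · refine LocallyIntegrable.locallyIntegrableOn ?_ _
      refine (locallyIntegrable_const (C : ℂ)).mono
        (hSm.indicator measurableSet_Ioi).aestronglyMeasurable (ae_of_all _ fun t ↦ ?_)
      simpa [abs_of_pos hC] using hgb t
    · refine Asymptotics.IsBigO.of_bound C (Eventually.of_forall fun t ↦ ?_)
      simpa using hgb t
    · simpa using hs
    · refine Asymptotics.IsBigO.of_bound 1 ?_
      have : Set.Iio (1 : ℝ) ∈ 𝓝[>] (0 : ℝ) :=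
        mem_nhdsWithin_of_mem_nhds (Iio_mem_nhds one_pos)
      filter_upwards [this] with t ht
      rw [hg, Set.indicator_of_notMem (by simp; exact (Set.mem_Iio.mp ht).le)]
      simp
    · simp
  have heq : ∀ s : ℂ, 0 < s.re → χ.LFunction s = s * mellin g (-s) := by
    refine eqOn_re_gt_of_eqOn zero_le_one
      (DirichletCharacter.differentiable_LFunction hχ).differentiableOn ?_ ?_
    · intro s hs
      refine DifferentiableAt.differentiableWithinAt ?_
      exact differentiableAt_id.mul ((hdiff s hs).comp s differentiableAt_id.neg)
    · intro s hs
      rw [χ.LFunction_eq_LSeries hs, hmel,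
        LSeries_eq_mul_integral _ le_rfl (by linarith) (χ.LSeriesSummable_of_one_lt_re hs)]
      refine Asymptotics.IsBigO.of_bound C (Eventually.of_forall fun n ↦ ?_)
      simpa using hS n
  refine ⟨C, hC, fun s hs ↦ ?_⟩
  rw [heq s hs, norm_mul, hmel]
  have hint : ∫ t in Set.Ioi (1 : ℝ), C * t ^ (-(s.re + 1)) = C / s.re := by
    rw [integral_const_mul, integral_Ioi_rpow_of_lt (by linarith) one_pos]
    simp
    field_simp
  have : ‖∫ t in Set.Ioi (1 : ℝ), S t * (t : ℂ) ^ (-(s + 1))‖ ≤ C / s.re := by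
    rw [← hint]
    refine norm_integral_le_of_norm_le
      ((integrableOn_Ioi_rpow_of_lt (by linarith) one_pos).const_mul C) ?_
    refine (ae_restrict_iff' measurableSet_Ioi).mpr (ae_of_all _ fun t ht ↦ ?_)
    have ht0 : (0 : ℝ) < t := one_pos.trans ht
    rw [norm_mul, Complex.norm_cpow_eq_rpow_re_of_pos ht0]
    simp only [neg_re, add_re, one_re]
    gcongr
    exact hS _
  calc ‖s‖ * ‖∫ t in Set.Ioi (1 : ℝ), S t * (t : ℂ) ^ (-(s + 1))‖ ≤ ‖s‖ * (C / s.re) := by gcongr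
    _ = C * ‖s‖ / s.re := by ring

lemma LFunction_inv_conj {q : ℕ} [NeZero q] {χ : DirichletCharacter ℂ q} (hχ : χ ≠ 1) (s : ℂ) :
    χ⁻¹.LFunction ((starRingEnd ℂ) s) = (starRingEnd ℂ) (χ.LFunction s) := by
  have hχ' : χ⁻¹ ≠ 1 := by simpa using hχ
  have hd : Differentiable ℂ (fun s ↦ (starRingEnd ℂ) (χ.LFunction ((starRingEnd ℂ) s))) := by
    intro z
    have := (DirichletCharacter.differentiable_LFunction hχ ((starRingEnd ℂ) z)).conj_conj
    rwa [Complex.conj_conj] at this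
  have key : ∀ z, χ⁻¹.LFunction z = (starRingEnd ℂ) (χ.LFunction ((starRingEnd ℂ) z)) := by
    intro z
    -- Both sides are entire; the half plane is chosen depending on z so as to contain it.
    refine eqOn_re_gt_of_eqOn (c := min 0 (z.re - 1)) (d := 1)
      ((min_le_left _ _).trans zero_le_one)
      (DirichletCharacter.differentiable_LFunction hχ').differentiableOn hd.differentiableOn ?_ z
      ((min_le_right _ _).trans_lt (by linarith))
    intro w hw
    rw [χ⁻¹.LFunction_eq_LSeries hw, χ.LFunction_eq_LSeries (by simpa using hw), LSeries, LSeries,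
      Complex.conj_tsum]
    refine tsum_congr fun n ↦ ?_
    rcases eq_or_ne n 0 with rfl | hn
    · simp
    · rw [LSeries.term_of_ne_zero hn, LSeries.term_of_ne_zero hn, map_div₀]
      congr 1
      · rw [← MulChar.star_eq_inv]; rfl
      · rw [← Complex.conj_cpow _ _ (by rw [Complex.natCast_arg]; exact Real.pi_pos.ne)]
        simp
  rw [key, Complex.conj_conj]

lemma gammaFactor_inv {q : ℕ} (χ : DirichletCharacter ℂ q) (s : ℂ) :
    χ⁻¹.gammaFactor s = χ.gammaFactor s := by
  rcases χ.even_or_odd with h | h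
  · have h' : χ⁻¹.Even := by
      rw [DirichletCharacter.Even, MulChar.inv_apply_eq_inv', h, inv_one]
    rw [h.gammaFactor_def, h'.gammaFactor_def]
  · have h' : χ⁻¹.Odd := by
      rw [DirichletCharacter.Odd, MulChar.inv_apply_eq_inv', h, inv_neg, inv_one]
    rw [h.gammaFactor_def, h'.gammaFactor_def]

lemma Gammaℝ_conj (s : ℂ) : Gammaℝ ((starRingEnd ℂ) s) = (starRingEnd ℂ) (Gammaℝ s) := by
  have h2 : (starRingEnd ℂ) 2 = 2 := map_ofNat (starRingEnd ℂ) 2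
  rw [Gammaℝ_def, Gammaℝ_def, map_mul, ← Complex.Gamma_conj]
  congr 1
  · rw [show -(starRingEnd ℂ) s / 2 = (starRingEnd ℂ) (-s / 2) by simp [h2], Complex.cpow_conj _ _
      (by rw [Complex.arg_ofReal_of_nonneg Real.pi_pos.le]; exact Real.pi_pos.ne), Complex.conj_ofReal]
  · simp [h2]

lemma gammaFactor_conj {q : ℕ} (χ : DirichletCharacter ℂ q) (s : ℂ) :
    χ.gammaFactor ((starRingEnd ℂ) s) = (starRingEnd ℂ) (χ.gammaFactor s) := by
  rcases χ.even_or_odd with h | h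
  · rw [h.gammaFactor_def, h.gammaFactor_def, Gammaℝ_conj]
  · rw [h.gammaFactor_def, h.gammaFactor_def, ← Gammaℝ_conj]; simp

lemma gammaFactor_ne_zero {q : ℕ} (χ : DirichletCharacter ℂ q) {s : ℂ} (hs : 0 < s.re) :
    χ.gammaFactor s ≠ 0 := by
  rcases χ.even_or_odd with h | h
  · rw [h.gammaFactor_def]; exact Gammaℝ_ne_zero_of_re_pos hs
  · rw [h.gammaFactor_def]; exact Gammaℝ_ne_zero_of_re_pos (by simp; linarith)

lemma completedLFunction_eq_mul {q : ℕ} [NeZero q] (χ : DirichletCharacter ℂ q) {s : ℂ}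
    (hs : 0 < s.re) : χ.completedLFunction s = χ.gammaFactor s * χ.LFunction s := by
  rw [χ.LFunction_eq_completed_div_gammaFactor s (Or.inl (by rintro rfl; simp at hs)),
    mul_div_cancel₀ _ (gammaFactor_ne_zero χ hs)]

lemma completedLFunction_inv_conj {q : ℕ} [NeZero q] {χ : DirichletCharacter ℂ q} (hχ : χ ≠ 1)
    (s : ℂ) : χ⁻¹.completedLFunction ((starRingEnd ℂ) s) =
      (starRingEnd ℂ) (χ.completedLFunction s) := by
  have hχ' : χ⁻¹ ≠ 1 := by simpa using hχ
  have hd : Differentiable ℂ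
      (fun s ↦ (starRingEnd ℂ) (χ.completedLFunction ((starRingEnd ℂ) s))) := by
    intro z
    have := (DirichletCharacter.differentiable_completedLFunction hχ ((starRingEnd ℂ) z)).conj_conj
    rwa [Complex.conj_conj] at this
  have key : ∀ z, χ⁻¹.completedLFunction z =
      (starRingEnd ℂ) (χ.completedLFunction ((starRingEnd ℂ) z)) := by
    intro z
    refine eqOn_re_gt_of_eqOn (c := min 0 (z.re - 1)) (d := 1)
      ((min_le_left _ _).trans zero_le_one)
      (DirichletCharacter.differentiable_completedLFunction hχ').differentiableOn
      hd.differentiableOn ?_ z ((min_le_right _ _).trans_lt (by linarith))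
    intro w hw
    rw [completedLFunction_eq_mul _ (by linarith),
      completedLFunction_eq_mul _ (by simp; linarith), map_mul, ← gammaFactor_conj,
      ← LFunction_inv_conj hχ, Complex.conj_conj, gammaFactor_inv]
  rw [key, Complex.conj_conj]

/-- Symmetry of the absolute value of the completed `L`-function of a primitive character. -/
lemma norm_completedLFunction_symm {q : ℕ} [NeZero q] {χ : DirichletCharacter ℂ q} (hχ : χ ≠ 1)
    (hp : χ.IsPrimitive) (h t : ℝ) :
    ‖χ.completedLFunction ((1 / 2 - h : ℝ) + t * I)‖ =
      (q : ℝ) ^ h * ‖χ.completedLFunction ((1 / 2 + h : ℝ) + t * I)‖ := by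
  have hq : 0 < q := NeZero.pos q
  have hq0 : (0 : ℝ) < q := by exact_mod_cast hq
  have step : ∀ h t : ℝ, ‖χ.completedLFunction ((1 / 2 - h : ℝ) + t * I)‖ =
      (q : ℝ) ^ h * ‖χ.rootNumber‖ * ‖χ.completedLFunction ((1 / 2 + h : ℝ) + t * I)‖ := by
    intro h t
    have := hp.completedLFunction_one_sub ((starRingEnd ℂ) ((1 / 2 + h : ℝ) + t * I))
    rw [completedLFunction_inv_conj hχ] at this
    have e : (1 : ℂ) - (starRingEnd ℂ) ((1 / 2 + h : ℝ) + t * I) = (1 / 2 - h : ℝ) + t * I := by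
      apply Complex.ext
      · simp; ring
      · simp
    rw [e] at this
    rw [this, norm_mul, norm_mul, RCLike.norm_conj, Complex.norm_natCast_cpow_of_pos hq]
    congr 3
    simp
  -- Reflecting with h = 2 and then with h = -2 returns to the same point, where the completed
  -- function does not vanish; hence the squared modulus of the root number is 1.
  have hroot : ‖χ.rootNumber‖ = 1 := by
    have h1 := step 2 0
    have h2 := step (-2) 0
    rw [show (1 / 2 - (-2) : ℝ) = 1 / 2 + 2 by ring, show (1 / 2 + (-2) : ℝ) = 1 / 2 - 2 by ring,
      h1] at h2
    have hne : ‖χ.completedLFunction ((1 / 2 + 2 : ℝ) + (0 : ℝ) * I)‖ ≠ 0 := by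
      have hre : (((1 / 2 + 2 : ℝ) : ℂ) + (0 : ℝ) * I).re = 5 / 2 := by
        norm_num
      rw [norm_ne_zero_iff, completedLFunction_eq_mul _ (by rw [hre]; norm_num)]
      exact mul_ne_zero (gammaFactor_ne_zero _ (by rw [hre]; norm_num))
        (χ.LFunction_ne_zero_of_one_le_re (Or.inl hχ) (by rw [hre]; norm_num))
    have h3 : (q : ℝ) ^ (-2 : ℝ) * (q : ℝ) ^ (2 : ℝ) = 1 := by
      rw [← Real.rpow_add hq0]; norm_num
    have h4 : ‖χ.rootNumber‖ ^ 2 = 1 := by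
      apply mul_right_cancel₀ hne
      linear_combination -h2 -
        ‖χ.rootNumber‖ ^ 2 * ‖χ.completedLFunction ((1 / 2 + 2 : ℝ) + (0 : ℝ) * I)‖ * h3
    exact (pow_eq_one_iff_of_nonneg (norm_nonneg _) two_ne_zero).mp h4
  rw [step, hroot, mul_one]

end

/-! ### Bounds for log L, 1/L, L'/L and (L'/L)' to the right of the critical line. -/

section

open Complex Filter Topology MeasureTheory

/-- A weight of moderate growth. -/
noncomputable def quarticWeight (t : ℝ) : ℝ := (1 + t ^ 2) ^ (1 / 4 : ℝ)

lemma one_le_quarticWeight (t : ℝ) : 1 ≤ quarticWeight t :=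
  Real.one_le_rpow (by nlinarith) (by norm_num)

lemma quarticWeight_add_le (t u : ℝ) :
    quarticWeight (t + u) ≤ 2 * (quarticWeight t * quarticWeight u) := by
  unfold quarticWeight
  have h2 : (2 : ℝ) ^ (1 / 4 : ℝ) ≤ 2 := by
    nth_rewrite 2 [← Real.rpow_one 2]
    exact Real.rpow_le_rpow_of_exponent_le (by norm_num) (by norm_num)
  calc (1 + (t + u) ^ 2) ^ (1 / 4 : ℝ) ≤ (2 * ((1 + t ^ 2) * (1 + u ^ 2))) ^ (1 / 4 : ℝ) := by
        apply Real.rpow_le_rpow (by positivity) _ (by norm_num)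
        nlinarith [sq_nonneg (t - u), mul_nonneg (sq_nonneg t) (sq_nonneg u)]
    _ = 2 ^ (1 / 4 : ℝ) * ((1 + t ^ 2) ^ (1 / 4 : ℝ) * (1 + u ^ 2) ^ (1 / 4 : ℝ)) := by
        rw [Real.mul_rpow (by norm_num) (by positivity), Real.mul_rpow (by positivity)
          (by positivity)]
    _ ≤ _ := by gcongr

lemma quarticWeight_le_of_abs_le {u : ℝ} (hu : |u| ≤ 1) (t : ℝ) :
    quarticWeight (t + u) ≤ 4 * quarticWeight t := by
  refine (quarticWeight_add_le t u).trans ?_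
  have : quarticWeight u ≤ 2 := by
    unfold quarticWeight
    have h1 : 1 + u ^ 2 ≤ 2 := by nlinarith [sq_abs u, abs_nonneg u]
    calc (1 + u ^ 2) ^ (1 / 4 : ℝ) ≤ 2 ^ (1 / 4 : ℝ) :=
          Real.rpow_le_rpow (by positivity) h1 (by norm_num)
      _ ≤ 2 ^ (1 : ℝ) := Real.rpow_le_rpow_of_exponent_le (by norm_num) (by norm_num)
      _ = 2 := Real.rpow_one 2
  nlinarith [one_le_quarticWeight t]

/-- From log u ≤ 2 u^(1/2). The weight grows like |t|^(1/2): it absorbs logarithms, it is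
submultiplicative under shifts up to a constant, and it stays integrable against 1/(1+y²). -/
lemma log_mul_le_quarticWeight {K : ℝ} (hK : 0 < K) (t : ℝ) :
    Real.log (K * (4 + 2 * |t|)) ≤ 2 * (K * 6) ^ (1 / 2 : ℝ) * quarticWeight t := by
  have h1 : 4 + 2 * |t| ≤ 6 * (1 + t ^ 2) ^ (1 / 2 : ℝ) := by
    rw [← Real.sqrt_eq_rpow]
    have : (4 + 2 * |t|) / 6 ≤ √(1 + t ^ 2) := by
      apply Real.le_sqrt_of_sq_le
      rw [← sq_abs t]
      nlinarith [sq_nonneg (|t| - 1), abs_nonneg t]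
    linarith
  have hp : 0 < 1 + t ^ 2 := by positivity
  calc Real.log (K * (4 + 2 * |t|)) ≤ Real.log (K * 6 * (1 + t ^ 2) ^ (1 / 2 : ℝ)) := by
        apply Real.log_le_log (by positivity)
        nlinarith
    _ ≤ (K * 6 * (1 + t ^ 2) ^ (1 / 2 : ℝ)) ^ (1 / 2 : ℝ) / (1 / 2) :=
        Real.log_le_rpow_div (by positivity) (by norm_num)
    _ = _ := by
        rw [Real.mul_rpow (by positivity) (by positivity), ← Real.rpow_mul hp.le, quarticWeight]
        norm_num
        ring

section

variable {q : ℕ} [NeZero q] {χ : DirichletCharacter ℂ q}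

lemma norm_LFunction_sub_one_le (χ : DirichletCharacter ℂ q) {k : ℕ} (hk : 2 ≤ k) {Z : ℝ}
    (hZ : HasSum (fun n : ℕ ↦ 1 / (n : ℝ) ^ k) Z) {s : ℂ} (hs : (k : ℝ) ≤ s.re) :
    ‖χ.LFunction s - 1‖ ≤ Z - 1 := by
  have hk' : (2 : ℝ) ≤ k := by exact_mod_cast hk
  have h1 : 1 < s.re := by linarith
  have hsum := (χ.LSeriesSummable_of_one_lt_re h1).LSeriesHasSum
  rw [← χ.LFunction_eq_LSeries h1] at hsum
  have hs1 : HasSum (fun n : ℕ ↦ if n = 1 then (1 : ℂ) else 0) 1 := hasSum_ite_eq 1 1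
  have hs2 : HasSum (fun n : ℕ ↦ if n = 1 then (1 : ℝ) else 0) 1 := hasSum_ite_eq 1 1
  have hd := HasSum.sub hsum hs1
  rw [← hd.tsum_eq]
  refine tsum_of_norm_bounded (HasSum.sub hZ hs2) fun n ↦ ?_
  rcases Nat.eq_zero_or_pos n with rfl | hn
  · rw [LSeries.term_zero, if_neg zero_ne_one, if_neg zero_ne_one, sub_zero, sub_zero, norm_zero]
    positivity
  · rw [LSeries.term_of_ne_zero hn.ne']
    split_ifs with h
    · subst h
      rw [Nat.cast_one, Nat.cast_one, Nat.cast_one, map_one, Complex.one_cpow, one_pow, div_one,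
        div_one, sub_self, sub_self, norm_zero]
    · rw [sub_zero, sub_zero, norm_div, Complex.norm_natCast_cpow_of_pos hn]
      have hn1 : (1 : ℝ) ≤ n := by exact_mod_cast hn
      have hle : (n : ℝ) ^ k ≤ (n : ℝ) ^ s.re := by
        rw [← Real.rpow_natCast]
        exact Real.rpow_le_rpow_of_exponent_le hn1 hs
      exact div_le_div₀ zero_le_one (χ.norm_le_one _) (by positivity) hle

lemma pi_sq_div_six_le : Real.pi ^ 2 / 6 ≤ 1.6452 := by
  have := Real.pi_lt_d4
  have := Real.pi_pos
  nlinarith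

lemma norm_LFunction_sub_one_le_of_two_le (χ : DirichletCharacter ℂ q) {s : ℂ} (hs : 2 ≤ s.re) :
    ‖χ.LFunction s - 1‖ ≤ 0.6452 := by
  have := norm_LFunction_sub_one_le χ le_rfl hasSum_zeta_two (s := s) (by simpa using hs)
  linarith [pi_sq_div_six_le]

lemma one_third_le_norm_LFunction (χ : DirichletCharacter ℂ q) {s : ℂ} (hs : 2 ≤ s.re) :
    1 / 3 ≤ ‖χ.LFunction s‖ := by
  have h1 := norm_LFunction_sub_one_le_of_two_le χ hs
  have h2 := norm_sub_norm_le (1 : ℂ) (1 - χ.LFunction s)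
  rw [norm_sub_rev] at h1
  rw [norm_one, sub_sub_cancel] at h2
  linarith

/-- A holomorphic nonvanishing function on a disc has a holomorphic logarithm, normalised at
the centre. -/
lemma exists_log_on_ball {F : ℂ → ℂ} (hF : Differentiable ℂ F) {c : ℂ} {R : ℝ} (hR : 0 < R)
    (hne : ∀ s ∈ Metric.ball c R, F s ≠ 0) :
    ∃ f : ℂ → ℂ, f c = 0 ∧ (∀ s ∈ Metric.ball c R, HasDerivAt f (logDeriv F s) s) ∧
      ∀ s ∈ Metric.ball c R, F s = F c * Complex.exp (f s) := by
  have hd : DifferentiableOn ℂ (logDeriv F) (Metric.ball c R) := by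
    intro s hs
    refine DifferentiableAt.differentiableWithinAt ?_
    exact ((hF.analyticAt s).deriv.differentiableAt).div (hF s) (hne s hs)
  obtain ⟨f, hf0, hf⟩ := hd.isExactOn_ball.with_val_at c 0
  refine ⟨f, hf0, hf, fun s hs ↦ ?_⟩
  have hder : ∀ z ∈ Metric.ball c R, HasDerivAt (fun z ↦ F z * Complex.exp (-f z)) 0 z := by
    intro z hz
    have := (hF z).hasDerivAt.mul ((hf z hz).neg.cexp)
    refine this.congr_deriv ?_
    rw [logDeriv_apply]
    field_simp [hne z hz]
    ring
  have hconst := (convex_ball c R).is_const_of_fderivWithin_eq_zero (𝕜 := ℂ)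
    (f := fun z ↦ F z * Complex.exp (-f z))
    (fun z hz ↦ (hder z hz).differentiableAt.differentiableWithinAt)
    (fun z hz ↦ by
      rw [fderivWithin_of_isOpen Metric.isOpen_ball hz]
      ext
      simp [(hder z hz).deriv, fderiv_eq_smul_deriv]) hs (Metric.mem_ball_self hR)
  simp only [hf0, neg_zero, Complex.exp_zero, mul_one] at hconst
  rw [← hconst, mul_assoc, ← Complex.exp_add, neg_add_cancel, Complex.exp_zero, mul_one]

/-- Local logarithms of an `L`-function without zeros in `Re s > 1/2`, with bounds. -/
lemma exists_log_LFunction (hχ : χ ≠ 1) (hnz : ∀ s : ℂ, 1 / 2 < s.re → χ.LFunction s ≠ 0)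
    {ε : ℝ} (hε : 0 < ε) (hε1 : ε ≤ 1) :
    ∃ K : ℝ, 0 < K ∧ ∀ s : ℂ, 1 / 2 + ε ≤ s.re → ∃ c : ℂ, 2 ≤ c.re ∧ ∃ f : ℂ → ℂ,
      (∀ w ∈ Metric.closedBall s (ε / 2), HasDerivAt f (logDeriv χ.LFunction w) w) ∧
      (∀ w ∈ Metric.closedBall s (ε / 2), ‖f w‖ ≤ K * quarticWeight s.im) ∧
      χ.LFunction s = χ.LFunction c * Complex.exp (f s) := by
  obtain ⟨C, hC, hL⟩ := exists_norm_LFunction_le hχ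
  set D : ℝ := 2 * (C * 3 * 6) ^ (1 / 2 : ℝ) with hD
  have hD0 : 0 < D := by positivity
  -- Borel–Carathéodory gives 2Mr/(R - r) with M = D times the weight, R = 3/2, r ≤ R and R - r ≥
  -- ε/2.
  refine ⟨6 * D / ε, by positivity, fun s hs ↦ ?_⟩
  -- At this centre |L| ≥ 1/3, and the disc of radius 3/2 around it stays in Re w > 1/2.
  set c : ℂ := (max s.re 2 : ℝ) + s.im * I with hc
  have hcre : c.re = max s.re 2 := by simp [hc]
  have hcim : c.im = s.im := by simp [hc]
  have hc2 : 2 ≤ c.re := by rw [hcre]; exact le_max_right _ _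
  have hball : ∀ w ∈ Metric.ball c (3 / 2), 1 / 2 < w.re ∧ |w.im| ≤ |s.im| + 3 / 2 := by
    intro w hw
    rw [Metric.mem_ball, Complex.dist_eq] at hw
    have h1 := (Complex.abs_re_le_norm (w - c)).trans_lt hw
    have h2 := (Complex.abs_im_le_norm (w - c)).trans_lt hw
    rw [Complex.sub_re, abs_lt] at h1
    rw [Complex.sub_im, hcim] at h2
    refine ⟨by linarith [h1.1], ?_⟩
    have := abs_add_le (w.im - s.im) s.im
    rw [sub_add_cancel] at this
    linarith
  obtain ⟨f, hf0, hfd, hfe⟩ := exists_log_on_ball (DirichletCharacter.differentiable_LFunction hχ)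
    (by norm_num : (0 : ℝ) < 3 / 2) (fun w hw ↦ hnz w (hball w hw).1)
  have hsub : ∀ w ∈ Metric.closedBall s (ε / 2), ‖w - c‖ ≤ 3 / 2 - ε / 2 := by
    intro w hw
    rw [Metric.mem_closedBall, Complex.dist_eq] at hw
    have h1 : ‖s - c‖ ≤ 3 / 2 - ε := by
      have : s - c = ((s.re - max s.re 2 : ℝ) : ℂ) := by
        apply Complex.ext <;> simp [hc]
      rw [this, Complex.norm_real, Real.norm_eq_abs, abs_le]
      rcases le_total s.re 2 with h | h
      · rw [max_eq_right h]; constructor <;> linarith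
      · rw [max_eq_left h]; constructor <;> linarith
    calc ‖w - c‖ = ‖(w - s) + (s - c)‖ := by ring_nf
      _ ≤ ‖w - s‖ + ‖s - c‖ := norm_add_le _ _
      _ ≤ _ := by linarith
  have hmem : ∀ w ∈ Metric.closedBall s (ε / 2), w ∈ Metric.ball c (3 / 2) := by
    intro w hw
    rw [Metric.mem_ball, Complex.dist_eq]
    linarith [hsub w hw]
  refine ⟨c, hc2, f, fun w hw ↦ hfd w (hmem w hw), fun w hw ↦ ?_,
    hfe s (hmem s (Metric.mem_closedBall_self (by positivity)))⟩
  set M : ℝ := D * quarticWeight s.im with hM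
  have hM0 : 0 < M := mul_pos hD0 (by linarith [one_le_quarticWeight s.im])
  have hre : ∀ z ∈ Metric.ball c (3 / 2), (f z).re ≤ M := by
    intro z hz
    obtain ⟨hz1, hz2⟩ := hball z hz
    have hLz := hL z (by linarith)
    have hc3 := one_third_le_norm_LFunction χ hc2
    have he : ‖χ.LFunction z‖ = ‖χ.LFunction c‖ * Real.exp (f z).re := by
      rw [hfe z hz, norm_mul, Complex.norm_exp]
    have hq : ‖z‖ / z.re ≤ 4 + 2 * |s.im| := by
      rw [div_le_iff₀ (by linarith)]
      have := Complex.norm_le_abs_re_add_abs_im z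
      rw [abs_of_pos (by linarith : 0 < z.re)] at this
      nlinarith [abs_nonneg s.im]
    have : Real.exp (f z).re ≤ C * 3 * (4 + 2 * |s.im|) := by
      have h1 : 1 / 3 * Real.exp (f z).re ≤ C * (4 + 2 * |s.im|) := by
        calc 1 / 3 * Real.exp (f z).re ≤ ‖χ.LFunction c‖ * Real.exp (f z).re := by gcongr
          _ = ‖χ.LFunction z‖ := he.symm
          _ ≤ C * ‖z‖ / z.re := hLz
          _ = C * (‖z‖ / z.re) := by ring
          _ ≤ _ := by gcongr
      linarith
    calc (f z).re ≤ Real.log (C * 3 * (4 + 2 * |s.im|)) := by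
          rwa [Real.le_log_iff_exp_le (by positivity)]
      _ ≤ M := log_mul_le_quarticWeight (by positivity) _
  have hg : DifferentiableOn ℂ (fun z ↦ f (c + z)) (Metric.ball 0 (3 / 2)) := by
    intro z hz
    have hz' : c + z ∈ Metric.ball c (3 / 2) := by simpa using hz
    exact ((hfd _ hz').comp_const_add c z).differentiableAt.differentiableWithinAt
  have hw' : w - c ∈ Metric.ball (0 : ℂ) (3 / 2) := by
    rw [mem_ball_zero_iff]; linarith [hsub w hw]
  have hbc := Complex.borelCaratheodory_zero hM0 hg
    (fun z hz ↦ hre (c + z) (by simpa using hz)) (by norm_num) hw' (by simpa using hf0)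
  rw [add_sub_cancel] at hbc
  refine hbc.trans ?_
  have hn := hsub w hw
  rw [div_le_iff₀ (by linarith)]
  have h1 : 2 * M * ‖w - c‖ ≤ 3 * M := by nlinarith
  have h2 : 3 * M ≤ 6 * D / ε * quarticWeight s.im * (3 / 2 - ‖w - c‖) := by
    have : 3 * M = 6 * D / ε * quarticWeight s.im * (ε / 2) := by
      rw [hM]; field_simp; ring
    rw [this]
    have : 0 ≤ 6 * D / ε * quarticWeight s.im := by
      have := one_le_quarticWeight s.im
      positivity
    apply mul_le_mul_of_nonneg_left _ this
    linarith
  exact h1.trans h2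

lemma exists_inv_norm_LFunction_le (hχ : χ ≠ 1)
    (hnz : ∀ s : ℂ, 1 / 2 < s.re → χ.LFunction s ≠ 0) {ε : ℝ} (hε : 0 < ε) (hε1 : ε ≤ 1) :
    ∃ K : ℝ, 0 < K ∧ ∀ s : ℂ, 1 / 2 + ε ≤ s.re →
      ‖χ.LFunction s‖⁻¹ ≤ 3 * Real.exp (K * quarticWeight s.im) := by
  obtain ⟨K, hK, h⟩ := exists_log_LFunction hχ hnz hε hε1
  refine ⟨K, hK, fun s hs ↦ ?_⟩
  obtain ⟨c, hc, f, -, hf, he⟩ := h s hs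
  have h1 := one_third_le_norm_LFunction χ hc
  have h2 := hf s (Metric.mem_closedBall_self (by positivity))
  rw [he, norm_mul, Complex.norm_exp, mul_inv, ← Real.exp_neg]
  have h3 : ‖χ.LFunction c‖⁻¹ ≤ 3 := by
    rw [inv_le_comm₀ (by linarith) (by norm_num)]; linarith
  gcongr
  linarith [neg_le_abs (f s).re, Complex.abs_re_le_norm (f s)]

lemma differentiableAt_logDeriv_LFunction (hχ : χ ≠ 1)
    (hnz : ∀ s : ℂ, 1 / 2 < s.re → χ.LFunction s ≠ 0) {s : ℂ} (hs : 1 / 2 < s.re) :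
    DifferentiableAt ℂ (logDeriv χ.LFunction) s :=
  ((DirichletCharacter.differentiable_LFunction hχ).analyticAt s).deriv.differentiableAt.div
    (DirichletCharacter.differentiable_LFunction hχ s) (hnz s hs)

/-- Cauchy's estimate for the local logarithm on a circle of radius ε/2. The next derivative is
handled in the same way from this bound at ε/2. -/
lemma exists_norm_logDeriv_LFunction_le (hχ : χ ≠ 1)
    (hnz : ∀ s : ℂ, 1 / 2 < s.re → χ.LFunction s ≠ 0) {ε : ℝ} (hε : 0 < ε) (hε1 : ε ≤ 1) :
    ∃ K : ℝ, 0 < K ∧ ∀ s : ℂ, 1 / 2 + ε ≤ s.re →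
      ‖logDeriv χ.LFunction s‖ ≤ K * quarticWeight s.im := by
  obtain ⟨K, hK, h⟩ := exists_log_LFunction hχ hnz hε hε1
  refine ⟨K / (ε / 2), by positivity, fun s hs ↦ ?_⟩
  obtain ⟨c, hc, f, hd, hf, -⟩ := h s hs
  have hd' : DiffContOnCl ℂ f (Metric.ball s (ε / 2)) := by
    refine DifferentiableOn.diffContOnCl fun w hw ↦ ?_
    rw [closure_ball _ (by positivity)] at hw
    exact (hd w hw).differentiableAt.differentiableWithinAt
  have := Complex.norm_deriv_le_of_forall_mem_sphere_norm_le (by positivity) hd'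
    (fun w hw ↦ hf w (Metric.sphere_subset_closedBall hw))
  rw [(hd s (Metric.mem_closedBall_self (by positivity))).deriv] at this
  calc _ ≤ _ := this
    _ = _ := by ring

lemma exists_norm_deriv_logDeriv_LFunction_le (hχ : χ ≠ 1)
    (hnz : ∀ s : ℂ, 1 / 2 < s.re → χ.LFunction s ≠ 0) {ε : ℝ} (hε : 0 < ε) (hε1 : ε ≤ 1) :
    ∃ K : ℝ, 0 < K ∧ ∀ s : ℂ, 1 / 2 + ε ≤ s.re →
      ‖deriv (logDeriv χ.LFunction) s‖ ≤ K * quarticWeight s.im := by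
  obtain ⟨K, hK, h⟩ := exists_norm_logDeriv_LFunction_le hχ hnz (ε := ε / 2) (by positivity)
    (by linarith)
  refine ⟨4 * K / (ε / 2), by positivity, fun s hs ↦ ?_⟩
  have hre : ∀ w ∈ Metric.closedBall s (ε / 2), 1 / 2 + ε / 2 ≤ w.re ∧ |w.im - s.im| ≤ 1 := by
    intro w hw
    rw [Metric.mem_closedBall, Complex.dist_eq] at hw
    have h1 := (Complex.abs_re_le_norm (w - s)).trans hw
    have h2 := (Complex.abs_im_le_norm (w - s)).trans hw
    rw [Complex.sub_re, abs_le] at h1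
    rw [Complex.sub_im] at h2
    exact ⟨by linarith [h1.1], by linarith⟩
  have hd' : DiffContOnCl ℂ (logDeriv χ.LFunction) (Metric.ball s (ε / 2)) := by
    refine DifferentiableOn.diffContOnCl fun w hw ↦ ?_
    rw [closure_ball _ (by positivity)] at hw
    exact (differentiableAt_logDeriv_LFunction hχ hnz
      (by linarith [(hre w hw).1])).differentiableWithinAt
  have := Complex.norm_deriv_le_of_forall_mem_sphere_norm_le (C := 4 * K * quarticWeight s.im)
    (by positivity) hd' (fun w hw ↦ ?_)
  · calc _ ≤ _ := this
      _ = _ := by ring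
  · obtain ⟨h1, h2⟩ := hre w (Metric.sphere_subset_closedBall hw)
    have h3 := quarticWeight_le_of_abs_le h2 s.im
    rw [add_sub_cancel] at h3
    calc _ ≤ K * quarticWeight w.im := h w h1
      _ ≤ K * (4 * quarticWeight s.im) := by gcongr
      _ = _ := by ring

end

end

/-! ### Monotonicity of the completed L-function of a primitive character. -/

section

open Complex Filter Topology MeasureTheory

lemma exists_norm_gammaFactor_eq {q : ℕ} (χ : DirichletCharacter ℂ q) :
    ∃ a : ℝ, 0 ≤ a ∧ a ≤ 1 ∧ ∀ s : ℂ,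
      ‖χ.gammaFactor s‖ = Real.pi ^ (-(s.re + a) / 2) * ‖Gamma ((s + a) / 2)‖ := by
  have key : ∀ s : ℂ, ‖Gammaℝ s‖ = Real.pi ^ (-s.re / 2) * ‖Gamma (s / 2)‖ := by
    intro s
    rw [Gammaℝ_def, norm_mul, Complex.norm_cpow_eq_rpow_re_of_pos Real.pi_pos]
    simp
  rcases χ.even_or_odd with h | h
  · refine ⟨0, le_rfl, zero_le_one, fun s ↦ ?_⟩
    rw [h.gammaFactor_def, key]; simp
  · refine ⟨1, zero_le_one, le_rfl, fun s ↦ ?_⟩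
    rw [h.gammaFactor_def, key]; simp

lemma rpow_div_le {x x₀ h : ℝ} (hx₀ : 0 < x₀) (hx : x₀ ≤ x) (hh : 0 < h) :
    (x + h) ^ (1 - h) / x ≤ (1 + h / x₀) * (x + h) ^ (-h) := by
  have hx' : 0 < x := hx₀.trans_le hx
  rw [show 1 - h = 1 + -h by ring, Real.rpow_add (by linarith), Real.rpow_one, mul_div_right_comm]
  refine mul_le_mul_of_nonneg_right ?_ (Real.rpow_nonneg (by linarith) _)
  rw [add_div, div_self hx'.ne']
  gcongr

section

variable {q : ℕ} [NeZero q] {χ : DirichletCharacter ℂ q}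

lemma completedLFunction_ne_zero (hnz : ∀ s : ℂ, 1 / 2 < s.re → χ.LFunction s ≠ 0) {s : ℂ}
    (hs : 1 / 2 < s.re) : χ.completedLFunction s ≠ 0 := by
  rw [completedLFunction_eq_mul χ (by linarith)]
  exact mul_ne_zero (gammaFactor_ne_zero χ (by linarith)) (hnz s hs)

/-- The completed `L`-function at the point shifted to the left, relative to the one at the point
shifted to the right. -/
noncomputable def completedRatio (χ : DirichletCharacter ℂ q) (h : ℝ) (z : ℂ) : ℂ :=
  χ.completedLFunction (1 / 2 - h + z) / χ.completedLFunction (1 / 2 + h + z)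

/-- This supplies the a priori input for Phragmén–Lindelöf. The Gamma quotient gives the power (Re
z/2 + h)^(-h), which forces decay along the positive real axis; the L-quotient contributes at most
exponential growth. -/
lemma exists_norm_completedRatio_le (hχ : χ ≠ 1)
    (hnz : ∀ s : ℂ, 1 / 2 < s.re → χ.LFunction s ≠ 0) {h : ℝ} (hh : 0 < h) (hh' : h < 1 / 2) :
    ∃ A K : ℝ, 0 < A ∧ 0 < K ∧ ∀ z : ℂ, 0 ≤ z.re → ‖completedRatio χ h z‖ ≤
      A * (z.re / 2 + h) ^ (-h) * (‖1 / 2 - h + z‖ / (1 / 2 - h + z.re)) *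
        Real.exp (K * quarticWeight z.im) := by
  obtain ⟨a, ha, ha', hγ⟩ := exists_norm_gammaFactor_eq χ
  obtain ⟨C, hC, hL⟩ := exists_norm_LFunction_le hχ
  obtain ⟨K, hK, hI⟩ := exists_inv_norm_LFunction_le hχ hnz hh (by linarith)
  set x₀ : ℝ := (1 / 2 - h) / 2 with hx₀def
  have hx₀ : 0 < x₀ := by rw [hx₀def]; linarith
  refine ⟨Real.pi ^ h * (1 + h / x₀) * (C * 3), K, by positivity, hK, fun z hz ↦ ?_⟩
  set s : ℂ := 1 / 2 - h + z with hs
  have hsre : s.re = 1 / 2 - h + z.re := by simp [hs]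
  have hsim : s.im = z.im := by simp [hs]
  have hs2 : (1 / 2 + h + z : ℂ) = s + (2 * h : ℝ) := by rw [hs]; push_cast; ring
  have hs2re : (s + (2 * h : ℝ)).re = 1 / 2 + h + z.re := by rw [add_re, hsre, ofReal_re]; ring
  have hs2im : (s + (2 * h : ℝ)).im = z.im := by rw [add_im, hsim, ofReal_im]; ring
  have hspos : 0 < s.re := by rw [hsre]; linarith
  have hγne := norm_pos_iff.mpr (gammaFactor_ne_zero χ (s := s + (2 * h : ℝ)) (by rw [hs2re]; linarith))
  have hx : ((s + a) / 2).re = (s.re + a) / 2 := by simp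
  have hgam : ‖χ.gammaFactor s‖ ≤ ‖χ.gammaFactor (s + (2 * h : ℝ))‖ *
      (Real.pi ^ h * ((1 + h / x₀) * (z.re / 2 + h) ^ (-h))) := by
    have h1 := norm_Gamma_ratio_le (z := (s + a) / 2) (by rw [hx]; linarith) hh (by linarith)
    have h2 := rpow_div_le (x := ((s + a) / 2).re) (x₀ := x₀) (h := h) hx₀
      (by rw [hx, hsre, hx₀def]; linarith) hh
    have h3 : (((s + a) / 2).re + h) ^ (-h) ≤ (z.re / 2 + h) ^ (-h) := by
      apply Real.rpow_le_rpow_of_nonpos (by linarith) _ (by linarith)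
      rw [hx, hsre]; linarith
    have e1 : (s + (2 * h : ℝ) + a) / 2 = (s + a) / 2 + h := by push_cast; ring
    rw [hγ, hγ, e1, hs2re, hsre]
    have e2 : Real.pi ^ (-(1 / 2 - h + z.re + a) / 2) =
        Real.pi ^ (-(1 / 2 + h + z.re + a) / 2) * Real.pi ^ h := by
      rw [← Real.rpow_add Real.pi_pos]; ring_nf
    rw [e2]
    calc Real.pi ^ (-(1 / 2 + h + z.re + a) / 2) * Real.pi ^ h * ‖Gamma ((s + a) / 2)‖
        ≤ Real.pi ^ (-(1 / 2 + h + z.re + a) / 2) * Real.pi ^ h *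
          (‖Gamma ((s + a) / 2 + h)‖ * ((1 + h / x₀) * (z.re / 2 + h) ^ (-h))) := by
          gcongr
          refine h1.trans ?_
          gcongr
          refine h2.trans ?_
          gcongr
      _ = _ := by ring
  have hLs := hL s hspos
  have hIs := hI (s + (2 * h : ℝ)) (by rw [hs2re]; linarith)
  rw [hs2im] at hIs
  rw [hsre] at hLs
  rw [completedRatio, hs2, ← hs, completedLFunction_eq_mul χ hspos,
    completedLFunction_eq_mul χ (by rw [hs2re]; linarith), norm_div, norm_mul, norm_mul, mul_div_mul_comm,
    div_eq_mul_inv ‖χ.LFunction s‖]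
  calc ‖χ.gammaFactor s‖ / ‖χ.gammaFactor (s + (2 * h : ℝ))‖ *
        (‖χ.LFunction s‖ * ‖χ.LFunction (s + (2 * h : ℝ))‖⁻¹)
      ≤ (Real.pi ^ h * ((1 + h / x₀) * (z.re / 2 + h) ^ (-h))) *
        (C * ‖s‖ / (1 / 2 - h + z.re) * (3 * Real.exp (K * quarticWeight z.im))) := by
        gcongr
        · rw [div_le_iff₀' hγne]; exact hgam
    _ = _ := by ring

lemma quarticWeight_im_le (z : ℂ) : quarticWeight z.im ≤ 1 + ‖z‖ := by
  have h1 := Complex.abs_im_le_norm z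
  have h2 : 1 + z.im ^ 2 ≤ (1 + ‖z‖) ^ 2 := by
    rw [← sq_abs]; nlinarith [abs_nonneg z.im, norm_nonneg z]
  calc quarticWeight z.im ≤ ((1 + ‖z‖) ^ 2) ^ (1 / 4 : ℝ) := by
        unfold quarticWeight; gcongr
    _ ≤ ((1 + ‖z‖) ^ 2) ^ (1 / 2 : ℝ) :=
        Real.rpow_le_rpow_of_exponent_le (by nlinarith [norm_nonneg z]) (by norm_num)
    _ = 1 + ‖z‖ := by
        rw [← Real.sqrt_eq_rpow, Real.sqrt_sq (by positivity)]

/-- The denominator is taken at real part at least 1/2 + h and has no zeros there. On Re z = 0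
numerator and denominator are mirror images in the critical line, so the modulus equals q^h. Growth
of order one and decay on the real axis then allow Phragmén–Lindelöf in the half plane. -/
lemma norm_completedRatio_le (hχ : χ ≠ 1) (hp : χ.IsPrimitive)
    (hnz : ∀ s : ℂ, 1 / 2 < s.re → χ.LFunction s ≠ 0) {h : ℝ} (hh : 0 < h) (hh' : h < 1 / 2)
    {z : ℂ} (hz : 0 ≤ z.re) : ‖completedRatio χ h z‖ ≤ (q : ℝ) ^ h := by
  have hclosure : closure {z : ℂ | 0 < z.re} = {z : ℂ | 0 ≤ z.re} :=
    Complex.closure_setOfPred_lt_re 0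
  obtain ⟨A, K, hA, hK, hb⟩ := exists_norm_completedRatio_le hχ hnz hh hh'
  refine PhragmenLindelof.right_half_plane_of_tendsto_zero_on_real (f := completedRatio χ h)
    ?_ ?_ ?_ ?_ hz
  · refine DifferentiableOn.diffContOnCl fun z hz ↦ ?_
    rw [hclosure] at hz
    refine DifferentiableAt.differentiableWithinAt ?_
    have hd := DirichletCharacter.differentiable_completedLFunction hχ
    refine DifferentiableAt.div (by fun_prop) (by fun_prop) (completedLFunction_ne_zero hnz ?_)
    have : (0 : ℝ) ≤ z.re := hz
    simp; linarith
  · refine ⟨1, by norm_num, K + 1, Asymptotics.IsBigO.of_bound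
      (A * h ^ (-h) / (1 / 2 - h) * Real.exp K) ?_⟩
    refine eventually_inf_principal.mpr (Eventually.of_forall fun z hz ↦ ?_)
    have hz' : (0 : ℝ) < z.re := hz
    refine (hb z hz'.le).trans ?_
    have h1 : (z.re / 2 + h) ^ (-h) ≤ h ^ (-h) :=
      Real.rpow_le_rpow_of_nonpos hh (by linarith) (by linarith)
    have h2 : ‖(1 / 2 - h + z : ℂ)‖ ≤ Real.exp ‖z‖ := by
      calc ‖(1 / 2 - h + z : ℂ)‖ ≤ ‖((1 / 2 - h : ℝ) : ℂ)‖ + ‖z‖ := by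
            refine le_trans (le_of_eq ?_) (norm_add_le _ _); push_cast; rfl
        _ ≤ 1 + ‖z‖ := by
            rw [Complex.norm_real, Real.norm_eq_abs, abs_of_pos (by linarith)]; linarith
        _ ≤ _ := by linarith [Real.add_one_le_exp ‖z‖]
    have h3 : Real.exp (K * quarticWeight z.im) ≤ Real.exp (K + K * ‖z‖) := by
      apply Real.exp_le_exp.mpr
      nlinarith [quarticWeight_im_le z]
    calc A * (z.re / 2 + h) ^ (-h) * (‖(1 / 2 - h + z : ℂ)‖ / (1 / 2 - h + z.re)) *
          Real.exp (K * quarticWeight z.im)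
        ≤ A * h ^ (-h) * (Real.exp ‖z‖ / (1 / 2 - h)) * Real.exp (K + K * ‖z‖) := by
          have : 0 < 1 / 2 - h := by linarith
          gcongr
          linarith
      _ = A * h ^ (-h) / (1 / 2 - h) * Real.exp K * Real.exp ((K + 1) * ‖z‖) := by
          rw [Real.exp_add, show (K + 1) * ‖z‖ = K * ‖z‖ + ‖z‖ by ring, Real.exp_add (K * ‖z‖)]
          ring
      _ = _ := by
          rw [Real.rpow_one, Real.norm_of_nonneg (Real.exp_pos _).le]
  · have hlim : Tendsto (fun x : ℝ ↦ A * (x / 2 + h) ^ (-h) * Real.exp (K * quarticWeight 0))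
        atTop (𝓝 0) := by
      have h1 : Tendsto (fun x : ℝ ↦ x / 2 + h) atTop atTop :=
        tendsto_atTop_add_const_right _ _ (tendsto_id.atTop_div_const (by norm_num))
      have h2 := (tendsto_rpow_neg_atTop hh).comp h1
      simpa using (h2.const_mul A).mul_const (Real.exp (K * quarticWeight 0))
    refine squeeze_zero_norm' ?_ hlim
    filter_upwards [eventually_gt_atTop 0] with x hx
    have := hb x (by simpa using hx.le)
    simp only [ofReal_re, ofReal_im] at this
    have e : ‖(1 / 2 - h + x : ℂ)‖ / (1 / 2 - h + x) = 1 := by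
      rw [show (1 / 2 - h + x : ℂ) = ((1 / 2 - h + x : ℝ) : ℂ) by push_cast; rfl, Complex.norm_real,
        Real.norm_eq_abs, abs_of_pos (by linarith), div_self (by linarith)]
    rwa [e, mul_one] at this
  · intro x
    have hs := norm_completedLFunction_symm hχ hp h x
    push_cast at hs
    rw [completedRatio, norm_div, hs, mul_div_assoc, div_self, mul_one]
    refine norm_ne_zero_iff.mpr (completedLFunction_ne_zero hnz ?_)
    simp; linarith

/-- Take h = d/2 and choose z so that the two points of the quotient are s and s + d. The condition
d < 1 reflects h < 1/2, which keeps the left point in Re > 0. -/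
lemma norm_completedLFunction_step (hχ : χ ≠ 1) (hp : χ.IsPrimitive)
    (hnz : ∀ s : ℂ, 1 / 2 < s.re → χ.LFunction s ≠ 0) {s : ℂ} (hs : 1 / 2 ≤ s.re) {d : ℝ}
    (hd : 0 < d) (hd' : d < 1) :
    ‖χ.completedLFunction s‖ ≤ (q : ℝ) ^ (d / 2) * ‖χ.completedLFunction (s + d)‖ := by
  have h := norm_completedRatio_le hχ hp hnz (h := d / 2) (by linarith) (by linarith)
    (z := s + ((d / 2 - 1 / 2 : ℝ) : ℂ)) (by simp; linarith)
  rw [completedRatio] at h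
  rw [show (1 / 2 - ((d / 2 : ℝ) : ℂ) + (s + ((d / 2 - 1 / 2 : ℝ) : ℂ))) = s by push_cast; ring,
    show (1 / 2 + ((d / 2 : ℝ) : ℂ) + (s + ((d / 2 - 1 / 2 : ℝ) : ℂ))) = s + d by
      push_cast; ring, norm_div, div_le_iff₀] at h
  · exact h
  · refine norm_pos_iff.mpr (completedLFunction_ne_zero hnz ?_)
    simp; linarith

/-- Monotonicity of the completed `L`-function of a primitive character to the right of the
critical line, when there are no zeros there. -/
lemma norm_completedLFunction_mono (hχ : χ ≠ 1) (hp : χ.IsPrimitive)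
    (hnz : ∀ s : ℂ, 1 / 2 < s.re → χ.LFunction s ≠ 0) {s : ℂ} (hs : 1 / 2 ≤ s.re) {d : ℝ}
    (hd : 0 ≤ d) :
    ‖χ.completedLFunction s‖ ≤ (q : ℝ) ^ (d / 2) * ‖χ.completedLFunction (s + d)‖ := by
  rcases hd.eq_or_lt with rfl | hd
  · simp
  have hq0 : (0 : ℝ) < q := by exact_mod_cast NeZero.pos q
  -- A long shift is split into n equal steps of length d/n < 1.
  obtain ⟨n, hn⟩ := exists_nat_gt d
  have hn0 : (0 : ℝ) < n := hd.trans hn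
  set e : ℝ := d / n with he
  have he0 : 0 < e := by positivity
  have he1 : e < 1 := by rw [he, div_lt_one hn0]; exact hn
  have key : ∀ k : ℕ, ‖χ.completedLFunction s‖ ≤
      (q : ℝ) ^ (k * e / 2) * ‖χ.completedLFunction (s + (k * e : ℝ))‖ := by
    intro k
    induction k with
    | zero => simp
    | succ k ih =>
      have h1 := norm_completedLFunction_step hχ hp hnz (s := s + (k * e : ℝ))
        (by rw [add_re, ofReal_re]; have : 0 ≤ k * e := by positivity
            linarith) he0 he1
      calc _ ≤ _ := ih
        _ ≤ (q : ℝ) ^ (k * e / 2) * ((q : ℝ) ^ (e / 2) *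
            ‖χ.completedLFunction (s + (k * e : ℝ) + e)‖) := by gcongr
        _ = _ := by
          rw [← mul_assoc, ← Real.rpow_add hq0]
          push_cast
          ring_nf
  have := key n
  rwa [he, mul_div_cancel₀ _ hn0.ne'] at this

lemma norm_LFunction_mono_of_isPrimitive (hχ : χ ≠ 1) (hp : χ.IsPrimitive)
    (hnz : ∀ s : ℂ, 1 / 2 < s.re → χ.LFunction s ≠ 0) :
    ∃ a : ℝ, 0 ≤ a ∧ a ≤ 1 ∧ ∀ s : ℂ, 1 / 2 ≤ s.re → ∀ d : ℝ, 0 ≤ d →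
      ‖Gamma ((s + a) / 2)‖ * ‖χ.LFunction s‖ ≤ ((q : ℝ) / Real.pi) ^ (d / 2) *
        (‖Gamma ((s + d + a) / 2)‖ * ‖χ.LFunction (s + d)‖) := by
  obtain ⟨a, ha, ha', hγ⟩ := exists_norm_gammaFactor_eq χ
  refine ⟨a, ha, ha', fun s hs d hd ↦ ?_⟩
  have hre : (s + d).re = s.re + d := by simp
  have h := norm_completedLFunction_mono hχ hp hnz hs hd
  rw [completedLFunction_eq_mul χ (by linarith), completedLFunction_eq_mul χ (by rw [hre]; linarith),
    norm_mul, norm_mul, hγ, hγ, hre] at h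
  have e : Real.pi ^ (-(s.re + d + a) / 2) = Real.pi ^ (-(s.re + a) / 2) / Real.pi ^ (d / 2) := by
    rw [← Real.rpow_sub Real.pi_pos]; ring_nf
  rw [e] at h
  have hP : 0 < Real.pi ^ (-(s.re + a) / 2) := Real.rpow_pos_of_pos Real.pi_pos _
  refine le_of_mul_le_mul_left ?_ hP
  rw [Real.div_rpow (Nat.cast_nonneg q) Real.pi_pos.le]
  calc _ = _ := by rw [mul_assoc]
    _ ≤ _ := h
    _ = _ := by ring

end

end

/-! ### Imprimitive characters and the consequences of GRH for log|L| and Re L'/L. -/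

section

open Complex Filter Topology MeasureTheory

/-- With u = ε p^(-s) and ρ = p^(-d), the identity |1 - ρu|² - ρ|1 - u|² = (1 - ρ)(1 - ρ|u|²) has a
nonnegative right side. -/
lemma norm_one_sub_mul_le {ε : ℂ} (hε : ‖ε‖ = 1) {p : ℕ} (hp : 0 < p) {s : ℂ} (hs : 0 ≤ s.re)
    {d : ℝ} (hd : 0 ≤ d) :
    ‖1 - ε * (p : ℂ) ^ (-s)‖ ≤
      (p : ℝ) ^ (d / 2) * ‖1 - ε * (p : ℂ) ^ (-(s + d))‖ := by
  have hp1 : (1 : ℝ) ≤ p := by exact_mod_cast hp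
  have hp0 : (p : ℂ) ≠ 0 := by exact_mod_cast hp.ne'
  set u : ℂ := ε * (p : ℂ) ^ (-s) with hu
  set ρ : ℝ := (p : ℝ) ^ (-d) with hρ
  have hρ0 : 0 < ρ := by positivity
  have hρ1 : ρ ≤ 1 := Real.rpow_le_one_of_one_le_of_nonpos hp1 (by linarith)
  have hur : ‖u‖ ≤ 1 := by
    rw [hu, norm_mul, hε, one_mul, Complex.norm_natCast_cpow_of_pos hp]
    exact Real.rpow_le_one_of_one_le_of_nonpos hp1 (by simpa using hs)
  have hv : ε * (p : ℂ) ^ (-(s + d)) = ρ * u := by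
    rw [neg_add, Complex.cpow_add _ _ hp0, hρ, hu, Complex.ofReal_cpow (by linarith)]
    push_cast; ring
  rw [hv]
  have hpd : (p : ℝ) ^ (d / 2) = √(1 / ρ) := by
    rw [hρ, Real.rpow_neg (by linarith), one_div, inv_inv, Real.sqrt_eq_rpow,
      ← Real.rpow_mul (by linarith)]
    ring_nf
  have hu2 : u.re * u.re + u.im * u.im ≤ 1 := by
    rw [← Complex.normSq_apply, Complex.normSq_eq_norm_sq]
    nlinarith [norm_nonneg u]
  rw [hpd, ← sq_le_sq₀ (norm_nonneg _) (by positivity), mul_pow, Real.sq_sqrt (by positivity),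
    ← Complex.normSq_eq_norm_sq, ← Complex.normSq_eq_norm_sq, Complex.normSq_apply,
    Complex.normSq_apply, one_div, ← div_eq_inv_mul, le_div_iff₀ hρ0]
  simp only [sub_re, one_re, sub_im, one_im, mul_re, ofReal_re, ofReal_im, zero_mul, sub_zero,
    mul_im, add_zero]
  nlinarith [mul_nonneg (sub_nonneg.mpr hρ1) (sub_nonneg.mpr
    ((mul_le_one₀ hρ1 (by nlinarith [mul_self_nonneg u.re, mul_self_nonneg u.im]) hu2)))]

lemma primitiveCharacter_ne_one {q : ℕ} {χ : DirichletCharacter ℂ q} (hχ : χ ≠ 1) : χ.primitiveCharacter ≠ 1 := by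
  intro h1
  apply hχ
  rw [← χ.changeLevel_primitiveCharacter, h1, map_one]

/-- The logarithm of the absolute value of a holomorphic function along a horizontal line. -/
lemma hasDerivAt_log_norm {F : ℂ → ℂ} {s : ℂ} {x : ℝ} (hF : DifferentiableAt ℂ F (s + x))
    (h0 : F (s + x) ≠ 0) :
    HasDerivAt (fun d : ℝ ↦ Real.log ‖F (s + d)‖) (logDeriv F (s + x)).re x := by
  have h1 : HasDerivAt (fun d : ℝ ↦ s + d) 1 x :=
    (Complex.ofRealCLM.hasDerivAt (x := x)).const_add s
  have h2 : HasDerivAt (fun d : ℝ ↦ F (s + d) / F (s + x)) (deriv F (s + x) / F (s + x)) x := by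
    have := (hF.hasDerivAt.comp_of_eq x h1 rfl).div_const (F (s + x))
    simpa using this
  have h3 := h2.clog_real (by rw [div_self h0]; exact Complex.one_mem_slitPlane)
  rw [div_self h0, div_one] at h3
  have h4 := (Complex.reCLM.hasFDerivAt.comp_hasDerivAt x h3).add_const (Real.log ‖F (s + x)‖)
  refine (h4.congr_of_eventuallyEq ?_).congr_deriv ?_
  · have hne : ∀ᶠ d : ℝ in 𝓝 x, F (s + d) ≠ 0 :=
      (hF.continuousAt.comp_of_eq h1.continuousAt rfl).eventually_ne h0
    filter_upwards [hne] with d hd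
    simp only [Function.comp, Complex.reCLM_apply, Complex.log_re, norm_div]
    rw [Real.log_div (norm_ne_zero_iff.mpr hd) (norm_ne_zero_iff.mpr h0)]
    ring
  · simp [logDeriv_apply]

section

variable {q : ℕ} [NeZero q] {χ : DirichletCharacter ℂ q}

lemma LFunction_eq_primitiveCharacter_mul (hχ : χ ≠ 1) [NeZero χ.conductor] (s : ℂ) :
    χ.LFunction s = χ.primitiveCharacter.LFunction s *
      ∏ p ∈ q.primeFactors, (1 - χ.primitiveCharacter p * (p : ℂ) ^ (-s)) := by
  have h := DirichletCharacter.LFunction_changeLevel χ.conductor_dvd_level χ.primitiveCharacter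
    (s := s) (Or.inl ?_)
  · rwa [χ.changeLevel_primitiveCharacter] at h
  · intro h1
    apply hχ
    rw [← χ.changeLevel_primitiveCharacter, h1, map_one]

lemma GRHModulus.LFunction_ne_zero (h : GRHModulus q) (hχ : χ ≠ 1) {s : ℂ} (hs : 1 / 2 < s.re) :
    χ.LFunction s ≠ 0 := by
  intro h0
  rcases lt_or_ge s.re 1 with h1 | h1
  · exact absurd (h χ s h0 (by linarith) h1) hs.ne'
  · exact χ.LFunction_ne_zero_of_one_le_re (Or.inl hχ) h1 h0

/-- Each nontrivial missing Euler factor costs p^(d/2). The primes concerned are coprime to the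
conductor, so their product together with the conductor still divides q. -/
lemma conductor_mul_prod_le [NeZero χ.conductor] (χ₀ : DirichletCharacter ℂ χ.conductor) :
    χ.conductor * ∏ p ∈ q.primeFactors.filter fun p : ℕ ↦ χ₀ (p : ZMod χ.conductor) ≠ 0, p ≤ q := by
  refine Nat.le_of_dvd (NeZero.pos q) (Nat.Coprime.mul_dvd_of_dvd_of_dvd ?_
    χ.conductor_dvd_level ?_)
  · refine Nat.Coprime.prod_right fun p hp ↦ ?_
    have h1 := (Finset.mem_filter.mp hp).2
    have h2 : IsUnit (p : ZMod χ.conductor) := by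
      by_contra h3
      exact h1 (χ₀.map_nonunit h3)
    exact ((ZMod.isUnit_iff_coprime _ _).mp h2).symm
  · exact (Finset.prod_dvd_prod_of_subset _ _ _ (Finset.filter_subset _ _)).trans
      (Nat.prod_primeFactors_dvd q)

/-- Under GRH, `‖(q/π)^{s/2} Γ((s+a)/2) L(s, χ)‖` increases with `Re s ≥ 1/2`. -/
lemma GRHModulus.norm_LFunction_mono (h : GRHModulus q) (hχ : χ ≠ 1) :
    ∃ a : ℝ, 0 ≤ a ∧ a ≤ 1 ∧ ∀ s : ℂ, 1 / 2 ≤ s.re → ∀ d : ℝ, 0 ≤ d →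
      ‖Gamma ((s + a) / 2)‖ * ‖χ.LFunction s‖ ≤ ((q : ℝ) / Real.pi) ^ (d / 2) *
        (‖Gamma ((s + d + a) / 2)‖ * ‖χ.LFunction (s + d)‖) := by
  have hc0 : χ.conductor ≠ 0 := fun h0 ↦ NeZero.ne q (Nat.eq_zero_of_zero_dvd
    (h0 ▸ χ.conductor_dvd_level))
  have : NeZero χ.conductor := ⟨hc0⟩
  set χ₀ := χ.primitiveCharacter with hχ₀
  have hχ₀1 : χ₀ ≠ 1 := primitiveCharacter_ne_one hχ
  -- A zero of the primitive L-function is also a zero of L(s, χ), so GRH modulo q is enough.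
  have hnz : ∀ s : ℂ, 1 / 2 < s.re → χ₀.LFunction s ≠ 0 := by
    intro s hs h0
    apply h.LFunction_ne_zero hχ hs
    rw [LFunction_eq_primitiveCharacter_mul hχ, ← hχ₀, h0, zero_mul]
  obtain ⟨a, ha, ha', hm⟩ := norm_LFunction_mono_of_isPrimitive hχ₀1
    χ.primitiveCharacter_isPrimitive hnz
  refine ⟨a, ha, ha', fun s hs d hd ↦ ?_⟩
  have hm := hm s hs d hd
  set P := q.primeFactors.filter fun p : ℕ ↦ χ₀ (p : ZMod χ.conductor) ≠ 0 with hP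
  have hprod : ∀ s : ℂ, ∏ p ∈ q.primeFactors, (1 - χ₀ p * (p : ℂ) ^ (-s)) =
      ∏ p ∈ P, (1 - χ₀ p * (p : ℂ) ^ (-s)) := by
    intro s
    symm
    refine Finset.prod_subset (Finset.filter_subset _ _) fun p hp hp' ↦ ?_
    have : χ₀ (p : ZMod χ.conductor) = 0 := by
      by_contra h1
      exact hp' (Finset.mem_filter.mpr ⟨hp, h1⟩)
    rw [this, zero_mul, sub_zero]
  have hPle : ‖∏ p ∈ P, (1 - χ₀ p * (p : ℂ) ^ (-s))‖ ≤ ((∏ p ∈ P, p : ℕ) : ℝ) ^ (d / 2) *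
      ‖∏ p ∈ P, (1 - χ₀ p * (p : ℂ) ^ (-(s + d)))‖ := by
    rw [norm_prod, norm_prod, Nat.cast_prod, ← Real.finsetProd_rpow _ _ (fun _ _ ↦ Nat.cast_nonneg _),
      ← Finset.prod_mul_distrib]
    refine Finset.prod_le_prod (fun _ _ ↦ norm_nonneg _) fun p hp ↦ ?_
    obtain ⟨hp1, hp2⟩ := Finset.mem_filter.mp hp
    have hunit : IsUnit (p : ZMod χ.conductor) := by
      by_contra h3
      exact hp2 (χ₀.map_nonunit h3)
    refine norm_one_sub_mul_le ?_ (Nat.pos_of_mem_primeFactors hp1) (by linarith) hd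
    obtain ⟨u, hu⟩ := hunit
    rw [← hu]
    exact χ₀.unit_norm_eq_one u
  have hcle : (χ.conductor : ℝ) * ((∏ p ∈ P, p : ℕ) : ℝ) ≤ q := by
    exact_mod_cast conductor_mul_prod_le χ₀
  have hqle : ((χ.conductor : ℝ) / Real.pi) ^ (d / 2) * ((∏ p ∈ P, p : ℕ) : ℝ) ^ (d / 2) ≤
      ((q : ℝ) / Real.pi) ^ (d / 2) := by
    have hpi := Real.pi_pos
    rw [← Real.mul_rpow (by positivity) (by positivity)]
    refine Real.rpow_le_rpow (by positivity) ?_ (by positivity)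
    rw [div_mul_eq_mul_div]
    gcongr
  rw [LFunction_eq_primitiveCharacter_mul hχ, LFunction_eq_primitiveCharacter_mul hχ, ← hχ₀, hprod,
    hprod, norm_mul, norm_mul]
  calc ‖Gamma ((s + a) / 2)‖ * (‖χ₀.LFunction s‖ * ‖∏ p ∈ P, (1 - χ₀ p * (p : ℂ) ^ (-s))‖)
      = ‖Gamma ((s + a) / 2)‖ * ‖χ₀.LFunction s‖ * ‖∏ p ∈ P, (1 - χ₀ p * (p : ℂ) ^ (-s))‖ := by ring
    _ ≤ (((χ.conductor : ℝ) / Real.pi) ^ (d / 2) *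
        (‖Gamma ((s + d + a) / 2)‖ * ‖χ₀.LFunction (s + d)‖)) *
        (((∏ p ∈ P, p : ℕ) : ℝ) ^ (d / 2) *
          ‖∏ p ∈ P, (1 - χ₀ p * (p : ℂ) ^ (-(s + d)))‖) := by gcongr
    _ = (((χ.conductor : ℝ) / Real.pi) ^ (d / 2) * ((∏ p ∈ P, p : ℕ) : ℝ) ^ (d / 2)) *
        (‖Gamma ((s + d + a) / 2)‖ * (‖χ₀.LFunction (s + d)‖ *
          ‖∏ p ∈ P, (1 - χ₀ p * (p : ℂ) ^ (-(s + d)))‖)) := by ring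
    _ ≤ _ := by gcongr

/-- Comparison of `log ‖L‖` along a horizontal segment, for bounded real part. -/
lemma GRHModulus.log_norm_LFunction_le (h : GRHModulus q) (hχ : χ ≠ 1) {s : ℂ}
    (hs : 1 / 2 ≤ s.re) {d : ℝ} (hd : 0 ≤ d) (hsd : s.re + d ≤ 4) (h0 : χ.LFunction s ≠ 0) :
    Real.log ‖χ.LFunction s‖ ≤
      Real.log ‖χ.LFunction (s + d)‖ + d / 2 * (Real.log q + Real.posLog s.im) := by
  obtain ⟨a, ha, ha', hm⟩ := h.norm_LFunction_mono hχ
  have h1 := hm s hs d hd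
  have h2 := norm_Gamma_add_le_pi ha ha' hs hd hsd
  have hG : 0 < ‖Gamma ((s + a) / 2)‖ := by
    refine norm_pos_iff.mpr (Gamma_ne_zero_of_re_pos ?_)
    simp; linarith
  have hq0 : (0 : ℝ) < q := by exact_mod_cast NeZero.pos q
  have hL : 0 < ‖χ.LFunction s‖ := norm_pos_iff.mpr h0
  have h3 : ‖χ.LFunction s‖ ≤ ((q : ℝ) / Real.pi) ^ (d / 2) *
      Real.exp (d / 2 * (Real.log Real.pi + Real.posLog s.im)) * ‖χ.LFunction (s + d)‖ := by
    refine le_of_mul_le_mul_left (h1.trans ?_) hG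
    calc _ ≤ ((q : ℝ) / Real.pi) ^ (d / 2) * (‖Gamma ((s + a) / 2)‖ *
          Real.exp (d / 2 * (Real.log Real.pi + Real.posLog s.im)) * ‖χ.LFunction (s + d)‖) := by
          gcongr
      _ = _ := by ring
  have hL' : 0 < ‖χ.LFunction (s + d)‖ := by
    by_contra h4
    have : ‖χ.LFunction (s + d)‖ = 0 := le_antisymm (not_lt.mp h4) (norm_nonneg _)
    rw [this, mul_zero] at h3
    linarith
  have h5 := Real.log_le_log hL h3
  have hpi := Real.pi_pos
  -- The log π from the Gamma comparison cancels the one in (q/π)^(d/2), leaving no additive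
  -- constant.
  rw [Real.log_mul (by positivity) hL'.ne', Real.log_mul (by positivity) (by positivity),
    Real.log_rpow (by positivity), Real.log_exp, Real.log_div hq0.ne' hpi.ne'] at h5
  linarith

/-- A lower bound for the real part of the logarithmic derivative. -/
lemma GRHModulus.neg_re_logDeriv_LFunction_le (h : GRHModulus q) (hχ : χ ≠ 1) {s : ℂ}
    (hs : 1 / 2 < s.re) :
    -(logDeriv χ.LFunction s).re ≤
      1 / 2 * (Real.log q + Real.log ‖s + 1‖ + 2) := by
  obtain ⟨a, ha, ha', hm⟩ := h.norm_LFunction_mono hχ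
  have hq0 : (0 : ℝ) < q := by exact_mod_cast NeZero.pos q
  have hpi := Real.pi_pos
  have hlogpi : 0 ≤ Real.log Real.pi := Real.log_nonneg (by linarith [Real.pi_gt_three])
  have hnz : ∀ d : ℝ, 0 ≤ d → χ.LFunction (s + d) ≠ 0 := fun d hd ↦
    h.LFunction_ne_zero hχ (by simp; linarith)
  have hstep : ∀ d : ℝ, 0 ≤ d → Real.log ‖χ.LFunction s‖ ≤ Real.log ‖χ.LFunction (s + d)‖ +
      d / 2 * (Real.log q + Real.log ‖s + d + 1‖ + 2) := by
    intro d hd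
    have h1 := hm s hs.le d hd
    have h2 := norm_Gamma_add_le_log ha ha' hs.le hd
    have hG : 0 < ‖Gamma ((s + a) / 2)‖ := by
      refine norm_pos_iff.mpr (Gamma_ne_zero_of_re_pos ?_)
      simp; linarith
    have h3 : ‖χ.LFunction s‖ ≤ ((q : ℝ) / Real.pi) ^ (d / 2) *
        Real.exp (d / 2 * (Real.log ‖s + d + 1‖ + 2)) * ‖χ.LFunction (s + d)‖ := by
      refine le_of_mul_le_mul_left (h1.trans ?_) hG
      calc _ ≤ ((q : ℝ) / Real.pi) ^ (d / 2) * (‖Gamma ((s + a) / 2)‖ *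
            Real.exp (d / 2 * (Real.log ‖s + d + 1‖ + 2)) * ‖χ.LFunction (s + d)‖) := by
            gcongr
        _ = _ := by ring
    have hL : 0 < ‖χ.LFunction s‖ := norm_pos_iff.mpr (by simpa using hnz 0 le_rfl)
    have hL' : 0 < ‖χ.LFunction (s + d)‖ := norm_pos_iff.mpr (hnz d hd)
    have h5 := Real.log_le_log hL h3
    rw [Real.log_mul (by positivity) hL'.ne', Real.log_mul (by positivity) (by positivity),
      Real.log_rpow (by positivity), Real.log_exp, Real.log_div hq0.ne' hpi.ne'] at h5
    nlinarith [mul_nonneg hd hlogpi]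
  have hlog : HasDerivAt (fun d : ℝ ↦ Real.log ‖χ.LFunction (s + d)‖)
      (logDeriv χ.LFunction s).re 0 := by
    have := hasDerivAt_log_norm (s := s) (x := 0)
      (DirichletCharacter.differentiable_LFunction hχ _) (hnz 0 le_rfl)
    simpa using this
  have hcont : Tendsto (fun d : ℝ ↦ -(1 / 2 * (Real.log q + Real.log ‖s + d + 1‖ + 2)))
      (𝓝[>] 0) (𝓝 (-(1 / 2 * (Real.log q + Real.log ‖s + 1‖ + 2)))) := by
    have hne : s + (0 : ℝ) + 1 ≠ 0 := by
      intro h0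
      have := congrArg Complex.re h0
      simp at this
      linarith
    have : ContinuousAt (fun d : ℝ ↦ -(1 / 2 * (Real.log q + Real.log ‖s + d + 1‖ + 2))) 0 := by
      have h1 : ContinuousAt (fun d : ℝ ↦ ‖s + d + 1‖) 0 := by fun_prop
      have h2 := h1.log (norm_ne_zero_iff.mpr hne)
      fun_prop
    have h2 := this.tendsto.mono_left (nhdsWithin_le_nhds (s := Set.Ioi (0 : ℝ)))
    simpa using h2
  -- The increments in `hstep`, divided by d > 0, pass to the derivative as d → 0⁺.
  have hslope := hlog.tendsto_slope.mono_left
    (nhdsWithin_mono (0 : ℝ) (fun x (hx : x ∈ Set.Ioi (0 : ℝ)) ↦ (ne_of_gt hx : x ≠ 0)))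
  have := le_of_tendsto_of_tendsto hcont hslope ?_
  · linarith
  · filter_upwards [self_mem_nhdsWithin] with d hd
    have hd : 0 < d := hd
    rw [slope_def_field, sub_zero, le_div_iff₀ hd]
    have := hstep d hd.le
    simp only [ofReal_zero, add_zero]
    linarith

end

end

/-! ### Fourier transforms of the Poisson kernel, the tail kernel and their nonnegative combination.
-/

section

open Complex Filter Topology MeasureTheory FourierTransform

/-- Fourier inversion in angular frequency. -/
lemma integral_cexp_mul_of_fourier {f κ : ℝ → ℂ} (hfc : Continuous f) (hf : Integrable f)
    (hκ : Integrable κ) (h : ∀ y : ℝ, ∫ r : ℝ, cexp (-(r * y * I)) * f r = κ y) (u : ℝ) :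
    ∫ y : ℝ, cexp (u * y * I) * κ y = 2 * Real.pi * f u := by
  have hF : 𝓕 f = fun ξ ↦ κ (2 * Real.pi * ξ) := by
    ext ξ
    rw [Real.fourier_real_eq_integral_exp_smul, ← h]
    congr 1; ext r
    rw [smul_eq_mul]
    congr 2
    push_cast; ring
  have hpi : (2 * Real.pi) ≠ 0 := by positivity
  have hFi : Integrable (𝓕 f) := by
    rw [hF]; exact hκ.comp_mul_left' hpi
  have hinv := congrFun (hfc.fourierInv_fourier_eq hf hFi) u
  rw [Real.fourierInv_eq', hF] at hinv
  have e : ∀ ξ : ℝ, cexp (((2 * Real.pi * inner ℝ ξ u : ℝ) : ℂ) * I) • κ (2 * Real.pi * ξ) =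
      (fun y : ℝ ↦ cexp (u * y * I) * κ y) (2 * Real.pi * ξ) := by
    intro ξ
    simp only [smul_eq_mul]
    congr 2
    simp only [RCLike.inner_apply, conj_trivial]
    push_cast; ring
  have hcov := Measure.integral_comp_mul_left (fun y : ℝ ↦ cexp (u * y * I) * κ y) (2 * Real.pi)
  have hinv := hcov.symm.trans ((integral_congr_ae (ae_of_all _ fun ξ ↦ (e ξ).symm)).trans hinv)
  rw [← hinv, abs_of_pos (by positivity), Complex.real_smul]
  have : (Real.pi : ℂ) ≠ 0 := by exact_mod_cast Real.pi_pos.ne'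
  generalize ∫ y : ℝ, cexp (u * y * I) * κ y = J
  push_cast
  field_simp

lemma integrableOn_Iic_of_comp_neg {F : ℝ → ℂ} (h2 : IntegrableOn (fun r ↦ F (-r)) (Set.Ioi 0)) : IntegrableOn F (Set.Iic 0) := by
  rw [integrableOn_Iic_iff_integrableOn_Iio]
  simpa using h2.comp_neg

/-- The Fourier integral of an even function. -/
lemma integral_even_fourier {m : ℝ → ℝ} (y : ℝ) (hm : IntegrableOn (fun r ↦ m r) (Set.Ioi 0)) :
    Integrable (fun r : ℝ ↦ cexp (-(r * y * I)) * ((m |r| : ℝ) : ℂ)) ∧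
    ∫ r : ℝ, cexp (-(r * y * I)) * ((m |r| : ℝ) : ℂ) =
      (∫ r in Set.Ioi (0 : ℝ), cexp (r * y * I) * (m r : ℂ)) +
        ∫ r in Set.Ioi (0 : ℝ), cexp (-(r * y * I)) * (m r : ℂ) := by
  have hnorm : ∀ w : ℝ, ‖cexp (w * y * I)‖ = 1 := fun w ↦ by
    rw [← Complex.ofReal_mul, Complex.norm_exp_ofReal_mul_I]
  have hi1 : IntegrableOn (fun r : ℝ ↦ cexp (r * y * I) * (m r : ℂ)) (Set.Ioi 0) := by
    refine hm.ofReal.bdd_mul (c := 1) ?_ (ae_of_all _ fun r ↦ (hnorm r).le)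
    exact Continuous.aestronglyMeasurable (by fun_prop)
  have hi2 : IntegrableOn (fun r : ℝ ↦ cexp (-(r * y * I)) * (m r : ℂ)) (Set.Ioi 0) := by
    refine hm.ofReal.bdd_mul (c := 1) ?_ (ae_of_all _ fun r ↦ ?_)
    · exact Continuous.aestronglyMeasurable (by fun_prop)
    · have := hnorm (-r)
      push_cast at this
      rw [← this]; ring_nf; rfl
  set F : ℝ → ℂ := fun r ↦ cexp (-(r * y * I)) * ((m |r| : ℝ) : ℂ) with hF
  have e1 : ∀ r ∈ Set.Ioi (0 : ℝ), F r = cexp (-(r * y * I)) * (m r : ℂ) := by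
    intro r hr
    simp only [hF, abs_of_pos (Set.mem_Ioi.mp hr)]
  have e2 : ∀ r ∈ Set.Ioi (0 : ℝ), F (-r) = cexp (r * y * I) * (m r : ℂ) := by
    intro r hr
    simp only [hF, abs_neg, abs_of_pos (Set.mem_Ioi.mp hr)]
    push_cast; ring_nf
  have hF1 : IntegrableOn F (Set.Ioi 0) := hi2.congr_fun (fun r hr ↦ (e1 r hr).symm) measurableSet_Ioi
  have hF2 : IntegrableOn F (Set.Iic 0) := integrableOn_Iic_of_comp_neg
    (hi1.congr_fun (fun r hr ↦ (e2 r hr).symm) measurableSet_Ioi)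
  refine ⟨?_, ?_⟩
  · rw [← integrableOn_univ, ← Set.Iic_union_Ioi (a := (0 : ℝ))]
    exact hF2.union hF1
  · rw [← intervalIntegral.integral_Iic_add_Ioi hF2 hF1,
      ← setIntegral_congr_fun measurableSet_Ioi e2, ← setIntegral_congr_fun measurableSet_Ioi e1,
      integral_comp_neg_Ioi, neg_zero]

lemma integrable_comp_abs_ofReal {m : ℝ → ℝ} (hm : IntegrableOn (fun r ↦ m r) (Set.Ioi 0)) :
    Integrable (fun r : ℝ ↦ ((m |r| : ℝ) : ℂ)) := by
  simpa using (integral_even_fourier 0 hm).1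

lemma integral_Ioi_cexp_neg_mul {z : ℂ} (hz : 0 < z.re) :
    ∫ r in Set.Ioi (0 : ℝ), cexp (-(z * r)) = 1 / z := by
  have := integral_exp_mul_complex_Ioi (a := -z) (by simpa using hz) 0
  simp only [neg_mul, ofReal_zero, mul_zero, Complex.exp_zero] at this
  rw [this, neg_div_neg_eq]

lemma integrableOn_sub_mul_exp {b : ℝ} (hb : 0 < b) {X : ℝ} (hX : 0 ≤ X) :
    IntegrableOn (fun r : ℝ ↦ (r - X) * Real.exp (-(b * r))) (Set.Ioi X) := by
  have h1 : IntegrableOn (fun r : ℝ ↦ r * Real.exp (-(b * r))) (Set.Ioi 0) := by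
    have := integrableOn_rpow_mul_exp_neg_mul_rpow (s := 1) (p := 1) (b := b) (by norm_num) one_pos hb
    simpa using this
  have h2 : IntegrableOn (fun r : ℝ ↦ Real.exp (-(b * r))) (Set.Ioi 0) := by
    have := exp_neg_integrableOn_Ioi 0 hb
    simpa using this
  have := (h1.sub (h2.const_mul X)).mono_set (Set.Ioi_subset_Ioi hX)
  refine this.congr_fun (fun r _ ↦ ?_) measurableSet_Ioi
  simp only [Pi.sub_apply]
  ring

lemma integral_Ioi_sub_mul_cexp_neg_mul {z : ℂ} (hz : 0 < z.re) {X : ℝ} (hX : 0 ≤ X) :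
    ∫ r in Set.Ioi X, ((r - X : ℝ) : ℂ) * cexp (-(z * r)) = cexp (-(z * X)) / z ^ 2 := by
  have hz0 : z ≠ 0 := by rintro rfl; simp at hz
  have hnorm : ∀ r : ℝ, ‖cexp (-(z * r))‖ = Real.exp (-(z.re * r)) := fun r ↦ by
    rw [Complex.norm_exp]; simp
  have hderiv : ∀ r : ℝ, HasDerivAt (fun r : ℝ ↦ -(((r - X : ℝ) : ℂ) / z + 1 / z ^ 2) * cexp (-(z * r)))
      (((r - X : ℝ) : ℂ) * cexp (-(z * r))) r := by
    intro r
    have h0 : HasDerivAt (fun r : ℝ ↦ (r : ℂ)) 1 r := Complex.ofRealCLM.hasDerivAt (x := r)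
    have h1 : HasDerivAt (fun r : ℝ ↦ ((r - X : ℝ) : ℂ)) 1 r := by
      have := h0.sub_const (X : ℂ)
      refine this.congr_of_eventuallyEq (Eventually.of_forall fun r ↦ ?_)
      push_cast; rfl
    have h2 : HasDerivAt (fun r : ℝ ↦ cexp (-(z * r))) (cexp (-(z * r)) * (-(z * 1))) r :=
      ((h0.const_mul z).neg).cexp
    have := (((h1.div_const z).add_const (1 / z ^ 2)).fun_neg).fun_mul h2
    refine this.congr_deriv ?_
    field_simp
    ring
  have hint : IntegrableOn (fun r : ℝ ↦ ((r - X : ℝ) : ℂ) * cexp (-(z * r))) (Set.Ioi X) := by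
    refine (integrableOn_sub_mul_exp hz hX).mono' (Continuous.aestronglyMeasurable (by fun_prop)) ?_
    refine (ae_restrict_iff' measurableSet_Ioi).mpr (ae_of_all _ fun r hr ↦ ?_)
    rw [norm_mul, hnorm, Complex.norm_real, Real.norm_eq_abs,
      abs_of_nonneg (sub_nonneg.mpr (Set.mem_Ioi.mp hr).le)]
  have hlim : Tendsto (fun r : ℝ ↦ -(((r - X : ℝ) : ℂ) / z + 1 / z ^ 2) * cexp (-(z * r))) atTop
      (𝓝 0) := by
    have h1 := tendsto_rpow_mul_exp_neg_mul_atTop_nhds_zero 1 z.re hz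
    have h2 := tendsto_rpow_mul_exp_neg_mul_atTop_nhds_zero 0 z.re hz
    have h3 := (h1.mul_const (1 / ‖z‖)).add (h2.mul_const (X / ‖z‖ + 1 / ‖z‖ ^ 2))
    simp only [zero_mul, add_zero, Real.rpow_one, Real.rpow_zero, one_mul] at h3
    refine squeeze_zero_norm' ?_ h3
    filter_upwards [eventually_ge_atTop 0] with r hr
    rw [norm_mul, hnorm, norm_neg]
    have h4 : ‖((r - X : ℝ) : ℂ) / z + 1 / z ^ 2‖ ≤ (r + X) / ‖z‖ + 1 / ‖z‖ ^ 2 := by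
      refine (norm_add_le _ _).trans ?_
      rw [norm_div, norm_div, norm_pow, norm_one, Complex.norm_real, Real.norm_eq_abs]
      gcongr
      rw [abs_le]; constructor <;> linarith
    calc _ ≤ ((r + X) / ‖z‖ + 1 / ‖z‖ ^ 2) * Real.exp (-(z.re * r)) := by gcongr
      _ = _ := by rw [neg_mul]; ring
  have := integral_Ioi_of_hasDerivAt_of_tendsto
    ((hderiv X).continuousAt.continuousWithinAt) (fun r _ ↦ hderiv r) hint hlim
  rw [this]
  simp
  ring

lemma inv_sq_add_sq_le {a : ℝ} (ha : 0 < a) (y : ℝ) :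
    1 / (a ^ 2 + y ^ 2) ≤ (1 + 1 / a ^ 2) * (1 + y ^ 2)⁻¹ := by
  rw [← div_eq_mul_inv, div_le_div_iff₀ (by positivity) (by positivity)]
  have : (1 + 1 / a ^ 2) * (a ^ 2 + y ^ 2) = 1 + a ^ 2 + y ^ 2 + y ^ 2 / a ^ 2 := by
    field_simp; ring
  rw [this]
  have : 0 ≤ y ^ 2 / a ^ 2 := by positivity
  nlinarith [sq_nonneg a]

/-- The Poisson kernel of a half plane. -/
noncomputable def poissonKernelLine (a y : ℝ) : ℝ := 2 * a / (a ^ 2 + y ^ 2)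

lemma continuous_poissonKernelLine {a : ℝ} (ha : 0 < a) : Continuous (poissonKernelLine a) := by
  unfold poissonKernelLine
  exact Continuous.div (by fun_prop) (by fun_prop) fun y ↦ by positivity

lemma poissonKernelLine_pos {a : ℝ} (ha : 0 < a) (y : ℝ) : 0 < poissonKernelLine a y := by
  unfold poissonKernelLine; positivity

lemma poissonKernelLine_le {a : ℝ} (ha : 0 < a) (y : ℝ) :
    poissonKernelLine a y ≤ 2 * a * (1 + 1 / a ^ 2) * (1 + y ^ 2)⁻¹ := by
  unfold poissonKernelLine
  rw [← mul_one_div, mul_assoc (2 * a)]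
  exact mul_le_mul_of_nonneg_left (inv_sq_add_sq_le ha y) (by positivity)

lemma integrable_poissonKernelLine {a : ℝ} (ha : 0 < a) : Integrable (poissonKernelLine a) := by
  refine (integrable_inv_one_add_sq.const_mul (2 * a * (1 + 1 / a ^ 2))).mono'
    (continuous_poissonKernelLine ha).aestronglyMeasurable (ae_of_all _ fun y ↦ ?_)
  rw [Real.norm_of_nonneg (poissonKernelLine_pos ha y).le]
  exact poissonKernelLine_le ha y

/-- The Fourier representation of the Poisson kernel. -/
lemma integral_cexp_mul_poisson {a : ℝ} (ha : 0 < a) (u : ℝ) :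
    ∫ y : ℝ, cexp (u * y * I) * (poissonKernelLine a y : ℂ) =
      2 * Real.pi * (Real.exp (-(a * |u|)) : ℝ) := by
  have hmi : IntegrableOn (fun r : ℝ ↦ Real.exp (-(a * r))) (Set.Ioi 0) := by
    simpa using exp_neg_integrableOn_Ioi 0 ha
  refine integral_cexp_mul_of_fourier (f := fun r ↦ ((Real.exp (-(a * |r|)) : ℝ) : ℂ))
    (κ := fun y ↦ (poissonKernelLine a y : ℂ))
    (by fun_prop) (integrable_comp_abs_ofReal hmi) (integrable_poissonKernelLine ha).ofReal ?_ u
  intro y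
  rw [(integral_even_fourier (m := fun r ↦ Real.exp (-(a * r))) y hmi).2]
  have e1 : ∀ r : ℝ, cexp (r * y * I) * ((Real.exp (-(a * r)) : ℝ) : ℂ) =
      cexp (-((a - y * I : ℂ) * r)) := by
    intro r; push_cast; rw [← Complex.exp_add]; ring_nf
  have e2 : ∀ r : ℝ, cexp (-(r * y * I)) * ((Real.exp (-(a * r)) : ℝ) : ℂ) =
      cexp (-((a + y * I : ℂ) * r)) := by
    intro r; push_cast; rw [← Complex.exp_add]; ring_nf
  simp_rw [e1, e2]
  rw [integral_Ioi_cexp_neg_mul (by simpa using ha), integral_Ioi_cexp_neg_mul (by simpa using ha)]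
  have h1 : (a - y * I : ℂ) ≠ 0 := fun h ↦ ha.ne' (by simpa using congrArg Complex.re h)
  have h2 : (a + y * I : ℂ) ≠ 0 := fun h ↦ ha.ne' (by simpa using congrArg Complex.re h)
  have h3 : (a ^ 2 + y ^ 2 : ℂ) = (a - y * I) * (a + y * I) := by
    linear_combination (y ^ 2 : ℂ) * Complex.I_sq
  unfold poissonKernelLine
  push_cast
  rw [h3]
  field_simp
  ring

/-- The transform of `max (|r| - X) 0 * exp (-b |r|)`. -/
noncomputable def tailKernel (b X y : ℝ) : ℝ :=
  2 * (cexp (-((b + y * I : ℂ) * X)) / (b + y * I : ℂ) ^ 2).re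

lemma continuous_tailKernel {b : ℝ} (hb : 0 < b) (X : ℝ) : Continuous (tailKernel b X) := by
  unfold tailKernel
  refine continuous_const.mul (Complex.continuous_re.comp (Continuous.div (by fun_prop) (by fun_prop)
    fun y ↦ pow_ne_zero 2 fun h ↦ hb.ne' (by simpa using congrArg Complex.re h)))

/-- Since |b + iy|² = b² + y² ≥ a² + y², a Poisson kernel of the smaller width a dominates. This is
what makes `comparisonKernel` nonnegative. -/
lemma abs_tailKernel_le {a b : ℝ} (ha : 0 < a) (hab : a ≤ b) (X y : ℝ) :
    |tailKernel b X y| ≤ Real.exp (-(b * X)) / a * poissonKernelLine a y := by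
  have hn : ‖(b + y * I : ℂ)‖ ^ 2 = b ^ 2 + y ^ 2 := by
    rw [← Complex.normSq_eq_norm_sq, Complex.normSq_add_mul_I]
  have hb : 0 < b := ha.trans_le hab
  unfold tailKernel poissonKernelLine
  rw [abs_mul, abs_two]
  have h1 := Complex.abs_re_le_norm (cexp (-((b + y * I : ℂ) * X)) / (b + y * I : ℂ) ^ 2)
  rw [norm_div, norm_pow, hn, Complex.norm_exp] at h1
  have e : (-((b + y * I : ℂ) * X)).re = -(b * X) := by simp
  rw [e] at h1
  have h2 : Real.exp (-(b * X)) / (b ^ 2 + y ^ 2) ≤ Real.exp (-(b * X)) / (a ^ 2 + y ^ 2) := by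
    gcongr
  calc _ ≤ 2 * (Real.exp (-(b * X)) / (a ^ 2 + y ^ 2)) := by linarith
    _ = _ := by field_simp

/-- The transform of the even tail function splits into two half-line integrals that are complex
conjugates, whence twice a real part in `tailKernel`; Fourier inversion then gives the stated
direction. -/
lemma integral_cexp_mul_tail {b X : ℝ} (hb : 0 < b) (hX : 0 ≤ X) (u : ℝ) :
    ∫ y : ℝ, cexp (u * y * I) * (tailKernel b X y : ℂ) =
      2 * Real.pi * ((max (|u| - X) 0 * Real.exp (-(b * |u|)) : ℝ) : ℂ) := by
  have hzero : ∀ r ∈ Set.Ioi (0 : ℝ) \ Set.Ioi X, max (r - X) 0 = 0 := by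
    intro r hr
    refine max_eq_right ?_
    have := hr.2
    simp only [Set.mem_Ioi, not_lt] at this
    linarith
  have hpos : ∀ r ∈ Set.Ioi X, max (r - X) 0 = r - X := fun r hr ↦
    max_eq_left (sub_nonneg.mpr (Set.mem_Ioi.mp hr).le)
  have hsub : Set.Ioi X ⊆ Set.Ioi 0 := Set.Ioi_subset_Ioi hX
  have hmi : IntegrableOn (fun r : ℝ ↦ max (r - X) 0 * Real.exp (-(b * r))) (Set.Ioi 0) := by
    rw [← Set.union_sdiff_cancel hsub]
    refine IntegrableOn.union ?_ ?_
    · refine (integrableOn_sub_mul_exp hb hX).congr_fun (fun r hr ↦ ?_) measurableSet_Ioi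
      simp only [hpos r hr]
    · refine (integrableOn_zero (ε' := ℝ)).congr_fun (fun r hr ↦ ?_)
        (measurableSet_Ioi.diff measurableSet_Ioi)
      simp only [hzero r hr, zero_mul]
  have hki : Integrable (tailKernel b X) := by
    refine ((integrable_poissonKernelLine hb).const_mul (Real.exp (-(b * X)) / b)).mono'
      (continuous_tailKernel hb X).aestronglyMeasurable (ae_of_all _ fun y ↦ ?_)
    exact abs_tailKernel_le hb le_rfl X y
  refine integral_cexp_mul_of_fourier
    (f := fun r ↦ ((max (|r| - X) 0 * Real.exp (-(b * |r|)) : ℝ) : ℂ))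
    (κ := fun y ↦ (tailKernel b X y : ℂ)) (by fun_prop)
    (integrable_comp_abs_ofReal (m := fun r ↦ max (r - X) 0 * Real.exp (-(b * r))) hmi)
    hki.ofReal ?_ u
  intro y
  rw [(integral_even_fourier (m := fun r ↦ max (r - X) 0 * Real.exp (-(b * r))) y hmi).2]
  have key : ∀ z w : ℂ, z.re = b → (∀ r : ℝ, w * r + ((-(b * r) : ℝ) : ℂ) = -(z * r)) →
      ∫ r in Set.Ioi (0 : ℝ), cexp (w * r) * ((max (r - X) 0 * Real.exp (-(b * r)) : ℝ) : ℂ) =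
        cexp (-(z * X)) / z ^ 2 := by
    intro z w hz hw
    rw [← integral_Ioi_sub_mul_cexp_neg_mul (by rw [hz]; exact hb) hX,
      setIntegral_eq_of_subset_of_forall_sdiff_eq_zero measurableSet_Ioi hsub (fun r hr ↦ by
        rw [hzero r hr]; simp)]
    refine setIntegral_congr_fun measurableSet_Ioi fun r hr ↦ ?_
    rw [hpos r hr, ← hw r, Complex.exp_add, Complex.ofReal_mul, Complex.ofReal_exp]
    ring
  have k1 := key (b - y * I) (y * I) (by simp) (fun r ↦ by push_cast; ring)
  have k2 := key (b + y * I) (-(y * I)) (by simp) (fun r ↦ by push_cast; ring)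
  have e1 : ∀ r : ℝ, (r * y * I : ℂ) = y * I * r := fun r ↦ by ring
  have e2 : ∀ r : ℝ, (-(y * I * r) : ℂ) = -(y * I) * r := fun r ↦ by ring
  simp_rw [e1, e2]
  rw [k1, k2]
  have hconj : cexp (-((b - y * I : ℂ) * X)) / (b - y * I : ℂ) ^ 2 =
      (starRingEnd ℂ) (cexp (-((b + y * I : ℂ) * X)) / (b + y * I : ℂ) ^ 2) := by
    rw [map_div₀, ← Complex.exp_conj]
    simp [sub_eq_add_neg]
  rw [hconj, add_comm, Complex.add_conj, tailKernel]

/-- The nonnegative kernel used to compare a tail sum with a value of the logarithmic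
derivative. -/
noncomputable def comparisonKernel (a b X y : ℝ) : ℝ :=
  Real.exp (-(b * X)) / a * poissonKernelLine a y - tailKernel b X y

lemma continuous_comparisonKernel {a b : ℝ} (ha : 0 < a) (hb : 0 < b) (X : ℝ) :
    Continuous (comparisonKernel a b X) :=
  ((continuous_poissonKernelLine ha).const_mul _).sub (continuous_tailKernel hb X)

lemma comparisonKernel_nonneg {a b : ℝ} (ha : 0 < a) (hab : a ≤ b) (X y : ℝ) :
    0 ≤ comparisonKernel a b X y := by
  have := abs_le.mp (abs_tailKernel_le ha hab X y)
  unfold comparisonKernel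
  linarith [this.2]

lemma comparisonKernel_le {a b : ℝ} (ha : 0 < a) (hab : a ≤ b) (X y : ℝ) :
    comparisonKernel a b X y ≤ 2 * (Real.exp (-(b * X)) / a) * poissonKernelLine a y := by
  have := abs_le.mp (abs_tailKernel_le ha hab X y)
  unfold comparisonKernel
  linarith [this.1]

lemma comparisonKernel_le_inv {a b : ℝ} (ha : 0 < a) (hab : a ≤ b) (X : ℝ) :
    ∃ B : ℝ, 0 ≤ B ∧ ∀ y, comparisonKernel a b X y ≤ B * (1 + y ^ 2)⁻¹ := by
  refine ⟨2 * (Real.exp (-(b * X)) / a) * (2 * a * (1 + 1 / a ^ 2)), by positivity, fun y ↦ ?_⟩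
  refine (comparisonKernel_le ha hab X y).trans ?_
  rw [mul_assoc _ (2 * a * (1 + 1 / a ^ 2))]
  exact mul_le_mul_of_nonneg_left (poissonKernelLine_le ha y) (by positivity)

lemma integral_cexp_mul_comparisonKernel {a b X : ℝ} (ha : 0 < a) (hab : a ≤ b) (hX : 0 ≤ X)
    (u : ℝ) :
    ∫ y : ℝ, cexp (u * y * I) * (comparisonKernel a b X y : ℂ) = 2 * Real.pi *
      ((Real.exp (-(b * X)) / a * Real.exp (-(a * |u|)) -
        max (|u| - X) 0 * Real.exp (-(b * |u|)) : ℝ) : ℂ) := by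
  have hb : 0 < b := ha.trans_le hab
  have hki : Integrable (tailKernel b X) := by
    refine ((integrable_poissonKernelLine hb).const_mul (Real.exp (-(b * X)) / b)).mono'
      (continuous_tailKernel hb X).aestronglyMeasurable (ae_of_all _ fun y ↦ ?_)
    exact abs_tailKernel_le hb le_rfl X y
  have hnorm : ∀ y : ℝ, ‖cexp (u * y * I)‖ ≤ 1 := fun y ↦ by
    rw [← Complex.ofReal_mul, Complex.norm_exp_ofReal_mul_I]
  have hcont : Continuous fun y : ℝ ↦ cexp (u * y * I) := by fun_prop
  have i1 : Integrable fun y : ℝ ↦ cexp (u * y * I) * (poissonKernelLine a y : ℂ) :=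
    (integrable_poissonKernelLine ha).ofReal.bdd_mul hcont.aestronglyMeasurable (ae_of_all _ hnorm)
  have i2 : Integrable fun y : ℝ ↦ cexp (u * y * I) * (tailKernel b X y : ℂ) :=
    hki.ofReal.bdd_mul hcont.aestronglyMeasurable (ae_of_all _ hnorm)
  have e : ∀ y : ℝ, cexp (u * y * I) * (comparisonKernel a b X y : ℂ) =
      ((Real.exp (-(b * X)) / a : ℝ) : ℂ) * (cexp (u * y * I) * (poissonKernelLine a y : ℂ)) -
        cexp (u * y * I) * (tailKernel b X y : ℂ) := by
    intro y
    unfold comparisonKernel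
    push_cast; ring
  simp_rw [e]
  rw [integral_sub (i1.const_mul _) i2, integral_const_mul, integral_cexp_mul_poisson ha,
    integral_cexp_mul_tail hb hX]
  push_cast
  ring

end

/-! ### Integrals of L'/L along vertical lines and the tail of its Dirichlet series. -/

section

open Complex Filter Topology MeasureTheory

lemma integrable_quarticWeight_mul_inv :
    Integrable fun y : ℝ ↦ quarticWeight y * (1 + y ^ 2)⁻¹ := by
  have h := integrable_rpow_neg_one_add_norm_sq (E := ℝ) (μ := volume) (r := 3 / 2)
    (by norm_num)
  refine h.congr (ae_of_all _ fun y ↦ ?_)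
  have hp : 0 < 1 + y ^ 2 := by positivity
  simp only [Real.norm_eq_abs, sq_abs]
  rw [quarticWeight, ← Real.rpow_neg_one, ← Real.rpow_add hp]
  norm_num

lemma continuous_quarticWeight : Continuous quarticWeight := by
  unfold quarticWeight
  exact Continuous.rpow_const (by fun_prop) fun y ↦ Or.inr (by norm_num)

/-- The coefficients `χ(n) Λ(n)`. -/
noncomputable def twistedMangoldt {q : ℕ} (χ : DirichletCharacter ℂ q) (n : ℕ) : ℂ :=
  χ (n : ZMod q) * (ArithmeticFunction.vonMangoldt n : ℂ)

section

variable {q : ℕ} [NeZero q] {χ : DirichletCharacter ℂ q}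

lemma summable_twistedMangoldt {q : ℕ} (χ : DirichletCharacter ℂ q) {s : ℂ} (hs : 1 < s.re) :
    LSeriesSummable (twistedMangoldt χ) s :=
  χ.LSeriesSummable_twist_vonMangoldt hs

lemma logDeriv_LFunction_eq (χ : DirichletCharacter ℂ q) {s : ℂ} (hs : 1 < s.re) :
    logDeriv χ.LFunction s = -LSeries (twistedMangoldt χ) s := by
  have h := χ.LSeries_twist_vonMangoldt_eq hs
  rw [← χ.deriv_LFunction_eq_deriv_LSeries hs, ← χ.LFunction_eq_LSeries hs] at h
  rw [logDeriv_apply, show LSeries (twistedMangoldt χ) s = _ from h]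
  ring

lemma term_sub_add_mul_I {f : ℕ → ℂ} (s : ℂ) (a y : ℝ) (n : ℕ) :
    LSeries.term f (s - a + y * I) n =
      LSeries.term f s n * (Real.exp (a * Real.log n) : ℝ) *
        cexp (((-Real.log n : ℝ) : ℂ) * y * I) := by
  rcases Nat.eq_zero_or_pos n with rfl | hn
  · simp
  have hn0 : (n : ℂ) ≠ 0 := by exact_mod_cast hn.ne'
  rw [LSeries.term_of_ne_zero hn.ne', LSeries.term_of_ne_zero hn.ne', div_mul_eq_mul_div,
    div_mul_eq_mul_div, div_eq_div_iff (by simp [hn0, Complex.cpow_eq_zero_iff])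
      (by simp [hn0, Complex.cpow_eq_zero_iff]), mul_assoc, mul_assoc, mul_assoc]
  congr 1
  rw [Complex.ofReal_exp, Complex.cpow_def_of_ne_zero hn0, Complex.cpow_def_of_ne_zero hn0,
    ← Complex.exp_add, ← Complex.exp_add, ← Complex.natCast_log]
  push_cast
  ring_nf

lemma norm_term_sub {f : ℕ → ℂ} (s : ℂ) (a : ℝ) (n : ℕ) :
    ‖LSeries.term f (s - a) n‖ = ‖LSeries.term f s n‖ * Real.exp (a * Real.log n) := by
  have := term_sub_add_mul_I (f := f) s a 0 n
  simp only [ofReal_zero, zero_mul, add_zero, mul_zero, Complex.exp_zero, mul_one] at this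
  rw [this, norm_mul, Complex.norm_real, Real.norm_of_nonneg (Real.exp_pos _).le]

/-- The integral of the logarithmic derivative along a vertical line against a kernel, on the
domain of absolute convergence. -/
lemma integral_logDeriv_mul_of_one_lt {κ φ : ℝ → ℝ} (hκi : Integrable κ)
    (hφ : ∀ u : ℝ, ∫ y : ℝ, cexp (u * y * I) * (κ y : ℂ) = 2 * Real.pi * (φ u : ℂ)) {a : ℝ} {s : ℂ}
    (hs : 1 + a < s.re) {S : ℂ}
    (hS : HasSum (fun n : ℕ ↦ LSeries.term (twistedMangoldt χ) s n *
      ((Real.exp (a * Real.log n) * φ (-Real.log n) : ℝ) : ℂ)) S) :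
    ∫ y : ℝ, logDeriv χ.LFunction (s - a + y * I) * (κ y : ℂ) = 2 * Real.pi * -S := by
  set F : ℕ → ℝ → ℂ := fun n y ↦ LSeries.term (twistedMangoldt χ) (s - a + y * I) n * (κ y : ℂ)
    with hF
  have hFe : ∀ n y, F n y = LSeries.term (twistedMangoldt χ) s n *
      (Real.exp (a * Real.log n) : ℝ) * (cexp (((-Real.log n : ℝ) : ℂ) * y * I) * (κ y : ℂ)) := by
    intro n y
    simp only [hF]
    rw [term_sub_add_mul_I]; ring
  have hnorm : ∀ w y : ℝ, ‖cexp (w * y * I)‖ = 1 := fun w y ↦ by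
    rw [← Complex.ofReal_mul, Complex.norm_exp_ofReal_mul_I]
  have hint : ∀ n, Integrable (F n) := by
    intro n
    rw [show F n = _ from funext (hFe n)]
    refine Integrable.const_mul ?_ _
    exact hκi.ofReal.bdd_mul (c := 1) (Continuous.aestronglyMeasurable (by fun_prop))
      (ae_of_all _ fun y ↦ (hnorm _ y).le)
  have hnF : ∀ n, ∫ y, ‖F n y‖ = ‖LSeries.term (twistedMangoldt χ) (s - a) n‖ * ∫ y, ‖κ y‖ := by
    intro n
    rw [← integral_const_mul]
    congr 1; ext y
    rw [hFe, norm_mul, norm_mul, norm_mul, hnorm, one_mul, norm_term_sub, Complex.norm_real,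
      Complex.norm_real, Real.norm_of_nonneg (Real.exp_pos _).le]
  have hsa : 1 < (s - a : ℂ).re := by simp; linarith
  have hsum : Summable fun n ↦ ∫ y, ‖F n y‖ := by
    simp_rw [hnF]
    exact ((summable_twistedMangoldt χ hsa).norm).mul_right _
  have key := hasSum_integral_of_summable_integral_norm hint hsum
  have e1 : ∀ n, ∫ y, F n y = 2 * Real.pi * (LSeries.term (twistedMangoldt χ) s n *
      ((Real.exp (a * Real.log n) * φ (-Real.log n) : ℝ) : ℂ)) := by
    intro n
    rw [show F n = _ from funext (hFe n), integral_const_mul, hφ]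
    push_cast; ring
  simp_rw [e1] at key
  have h2 := (hS.mul_left (2 * Real.pi : ℂ)).unique key
  have e3 : ∀ y : ℝ, logDeriv χ.LFunction (s - a + y * I) * (κ y : ℂ) = -∑' n, F n y := by
    intro y
    have hre : 1 < (s - a + y * I : ℂ).re := by simpa using hsa
    rw [logDeriv_LFunction_eq χ hre, LSeries, ← tsum_mul_right.symm]
    ring
  simp_rw [e3]
  rw [integral_neg, ← h2]
  ring

lemma continuous_logDeriv_line (hχ : χ ≠ 1) (hnz : ∀ s : ℂ, 1 / 2 < s.re → χ.LFunction s ≠ 0)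
    {s : ℂ} (hs : 1 / 2 < s.re) : Continuous fun y : ℝ ↦ logDeriv χ.LFunction (s + y * I) := by
  refine continuous_iff_continuousAt.mpr fun y ↦ ?_
  have h1 : ContinuousAt (logDeriv χ.LFunction) (s + y * I) :=
    (differentiableAt_logDeriv_LFunction hχ hnz (by simpa using hs)).continuousAt
  have h2 : ContinuousAt (fun y : ℝ ↦ s + y * I) y := by fun_prop
  exact h1.comp (f := fun y : ℝ ↦ s + y * I) h2

lemma analyticAt_logDeriv_LFunction (hχ : χ ≠ 1)
    (hnz : ∀ s : ℂ, 1 / 2 < s.re → χ.LFunction s ≠ 0) {s : ℂ} (hs : 1 / 2 < s.re) :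
    AnalyticAt ℂ (logDeriv χ.LFunction) s := by
  have : DifferentiableOn ℂ (logDeriv χ.LFunction) {s | 1 / 2 < s.re} := fun z hz ↦
    (differentiableAt_logDeriv_LFunction hχ hnz hz).differentiableWithinAt
  exact this.analyticAt ((re_gt_isOpen _).mem_nhds hs)

lemma integrable_logDeriv_mul (hχ : χ ≠ 1) (hnz : ∀ s : ℂ, 1 / 2 < s.re → χ.LFunction s ≠ 0)
    {κ : ℝ → ℝ} (hκc : Continuous κ) {B : ℝ} (hB : ∀ y, |κ y| ≤ B * (1 + y ^ 2)⁻¹)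
    {s : ℂ} (hs : 1 / 2 < s.re) :
    Integrable fun y : ℝ ↦ logDeriv χ.LFunction (s + y * I) * (κ y : ℂ) := by
  set ε := min 1 (s.re - 1 / 2) with hε
  have hε0 : 0 < ε := lt_min one_pos (by linarith)
  obtain ⟨K, hK, hb⟩ := exists_norm_logDeriv_LFunction_le hχ hnz hε0 (min_le_left _ _)
  have hεs : 1 / 2 + ε ≤ s.re := by linarith [min_le_right 1 (s.re - 1 / 2)]
  refine (integrable_quarticWeight_mul_inv.const_mul (K * (2 * quarticWeight s.im) * B)).mono'
    ((continuous_logDeriv_line hχ hnz hs).mul (by fun_prop)).aestronglyMeasurable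
    (ae_of_all _ fun y ↦ ?_)
  have h1 := hb (s + y * I) (by simpa using hεs)
  have h2 := quarticWeight_add_le s.im y
  have h3 : (s + y * I : ℂ).im = s.im + y := by simp
  rw [h3] at h1
  have hB0 : 0 ≤ B * (1 + y ^ 2)⁻¹ := (abs_nonneg _).trans (hB y)
  rw [norm_mul, Complex.norm_real, Real.norm_eq_abs]
  calc _ ≤ (K * (2 * (quarticWeight s.im * quarticWeight y))) * (B * (1 + y ^ 2)⁻¹) := by
        refine mul_le_mul (h1.trans (by gcongr)) (hB y) (abs_nonneg _) ?_
        exact (norm_nonneg _).trans (h1.trans (by gcongr))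
    _ = _ := by ring

/-- The same integral, continued analytically to the half plane free of zeros. -/
lemma integral_logDeriv_mul (hχ : χ ≠ 1) (hnz : ∀ s : ℂ, 1 / 2 < s.re → χ.LFunction s ≠ 0)
    {κ φ : ℝ → ℝ} (hκc : Continuous κ) {B : ℝ} (hB : ∀ y, |κ y| ≤ B * (1 + y ^ 2)⁻¹)
    (hφ : ∀ u : ℝ, ∫ y : ℝ, cexp (u * y * I) * (κ y : ℂ) = 2 * Real.pi * (φ u : ℂ)) {a : ℝ}
    {H : ℂ → ℂ} (hH : DifferentiableOn ℂ H {s | 1 / 2 + a < s.re})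
    (hS : ∀ s : ℂ, 1 + a < s.re → HasSum (fun n : ℕ ↦ LSeries.term (twistedMangoldt χ) s n *
      ((Real.exp (a * Real.log n) * φ (-Real.log n) : ℝ) : ℂ)) (-H s)) {s : ℂ}
    (hs : 1 / 2 + a < s.re) :
    ∫ y : ℝ, logDeriv χ.LFunction (s - a + y * I) * (κ y : ℂ) = 2 * Real.pi * H s := by
  have hκi : Integrable κ := (integrable_inv_one_add_sq.const_mul B).mono'
    hκc.aestronglyMeasurable (ae_of_all _ hB)
  have hcd : 1 / 2 + a ≤ 1 + a := by linarith
  refine eqOn_re_gt_of_eqOn (f := fun s ↦ ∫ y : ℝ, logDeriv χ.LFunction (s - a + y * I) * (κ y : ℂ))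
    (g := fun s ↦ 2 * Real.pi * H s) hcd ?_
    (hH.const_mul (2 * Real.pi : ℂ)) (fun s hs ↦ ?_) s hs
  · intro s₀ hs₀
    have hs₀' : 1 / 2 + a < s₀.re := hs₀
    refine DifferentiableAt.differentiableWithinAt ?_
    set ε := min 1 ((s₀.re - 1 / 2 - a) / 2) with hε
    have hε0 : 0 < ε := lt_min one_pos (by linarith)
    have hε1 : ε ≤ 1 := min_le_left _ _
    have hε2 : ε ≤ (s₀.re - 1 / 2 - a) / 2 := min_le_right _ _
    obtain ⟨K, hK, hb⟩ := exists_norm_deriv_logDeriv_LFunction_le hχ hnz hε0 hε1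
    have hball : ∀ z ∈ Metric.ball s₀ ε, 1 / 2 + ε ≤ z.re - a ∧ |z.im - s₀.im| ≤ 1 := by
      intro z hz
      rw [Metric.mem_ball, Complex.dist_eq] at hz
      have h1 := (Complex.abs_re_le_norm (z - s₀)).trans hz.le
      have h2 := (Complex.abs_im_le_norm (z - s₀)).trans hz.le
      rw [Complex.sub_re, abs_le] at h1
      rw [Complex.sub_im] at h2
      exact ⟨by linarith [h1.1], h2.trans hε1⟩
    have hre : ∀ z : ℂ, ∀ y : ℝ, (z - a + y * I : ℂ).re = z.re - a := fun z y ↦ by simp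
    have him : ∀ z : ℂ, ∀ y : ℝ, (z - a + y * I : ℂ).im = z.im + y := fun z y ↦ by simp
    have hsub : ∀ z : ℂ, (z - a : ℂ).re = z.re - a := fun z ↦ by simp
    refine (hasDerivAt_integral_of_dominated_loc_of_deriv_le (Metric.ball_mem_nhds s₀ hε0)
      (F := fun s y ↦ logDeriv χ.LFunction (s - a + y * I) * (κ y : ℂ))
      (F' := fun s y ↦ deriv (logDeriv χ.LFunction) (s - a + y * I) * (κ y : ℂ))
      -- The 8 is 4 · 2: a factor 4 for moving the imaginary part by at most 1, and 2 for separating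
      -- Im s₀ from y.
      (bound := fun y ↦ K * (8 * quarticWeight s₀.im) * B * (quarticWeight y * (1 + y ^ 2)⁻¹))
      ?_ ?_ ?_ ?_ ?_ ?_).2.differentiableAt
    · filter_upwards [Metric.ball_mem_nhds s₀ hε0] with z hz
      refine ((continuous_logDeriv_line hχ hnz ?_).mul (by fun_prop)).aestronglyMeasurable
      rw [hsub]; linarith [(hball z hz).1]
    · exact integrable_logDeriv_mul hχ hnz hκc hB (by rw [hsub]; linarith)
    · refine Continuous.aestronglyMeasurable (Continuous.mul ?_ (by fun_prop))
      refine continuous_iff_continuousAt.mpr fun y ↦ ?_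
      have h1 : ContinuousAt (deriv (logDeriv χ.LFunction)) (s₀ - a + y * I) :=
        (analyticAt_logDeriv_LFunction hχ hnz (by rw [hre]; linarith)).deriv.continuousAt
      have h2 : ContinuousAt (fun y : ℝ ↦ s₀ - a + y * I) y := by fun_prop
      exact h1.comp (f := fun y : ℝ ↦ s₀ - a + y * I) h2
    · refine ae_of_all _ fun y z hz ↦ ?_
      obtain ⟨h1, h2⟩ := hball z hz
      have h3 := hb (z - a + y * I) (by rw [hre]; exact h1)
      rw [him] at h3
      have h4 := quarticWeight_le_of_abs_le h2 (s₀.im + y)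
      rw [show s₀.im + y + (z.im - s₀.im) = z.im + y by ring] at h4
      have h5 := quarticWeight_add_le s₀.im y
      have hB0 : 0 ≤ B * (1 + y ^ 2)⁻¹ := (abs_nonneg _).trans (hB y)
      rw [norm_mul, Complex.norm_real, Real.norm_eq_abs]
      calc _ ≤ (K * (4 * (2 * (quarticWeight s₀.im * quarticWeight y)))) *
            (B * (1 + y ^ 2)⁻¹) := by
            have h6 := h3.trans (mul_le_mul_of_nonneg_left (h4.trans
              (mul_le_mul_of_nonneg_left h5 zero_le_four)) hK.le)
            exact mul_le_mul h6 (hB y) (abs_nonneg _) ((norm_nonneg _).trans h6)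
        _ = _ := by ring
    · exact integrable_quarticWeight_mul_inv.const_mul _
    · refine ae_of_all _ fun y z hz ↦ ?_
      have h1 : HasDerivAt (fun z : ℂ ↦ z - a + y * I) 1 z :=
        ((hasDerivAt_id z).sub_const (a : ℂ)).add_const (y * I : ℂ)
      have h2 := (differentiableAt_logDeriv_LFunction hχ hnz (s := z - a + y * I)
        (by rw [hre]; linarith [(hball z hz).1])).hasDerivAt
      have h3 := (h2.comp_of_eq z h1 rfl).mul_const (κ y : ℂ)
      simpa using h3
  · rw [integral_logDeriv_mul_of_one_lt hκi hφ hs (hS s hs), neg_neg]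

/-- The combination of `L'/L`, its derivative and a prime power sum that equals a tail of the
Dirichlet series of `L'/L` on the domain of absolute convergence. -/
noncomputable def tailFunction (χ : DirichletCharacter ℂ q) (x : ℝ) (s : ℂ) : ℂ :=
  Real.log x * logDeriv χ.LFunction s + deriv (logDeriv χ.LFunction) s +
    ∑ n ∈ Finset.Icc 1 ⌊x⌋₊,
      LSeries.term (twistedMangoldt χ) s n * ((Real.log x - Real.log n : ℝ) : ℂ)

lemma differentiable_term (f : ℕ → ℂ) (n : ℕ) : Differentiable ℂ fun s ↦ LSeries.term f s n :=
  fun s ↦ (LSeries.hasDerivAt_term f n s).differentiableAt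

lemma differentiableAt_tailFunction (hχ : χ ≠ 1)
    (hnz : ∀ s : ℂ, 1 / 2 < s.re → χ.LFunction s ≠ 0) (x : ℝ) {s : ℂ} (hs : 1 / 2 < s.re) :
    DifferentiableAt ℂ (tailFunction χ x) s := by
  have h := analyticAt_logDeriv_LFunction hχ hnz hs
  unfold tailFunction
  refine ((h.differentiableAt.const_mul _).add h.deriv.differentiableAt).add ?_
  exact DifferentiableAt.fun_sum fun n _ ↦ (differentiable_term _ n s).mul_const _

lemma hasSum_term_log (χ : DirichletCharacter ℂ q) {s : ℂ} (hs : 1 < s.re) :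
    HasSum (fun n ↦ LSeries.term (twistedMangoldt χ) s n * (Real.log n : ℂ))
      (deriv (logDeriv χ.LFunction) s) := by
  have habs : LSeries.abscissaOfAbsConv (twistedMangoldt χ) < s.re := by
    have h1 : LSeries.abscissaOfAbsConv (twistedMangoldt χ) ≤ ((1 : ℝ) : EReal) :=
      LSeries.abscissaOfAbsConv_le_of_forall_lt_LSeriesSummable' fun y hy ↦ by
        have hy' : (1 : ℝ) < y := by exact_mod_cast hy
        exact summable_twistedMangoldt χ (by simpa using hy')
    exact h1.trans_lt (by exact_mod_cast hs)
  have hd : deriv (logDeriv χ.LFunction) s =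
      LSeries (LSeries.logMul (twistedMangoldt χ)) s := by
    have h1 : logDeriv χ.LFunction =ᶠ[𝓝 s] fun z ↦ -LSeries (twistedMangoldt χ) z := by
      filter_upwards [(re_gt_isOpen 1).mem_nhds hs] with z hz using logDeriv_LFunction_eq χ hz
    rw [h1.deriv_eq, ((LSeries_hasDerivAt habs).fun_neg).deriv, neg_neg]
  rw [hd]
  have h2 := (LSeriesSummable_logMul_of_lt_re habs).LSeriesHasSum
  refine HasSum.congr_fun h2 fun n ↦ ?_
  rcases Nat.eq_zero_or_pos n with rfl | hn
  · simp
  rw [LSeries.term_of_ne_zero hn.ne', LSeries.term_of_ne_zero hn.ne', LSeries.logMul,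
    Complex.natCast_log]
  ring

/-- The series of (L'/L)' + log x · L'/L has the weights log n - log x; the finite sum cancels
precisely the terms with n ≤ x and leaves the positive part. -/
lemma hasSum_tailFunction (χ : DirichletCharacter ℂ q) {x : ℝ} (hx : 1 ≤ x) {s : ℂ}
    (hs : 1 < s.re) :
    HasSum (fun n : ℕ ↦ LSeries.term (twistedMangoldt χ) s n *
      ((max (Real.log n - Real.log x) 0 : ℝ) : ℂ)) (tailFunction χ x s) := by
  have h1 := hasSum_term_log χ hs
  have h2 := ((summable_twistedMangoldt χ hs).LSeriesHasSum).mul_right (Real.log x : ℂ)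
  have h3 := hasSum_sum_of_ne_finset_zero (L := .unconditional ℕ) (f := fun n : ℕ ↦ if n ∈ Finset.Icc 1 ⌊x⌋₊ then
      LSeries.term (twistedMangoldt χ) s n * ((Real.log x - Real.log n : ℝ) : ℂ) else 0)
      (s := Finset.Icc 1 ⌊x⌋₊) (fun n hn ↦ if_neg hn)
  rw [Finset.sum_congr rfl fun n hn ↦ if_pos hn] at h3
  have h4 := (h1.sub h2).add h3
  have e : deriv (logDeriv χ.LFunction) s - LSeries (twistedMangoldt χ) s * (Real.log x : ℂ) +
      ∑ n ∈ Finset.Icc 1 ⌊x⌋₊,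
        LSeries.term (twistedMangoldt χ) s n * ((Real.log x - Real.log n : ℝ) : ℂ) =
      tailFunction χ x s := by
    rw [tailFunction, logDeriv_LFunction_eq χ hs]
    ring
  rw [e] at h4
  refine HasSum.congr_fun h4 fun n ↦ ?_
  rcases Nat.eq_zero_or_pos n with rfl | hn
  · simp
  have hn0 : (0 : ℝ) < n := by exact_mod_cast hn
  by_cases hnx : n ∈ Finset.Icc 1 ⌊x⌋₊
  · rw [if_pos hnx, max_eq_right]
    · push_cast; ring
    · have : (n : ℝ) ≤ x := (Nat.le_floor_iff (by linarith)).mp (Finset.mem_Icc.mp hnx).2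
      linarith [Real.log_le_log hn0 this]
  · rw [if_neg hnx, max_eq_left]
    · push_cast; ring
    · have : x ≤ n := by
        by_contra hlt
        push Not at hlt
        exact hnx (Finset.mem_Icc.mpr ⟨hn, Nat.le_floor hlt.le⟩)
      linarith [Real.log_le_log (by linarith) this]

lemma term_add_ofReal {f : ℕ → ℂ} (s : ℂ) (v : ℝ) (n : ℕ) :
    LSeries.term f (s + v) n = LSeries.term f s n * (Real.exp (-(v * Real.log n)) : ℝ) := by
  have := term_sub_add_mul_I (f := f) s (-v) 0 n
  simpa using this

/-- The shift by a multiplies the n-th term by n^a. This undoes n^(-a) in the Poisson part, which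
returns L'/L(s), and turns n^(-(a+v)) in the tail part into n^(-v), which returns the tail at s + v.
-/
lemma integral_logDeriv_mul_comparisonKernel (hχ : χ ≠ 1)
    (hnz : ∀ s : ℂ, 1 / 2 < s.re → χ.LFunction s ≠ 0) {a v x : ℝ} (ha : 0 < a) (hv : 0 ≤ v)
    (hx : 1 ≤ x) {s : ℂ} (hs : 1 / 2 + a < s.re) :
    ∫ y : ℝ, logDeriv χ.LFunction (s - a + y * I) *
        (comparisonKernel a (a + v) (Real.log x) y : ℂ) =
      2 * Real.pi * ((Real.exp (-((a + v) * Real.log x)) / a : ℝ) * logDeriv χ.LFunction s +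
        tailFunction χ x (s + v)) := by
  have hX : 0 ≤ Real.log x := Real.log_nonneg hx
  have hab : a ≤ a + v := by linarith
  obtain ⟨B, -, hB⟩ := comparisonKernel_le_inv ha hab (Real.log x)
  refine integral_logDeriv_mul hχ hnz
    (continuous_comparisonKernel ha (ha.trans_le hab) _) (B := B) (fun y ↦ ?_)
    (integral_cexp_mul_comparisonKernel ha hab hX)
    (H := fun s ↦ (Real.exp (-((a + v) * Real.log x)) / a : ℝ) * logDeriv χ.LFunction s +
        tailFunction χ x (s + v)) ?_ ?_ hs
  · rw [abs_of_nonneg (comparisonKernel_nonneg ha hab _ _)]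
    exact hB y
  · intro z hz
    have hz' : 1 / 2 + a < z.re := hz
    refine DifferentiableAt.differentiableWithinAt ?_
    refine ((differentiableAt_logDeriv_LFunction hχ hnz (by linarith)).const_mul _).add ?_
    exact (differentiableAt_tailFunction hχ hnz x (s := z + v) (by simp; linarith)).comp z
      (by fun_prop : DifferentiableAt ℂ (fun z : ℂ ↦ z + v) z)
  · intro z hz
    have h1 := ((summable_twistedMangoldt χ (s := z) (by linarith)).LSeriesHasSum).mul_right
      ((Real.exp (-((a + v) * Real.log x)) / a : ℝ) : ℂ)
    have h2 := hasSum_tailFunction χ hx (s := z + v) (by simp; linarith)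
    have h3 := h1.sub h2
    have e : LSeries (twistedMangoldt χ) z * ((Real.exp (-((a + v) * Real.log x)) / a : ℝ) : ℂ) -
        tailFunction χ x (z + v) =
        -((Real.exp (-((a + v) * Real.log x)) / a : ℝ) * logDeriv χ.LFunction z +
          tailFunction χ x (z + v)) := by
      rw [logDeriv_LFunction_eq χ (by linarith)]; ring
    rw [e] at h3
    refine HasSum.congr_fun h3 fun n ↦ ?_
    rcases Nat.eq_zero_or_pos n with rfl | hn
    · simp
    have hln : 0 ≤ Real.log n := Real.log_natCast_nonneg n
    rw [term_add_ofReal, abs_neg, abs_of_nonneg hln, mul_assoc, ← mul_sub]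
    congr 1
    have e1 : Real.exp (a * Real.log n) * Real.exp (-(a * Real.log n)) = 1 := by
      rw [← Real.exp_add]; simp
    have e2 : Real.exp (a * Real.log n) * Real.exp (-((a + v) * Real.log n)) =
        Real.exp (-(v * Real.log n)) := by
      rw [← Real.exp_add]; ring_nf
    rw [← Complex.ofReal_mul, ← Complex.ofReal_sub]
    congr 1
    linear_combination (Real.exp (-((a + v) * Real.log x)) / a) * e1 -
      max (Real.log n - Real.log x) 0 * e2

end

end

/-! ### Bounding the tail function through positivity of the kernel. -/

section

open Complex Filter Topology MeasureTheory

lemma quarticWeight_nonneg (t : ℝ) : 0 ≤ quarticWeight t :=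
  zero_le_one.trans (one_le_quarticWeight t)

lemma log_one_add_abs_le (y : ℝ) : Real.log (1 + |y|) ≤ 4 * quarticWeight y := by
  have h := log_mul_le_quarticWeight (K := 1 / 2) (by norm_num) y
  have h1 : Real.log (1 + |y|) ≤ Real.log (1 / 2 * (4 + 2 * |y|)) :=
    Real.log_le_log (by positivity) (by linarith [abs_nonneg y])
  have h2 : (1 / 2 * 6 : ℝ) ^ (1 / 2 : ℝ) ≤ 2 := by
    rw [← Real.sqrt_eq_rpow, Real.sqrt_le_left (by norm_num)]; norm_num
  nlinarith [quarticWeight_nonneg y]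

lemma quarticWeight_mul_le {a : ℝ} (ha : 0 ≤ a) (ha4 : a ≤ 4) (y : ℝ) :
    quarticWeight (a * y) ≤ 17 * quarticWeight y := by
  unfold quarticWeight
  calc (1 + (a * y) ^ 2) ^ (1 / 4 : ℝ) ≤ (17 * (1 + y ^ 2)) ^ (1 / 4 : ℝ) := by
        refine Real.rpow_le_rpow (by positivity) ?_ (by norm_num)
        have : a ^ 2 ≤ 16 := by nlinarith
        nlinarith [mul_le_mul_of_nonneg_right this (sq_nonneg y), sq_nonneg y]
    _ = 17 ^ (1 / 4 : ℝ) * (1 + y ^ 2) ^ (1 / 4 : ℝ) :=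
        Real.mul_rpow (by norm_num) (by positivity)
    _ ≤ 17 * (1 + y ^ 2) ^ (1 / 4 : ℝ) := by
        gcongr
        exact Real.rpow_le_self_of_one_le (by norm_num) (by norm_num)

lemma integrable_quarticWeight_mul_poisson {a : ℝ} (ha : 0 < a) :
    Integrable fun y ↦ quarticWeight y * poissonKernelLine a y := by
  refine (integrable_quarticWeight_mul_inv.const_mul (2 * a * (1 + 1 / a ^ 2))).mono'
    (continuous_quarticWeight.mul (continuous_poissonKernelLine ha)).aestronglyMeasurable
    (ae_of_all _ fun y ↦ ?_)
  rw [Real.norm_of_nonneg (mul_nonneg (quarticWeight_nonneg y) (poissonKernelLine_pos ha y).le)]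
  calc _ ≤ quarticWeight y * (2 * a * (1 + 1 / a ^ 2) * (1 + y ^ 2)⁻¹) :=
        mul_le_mul_of_nonneg_left (poissonKernelLine_le ha y) (quarticWeight_nonneg y)
    _ = _ := by ring

/-- Rescaling y by a turns the Poisson kernel into 2/(1+y²), so the bound is uniform as a → 0; 34 is
twice the constant 17 of the rescaled weight. -/
lemma integral_quarticWeight_mul_poisson_le {a : ℝ} (ha : 0 < a) (ha4 : a ≤ 4) :
    ∫ y, quarticWeight y * poissonKernelLine a y ≤
      34 * ∫ y : ℝ, quarticWeight y * (1 + y ^ 2)⁻¹ := by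
  have h := Measure.integral_comp_mul_left (fun y ↦ quarticWeight y * poissonKernelLine a y) a
  rw [abs_of_pos (inv_pos.mpr ha), smul_eq_mul] at h
  have h1 : ∫ y, quarticWeight y * poissonKernelLine a y =
      a * ∫ y, quarticWeight (a * y) * poissonKernelLine a (a * y) := by
    rw [h, mul_inv_cancel_left₀ ha.ne']
  have hi := ((integrable_quarticWeight_mul_poisson ha).comp_mul_left' ha.ne').const_mul a
  rw [h1, ← integral_const_mul, ← integral_const_mul]
  refine integral_mono hi (integrable_quarticWeight_mul_inv.const_mul 34) fun y ↦ ?_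
  have e : a * (quarticWeight (a * y) * poissonKernelLine a (a * y)) =
      2 * quarticWeight (a * y) * (1 + y ^ 2)⁻¹ := by
    have : 0 < 1 + y ^ 2 := by positivity
    unfold poissonKernelLine
    rw [show a ^ 2 + (a * y) ^ 2 = a ^ 2 * (1 + y ^ 2) by ring]
    field_simp
  have hp : 0 ≤ (1 + y ^ 2)⁻¹ := by positivity
  simp only [e]
  nlinarith [mul_le_mul_of_nonneg_right (quarticWeight_mul_le ha.le ha4 y) hp]

lemma log_norm_sub_add_le {s : ℂ} {a : ℝ} (ha : 0 ≤ a) (has : a ≤ s.re) (y : ℝ) :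
    Real.log ‖s - a + y * I + 1‖ ≤ Real.log ‖s + 1‖ + Real.log (1 + |y|) := by
  have h1 : 1 ≤ ‖s + 1‖ := by
    have := Complex.re_le_norm (s + 1)
    simp only [add_re, one_re] at this
    linarith
  have h0 : ‖s - a + 1‖ ≤ ‖s + 1‖ := by
    rw [← pow_le_pow_iff_left₀ (norm_nonneg _) (norm_nonneg _) two_ne_zero, Complex.sq_norm,
      Complex.sq_norm, Complex.normSq_apply, Complex.normSq_apply]
    simp only [add_re, sub_re, one_re, ofReal_re, add_im, sub_im, one_im, ofReal_im]
    nlinarith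
  have h2 : ‖s - a + y * I + 1‖ ≤ ‖s + 1‖ + |y| := by
    have h := norm_add_le (s - a + 1) (y * I)
    rw [show s - a + 1 + y * I = s - a + y * I + 1 by ring] at h
    have : ‖(y * I : ℂ)‖ = |y| := by simp
    linarith
  have h3 : ‖s - a + y * I + 1‖ ≤ ‖s + 1‖ * (1 + |y|) := by nlinarith [abs_nonneg y]
  have h4 : 0 < ‖s - a + y * I + 1‖ := by
    have := Complex.re_le_norm (s - a + y * I + 1)
    simp at this
    linarith
  rw [← Real.log_mul (by positivity) (by positivity)]
  exact Real.log_le_log h4 h3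

/-- Positivity of the comparison kernel bounds the tail function by `L'/L`. -/
lemma exists_neg_re_tailFunction_le : ∃ C : ℝ, ∀ (q : ℕ) [NeZero q], GRHModulus q →
    ∀ χ : DirichletCharacter ℂ q, χ ≠ 1 → ∀ (a v x : ℝ) (s : ℂ), 0 < a → a ≤ 4 → 0 ≤ v → 1 ≤ x →
    1 / 2 + a < s.re →
    -(tailFunction χ x (s + v)).re ≤ Real.exp (-((a + v) * Real.log x)) / a *
      ((logDeriv χ.LFunction s).re + 1 / 2 * (Real.log q + Real.log ‖s + 1‖ + 2) + C) := by
  -- The 4 combines the coefficient 2 of the weight in the lower bound for Re L'/L with the factor 2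
  -- in `comparisonKernel_le`; 2π is the Fourier normalisation.
  refine ⟨4 * (34 * ∫ y : ℝ, quarticWeight y * (1 + y ^ 2)⁻¹) / (2 * Real.pi), ?_⟩
  intro q _ h χ hχ a v x s ha ha4 hv hx hs
  have hnz : ∀ s : ℂ, 1 / 2 < s.re → χ.LFunction s ≠ 0 := fun s hs ↦ h.LFunction_ne_zero hχ hs
  have hX : 0 ≤ Real.log x := Real.log_nonneg hx
  have hab : a ≤ a + v := by linarith
  set κ := comparisonKernel a (a + v) (Real.log x) with hκ
  have hκ0 : ∀ y, 0 ≤ κ y := comparisonKernel_nonneg ha hab _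
  have hκc : Continuous κ := continuous_comparisonKernel ha (ha.trans_le hab) _
  obtain ⟨B, -, hB⟩ := comparisonKernel_le_inv ha hab (Real.log x)
  have hB' : ∀ y, |κ y| ≤ B * (1 + y ^ 2)⁻¹ := fun y ↦ by
    rw [abs_of_nonneg (hκ0 y)]; exact hB y
  have hκi : Integrable κ := (integrable_inv_one_add_sq.const_mul B).mono'
    hκc.aestronglyMeasurable (ae_of_all _ hB')
  set c := Real.exp (-((a + v) * Real.log x)) / a with hc
  have hc0 : 0 ≤ c := by positivity
  -- The mass is the transform at 0, where the tail part vanishes because log x ≥ 0.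
  have hκint : ∫ y, κ y = 2 * Real.pi * c := by
    have := integral_cexp_mul_comparisonKernel ha hab hX 0
    simp only [ofReal_zero, zero_mul, Complex.exp_zero, one_mul, abs_zero, zero_sub, mul_zero,
      neg_zero, Real.exp_zero, mul_one, max_eq_right (neg_nonpos.mpr hX), sub_zero] at this
    rw [integral_complex_ofReal] at this
    exact_mod_cast this
  have hi := integrable_logDeriv_mul hχ hnz hκc hB' (s := s - a) (by simp; linarith)
  have hI := integral_logDeriv_mul_comparisonKernel hχ hnz ha hv hx hs
  have hIre : ∫ y : ℝ, (logDeriv χ.LFunction (s - a + y * I)).re * κ y =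
      2 * Real.pi * (c * (logDeriv χ.LFunction s).re + (tailFunction χ x (s + v)).re) := by
    have h1 := integral_re hi
    have h2 := congrArg Complex.re hI
    simp only [← hκ, ← hc] at h2
    have e : (2 * Real.pi * ((c : ℂ) * logDeriv χ.LFunction s + tailFunction χ x (s + v))).re =
        2 * Real.pi * (c * (logDeriv χ.LFunction s).re + (tailFunction χ x (s + v)).re) := by
      rw [show (2 * Real.pi : ℂ) = ((2 * Real.pi : ℝ) : ℂ) by push_cast; rfl, re_ofReal_mul,
        add_re, re_ofReal_mul]
    rw [e] at h2
    rw [← h2, RCLike.re_eq_complex_re] at *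
    refine Eq.trans ?_ h1
    congr 1; ext y
    simp
  have hire : Integrable fun y : ℝ ↦ (logDeriv χ.LFunction (s - a + y * I)).re * κ y := by
    refine hi.re.congr (ae_of_all _ fun y ↦ ?_)
    simp
  set A := 1 / 2 * (Real.log q + Real.log ‖s + 1‖ + 2) with hA
  have hpt : ∀ y : ℝ, -((logDeriv χ.LFunction (s - a + y * I)).re * κ y) ≤
      A * κ y + 4 * c * (quarticWeight y * poissonKernelLine a y) := by
    intro y
    have h1 := h.neg_re_logDeriv_LFunction_le hχ (s := s - a + y * I) (by simp; linarith)
    have h2 := log_norm_sub_add_le (s := s) ha.le (by linarith) y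
    have h3 := log_one_add_abs_le y
    have h4 : -(logDeriv χ.LFunction (s - a + y * I)).re ≤ A + 2 * quarticWeight y := by
      linarith
    have h5 := mul_le_mul_of_nonneg_right h4 (hκ0 y)
    have h6 := mul_le_mul_of_nonneg_left (comparisonKernel_le ha hab (Real.log x) y)
      (mul_nonneg zero_le_two (quarticWeight_nonneg y))
    rw [← hκ, ← hc] at h6
    linarith
  have hP := integrable_quarticWeight_mul_poisson ha
  have hmono := integral_mono hire.neg
    (g := fun y ↦ A * κ y + 4 * c * (quarticWeight y * poissonKernelLine a y))
    ((hκi.const_mul A).add (hP.const_mul (4 * c))) hpt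
  simp only [Pi.neg_apply] at hmono
  rw [integral_neg, hIre, integral_add (hκi.const_mul A) (hP.const_mul (4 * c)),
    integral_const_mul, integral_const_mul, hκint] at hmono
  have hJ := mul_le_mul_of_nonneg_left (integral_quarticWeight_mul_poisson_le ha ha4)
    (mul_nonneg zero_le_four hc0)
  set J := 34 * ∫ y : ℝ, quarticWeight y * (1 + y ^ 2)⁻¹
  have hpi := Real.pi_pos
  refine le_of_mul_le_mul_left (?_ : 2 * Real.pi * _ ≤ 2 * Real.pi * _) (by positivity)
  have e : 2 * Real.pi * (c * ((logDeriv χ.LFunction s).re + A + 4 * J / (2 * Real.pi))) =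
      2 * Real.pi * c * ((logDeriv χ.LFunction s).re + A) + 4 * c * J := by
    field_simp
  rw [e]
  linarith

end

/-! ### Integration over horizontal rays and the choice of the parameter a. -/

section

open Complex Filter Topology MeasureTheory

lemma tendsto_term_add_ofReal (f : ℕ → ℂ) (s : ℂ) (n : ℕ) :
    Tendsto (fun v : ℝ ↦ LSeries.term f (s + v) n) atTop (𝓝 (if n = 1 then f 1 else 0)) := by
  rcases Nat.lt_or_ge 1 n with hn | hn
  · rw [if_neg hn.ne']
    have hl : 0 < Real.log n := Real.log_pos (by exact_mod_cast hn)
    have h1 : Tendsto (fun v : ℝ ↦ Real.exp (-(v * Real.log n))) atTop (𝓝 0) :=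
      Real.tendsto_exp_neg_atTop_nhds_zero.comp (tendsto_id.atTop_mul_const hl)
    have h2 := ((continuous_ofReal.tendsto 0).comp h1).const_mul (LSeries.term f s n)
    rw [ofReal_zero, mul_zero] at h2
    exact h2.congr fun v ↦ (term_add_ofReal s v n).symm
  · interval_cases n
    · simp
    · simp [LSeries.term_of_ne_zero]

lemma tendsto_LSeries_add_ofReal {f : ℕ → ℂ} (s : ℂ) {v₀ : ℝ} (h : LSeriesSummable f (s + v₀)) :
    Tendsto (fun v : ℝ ↦ LSeries f (s + v)) atTop (𝓝 (f 1)) := by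
  have key := tendsto_tsum_of_dominated_convergence (𝓕 := atTop)
    (f := fun (v : ℝ) n ↦ LSeries.term f (s + v) n) h.norm (tendsto_term_add_ofReal f s) (by
      filter_upwards [eventually_ge_atTop v₀] with v hv n
      exact LSeries.norm_term_le_of_re_le_re f (by simpa using hv) n)
  rwa [tsum_ite_eq] at key

/-- The prime power sum `∑ χ(n) Λ(n) n⁻ˢ log (x / n) / log n` over `n ≤ x`. -/
noncomputable def primePowerSum {q : ℕ} (χ : DirichletCharacter ℂ q) (x : ℝ) (s : ℂ) : ℂ :=
  ∑ n ∈ Finset.Icc 1 ⌊x⌋₊, LSeries.term (twistedMangoldt χ) s n *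
    (((Real.log x - Real.log n) / Real.log n : ℝ) : ℂ)

lemma twistedMangoldt_one {q : ℕ} (χ : DirichletCharacter ℂ q) : twistedMangoldt χ 1 = 0 := by
  simp [twistedMangoldt]

lemma hasDerivAt_primePowerSum {q : ℕ} (χ : DirichletCharacter ℂ q) (x : ℝ) (s : ℂ) :
    HasDerivAt (primePowerSum χ x) (-∑ n ∈ Finset.Icc 1 ⌊x⌋₊,
      LSeries.term (twistedMangoldt χ) s n * ((Real.log x - Real.log n : ℝ) : ℂ)) s := by
  unfold primePowerSum
  rw [← Finset.sum_neg_distrib]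
  refine HasDerivAt.fun_sum fun n hn ↦ ?_
  have h := (LSeries.hasDerivAt_term (twistedMangoldt χ) n s).mul_const
    (((Real.log x - Real.log n) / Real.log n : ℝ) : ℂ)
  refine h.congr_deriv ?_
  have hn1 := (Finset.mem_Icc.mp hn).1
  -- At n = 1 the quotient by log 1 = 0 is a default value; the term vanishes because Λ(1) = 0.
  rcases hn1.eq_or_lt with rfl | hn1
  · simp [LSeries.term_of_ne_zero, LSeries.logMul, twistedMangoldt_one]
  have hl : (Real.log n : ℂ) ≠ 0 := by
    exact_mod_cast (Real.log_pos (by exact_mod_cast hn1)).ne'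
  rw [LSeries.term_of_ne_zero (by omega), LSeries.term_of_ne_zero (by omega), LSeries.logMul,
    Complex.ofReal_div, ← Complex.natCast_log]
  field_simp

lemma tendsto_primePowerSum {q : ℕ} (χ : DirichletCharacter ℂ q) (x : ℝ) (s : ℂ) :
    Tendsto (fun v : ℝ ↦ primePowerSum χ x (s + v)) atTop (𝓝 0) := by
  have h := tendsto_finsetSum (Finset.Icc 1 ⌊x⌋₊) fun n _ ↦
    (tendsto_term_add_ofReal (twistedMangoldt χ) s n).mul_const
      (((Real.log x - Real.log n) / Real.log n : ℝ) : ℂ)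
  simpa [primePowerSum, twistedMangoldt_one] using h

section

variable {q : ℕ} [NeZero q] {χ : DirichletCharacter ℂ q}

lemma tendsto_LFunction_add_ofReal (χ : DirichletCharacter ℂ q) (s : ℂ) :
    Tendsto (fun v : ℝ ↦ χ.LFunction (s + v)) atTop (𝓝 1) := by
  have h := tendsto_LSeries_add_ofReal (f := fun n : ℕ ↦ χ n) s (v₀ := 2 - s.re)
    (χ.LSeriesSummable_of_one_lt_re (by simp))
  simp only [Nat.cast_one, map_one] at h
  refine h.congr' ?_
  filter_upwards [eventually_ge_atTop (2 - s.re)] with v hv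
  exact (χ.LFunction_eq_LSeries (by simp; linarith)).symm

lemma tendsto_logDeriv_add_ofReal (χ : DirichletCharacter ℂ q) (s : ℂ) :
    Tendsto (fun v : ℝ ↦ logDeriv χ.LFunction (s + v)) atTop (𝓝 0) := by
  have h := (tendsto_LSeries_add_ofReal (f := twistedMangoldt χ) s (v₀ := 2 - s.re)
    (summable_twistedMangoldt χ (by simp))).neg
  rw [twistedMangoldt_one, neg_zero] at h
  refine h.congr' ?_
  filter_upwards [eventually_ge_atTop (2 - s.re)] with v hv
  exact (logDeriv_LFunction_eq χ (by simp; linarith)).symm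

/-- This exhibits a primitive of the real part of the tail function; as it tends to 0 at infinity,
bounds for the tail can be integrated over v. -/
lemma hasDerivAt_log_norm_add_logDeriv (hχ : χ ≠ 1)
    (hnz : ∀ s : ℂ, 1 / 2 < s.re → χ.LFunction s ≠ 0) (x : ℝ) {s : ℂ} {v : ℝ}
    (hs : 1 / 2 < s.re + v) :
    HasDerivAt (fun v : ℝ ↦ Real.log x * Real.log ‖χ.LFunction (s + v)‖ +
      (logDeriv χ.LFunction (s + v)).re - (primePowerSum χ x (s + v)).re)
      (tailFunction χ x (s + v)).re v := by
  have hs' : 1 / 2 < (s + v : ℂ).re := by simpa using hs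
  have h1 := (hasDerivAt_log_norm (DirichletCharacter.differentiable_LFunction hχ (s + v))
    (hnz _ hs')).const_mul (Real.log x)
  have hadd : HasDerivAt (fun z : ℂ ↦ s + z) 1 (v : ℂ) := (hasDerivAt_id _).const_add s
  have h2 := ((differentiableAt_logDeriv_LFunction hχ hnz hs').hasDerivAt.comp_of_eq (v : ℂ) hadd
    rfl).real_of_complex
  have h3 := ((hasDerivAt_primePowerSum χ x (s + v)).comp_of_eq (v : ℂ) hadd rfl).real_of_complex
  have h4 := (h1.add h2).sub h3
  refine h4.congr_deriv ?_
  simp only [mul_one, neg_re, tailFunction, add_re, re_ofReal_mul]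
  ring

lemma tendsto_log_norm_add_logDeriv (χ : DirichletCharacter ℂ q) (x : ℝ) (s : ℂ) :
    Tendsto (fun v : ℝ ↦ Real.log x * Real.log ‖χ.LFunction (s + v)‖ +
      (logDeriv χ.LFunction (s + v)).re - (primePowerSum χ x (s + v)).re) atTop (𝓝 0) := by
  have h1 := ((tendsto_LFunction_add_ofReal χ s).norm.log (by simp)).const_mul (Real.log x)
  have h2 := (continuous_re.tendsto _).comp (tendsto_logDeriv_add_ofReal χ s)
  have h3 := (continuous_re.tendsto _).comp (tendsto_primePowerSum χ x s)
  have := (h1.add h2).sub h3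
  simpa using this

end

/-- The integral of e^(-(a+v) log x)/a over v ≥ 0 is the factor on the right. The integration takes
the form of monotonicity: the difference of the two primitives increases in v and tends to 0, so it
is at most 0 at v = 0. -/
lemma exists_log_norm_add_logDeriv_le : ∃ C : ℝ, 0 ≤ C ∧ ∀ (q : ℕ) [NeZero q], GRHModulus q →
    ∀ χ : DirichletCharacter ℂ q, χ ≠ 1 → ∀ (a x : ℝ) (s : ℂ), 0 < a → a ≤ 4 → 1 < x →
    1 / 2 + a < s.re →
    Real.log x * Real.log ‖χ.LFunction s‖ + (logDeriv χ.LFunction s).re -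
      (primePowerSum χ x s).re ≤ Real.exp (-(a * Real.log x)) / (a * Real.log x) *
      ((logDeriv χ.LFunction s).re + 1 / 2 * (Real.log q + Real.log ‖s + 1‖ + 2) + C) := by
  obtain ⟨C, hC⟩ := exists_neg_re_tailFunction_le
  refine ⟨max C 0, le_max_right _ _, ?_⟩
  intro q _ h χ hχ a x s ha ha4 hx hs
  have hnz : ∀ s : ℂ, 1 / 2 < s.re → χ.LFunction s ≠ 0 := fun s hs ↦ h.LFunction_ne_zero hχ hs
  have hX : 0 < Real.log x := Real.log_pos hx
  set X := Real.log x with hXd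
  set M := (logDeriv χ.LFunction s).re + 1 / 2 * (Real.log q + Real.log ‖s + 1‖ + 2) + max C 0
  have hE : ∀ v : ℝ, HasDerivAt (fun v : ℝ ↦ Real.exp (-((a + v) * X)) / (a * X) * M)
      (-(Real.exp (-((a + v) * X)) / a * M)) v := by
    intro v
    have h1 : HasDerivAt (fun v : ℝ ↦ -((a + v) * X)) (-X) v := by
      simpa using (((hasDerivAt_id v).const_add a).mul_const X).fun_neg
    refine ((h1.exp.div_const (a * X)).mul_const M).congr_deriv ?_
    field_simp
  have hD : ∀ v : ℝ, 0 ≤ v → HasDerivAt (fun v : ℝ ↦ (X * Real.log ‖χ.LFunction (s + v)‖ +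
      (logDeriv χ.LFunction (s + v)).re - (primePowerSum χ x (s + v)).re) -
      Real.exp (-((a + v) * X)) / (a * X) * M)
      ((tailFunction χ x (s + v)).re - -(Real.exp (-((a + v) * X)) / a * M)) v := fun v hv ↦
    (hasDerivAt_log_norm_add_logDeriv hχ hnz x (by linarith)).sub (hE v)
  have hmono : MonotoneOn (fun v : ℝ ↦ (X * Real.log ‖χ.LFunction (s + v)‖ +
      (logDeriv χ.LFunction (s + v)).re - (primePowerSum χ x (s + v)).re) -
      Real.exp (-((a + v) * X)) / (a * X) * M) (Set.Ici 0) := by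
    refine monotoneOn_of_deriv_nonneg (convex_Ici 0)
      (fun v hv ↦ (hD v hv).continuousAt.continuousWithinAt)
      (fun v hv ↦ (hD v (interior_subset hv)).differentiableAt.differentiableWithinAt)
      fun v hv ↦ ?_
    have hv0 : 0 ≤ v := interior_subset hv
    rw [(hD v hv0).deriv]
    have h1 := hC q h χ hχ a v x s ha ha4 hv0 hx.le hs
    have h2 : Real.exp (-((a + v) * X)) / a * ((logDeriv χ.LFunction s).re +
        1 / 2 * (Real.log q + Real.log ‖s + 1‖ + 2) + C) ≤ Real.exp (-((a + v) * X)) / a * M :=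
      mul_le_mul_of_nonneg_left (add_le_add_right (le_max_left C 0) _) (by positivity)
    linarith
  have hElim : Tendsto (fun v : ℝ ↦ Real.exp (-((a + v) * X)) / (a * X) * M) atTop (𝓝 0) := by
    have h1 : Tendsto (fun v : ℝ ↦ (a + v) * X) atTop atTop :=
      (tendsto_atTop_add_const_left _ a tendsto_id).atTop_mul_const hX
    have h2 := ((Real.tendsto_exp_neg_atTop_nhds_zero.comp h1).div_const (a * X)).mul_const M
    simpa using h2
  have hlim := (tendsto_log_norm_add_logDeriv χ x s).sub hElim
  rw [sub_zero] at hlim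
  have h0 := ge_of_tendsto hlim (b := X * Real.log ‖χ.LFunction s‖ + (logDeriv χ.LFunction s).re -
      (primePowerSum χ x s).re - Real.exp (-(a * X)) / (a * X) * M) (by
    filter_upwards [eventually_ge_atTop (0 : ℝ)] with v hv
    simpa using hmono (Set.mem_Ici.mpr le_rfl) (Set.mem_Ici.mpr hv) hv)
  linarith

lemma log_norm_add_one_le {s : ℂ} (hs : 1 / 2 ≤ s.re) (hs4 : s.re ≤ 4) :
    Real.log ‖s + 1‖ ≤ 2 + Real.posLog s.im := by
  have h1 : ‖s + 1‖ ≤ 6 * max 1 |s.im| := by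
    have h := Complex.norm_le_abs_re_add_abs_im (s + 1)
    simp only [add_re, one_re, add_im, one_im, add_zero] at h
    rw [abs_of_nonneg (by linarith)] at h
    linarith [le_max_left 1 |s.im|, le_max_right 1 |s.im|]
  have h2 : 0 < ‖s + 1‖ := by
    have := Complex.re_le_norm (s + 1)
    simp only [add_re, one_re] at this
    linarith
  have hm : 0 < max 1 |s.im| := lt_max_of_lt_left one_pos
  have h3 : Real.log 6 ≤ 2 := by
    rw [Real.log_le_iff_le_exp (by norm_num)]
    have := Real.exp_one_gt_d9
    rw [show (2 : ℝ) = 1 + 1 by norm_num, Real.exp_add]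
    nlinarith
  have h4 : Real.posLog s.im = Real.log (max 1 |s.im|) := by
    rw [← Real.posLog_abs, Real.posLog_eq_log_max_one (abs_nonneg _)]
  have h5 := Real.log_le_log h2 h1
  rw [Real.log_mul (by norm_num) hm.ne'] at h5
  linarith

lemma exists_log_norm_LFunction_le {lam0 : ℝ} (hlam0 : Real.exp (-lam0) = lam0) :
    ∃ C : ℝ, 0 ≤ C ∧ ∀ (q : ℕ) [NeZero q], GRHModulus q →
    ∀ χ : DirichletCharacter ℂ q, χ ≠ 1 → ∀ (lam x : ℝ) (s : ℂ), lam0 ≤ lam → 1 < x →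
    s.re = 1 / 2 + lam / Real.log x → s.re ≤ 4 →
    Real.log x * Real.log ‖χ.LFunction s‖ ≤ (primePowerSum χ x s).re +
      1 / 2 * (Real.log q + Real.posLog s.im) + C := by
  obtain ⟨C, hC0, hC⟩ := exists_log_norm_add_logDeriv_le
  -- The 2 is half of 2 + 2: one from the lower bound for Re L'/L, one from log|s+1| ≤ 2 + log⁺ t.
  refine ⟨C + 2, by linarith, ?_⟩
  intro q _ h χ hχ lam x s hlam hx hs hs4
  have hX : 0 < Real.log x := Real.log_pos hx
  have hlam0' : 0 < lam0 := hlam0 ▸ Real.exp_pos _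
  have hlampos : 0 < lam := hlam0'.trans_le hlam
  set δ := lam / Real.log x with hδ
  have hδ0 : 0 < δ := div_pos hlampos hX
  have hδX : δ * Real.log x = lam := div_mul_cancel₀ _ hX.ne'
  set M := (logDeriv χ.LFunction s).re + 1 / 2 * (Real.log q + Real.log ‖s + 1‖ + 2) + C with hM
  have hcont : ContinuousAt (fun a ↦ Real.exp (-(a * Real.log x)) / (a * Real.log x) * M) δ := by
    refine ContinuousAt.mul (ContinuousAt.div (by fun_prop) (by fun_prop) ?_) continuousAt_const
    rw [hδX]; exact hlampos.ne'
  -- The value a = δ is excluded by the strict inequality 1/2 + a < Re s, so it is reached as a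
  -- limit from the left.
  have key := ge_of_tendsto (x := 𝓝[<] δ) (hcont.tendsto.mono_left nhdsWithin_le_nhds)
    (b := Real.log x * Real.log ‖χ.LFunction s‖ + (logDeriv χ.LFunction s).re -
      (primePowerSum χ x s).re) (by
    filter_upwards [Ioo_mem_nhdsLT hδ0] with a ha
    exact hC q h χ hχ a x s ha.1 (by linarith [ha.2]) hx (by linarith [ha.2]))
  rw [hδX] at key
  have hM0 : 0 ≤ M := by
    linarith [h.neg_re_logDeriv_LFunction_le hχ (s := s) (by linarith)]
  -- The only place where λ ≥ λ₀ is needed beyond positivity. As M ≥ 0, the factor may be replaced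
  -- by 1, and Re L'/L(s) then cancels from both sides.
  have hr : Real.exp (-lam) / lam ≤ 1 := by
    rw [div_le_one hlampos]
    exact (Real.exp_le_exp.mpr (neg_le_neg hlam)).trans (hlam0.le.trans hlam)
  have h1 := mul_le_mul_of_nonneg_right hr hM0
  have h2 := log_norm_add_one_le (s := s) (by linarith) hs4
  linarith

end

/-! ### The range of large λ/log x and the final assembly. -/

section

open Complex Filter Topology MeasureTheory

lemma weightedPrimePowerSum_eq {q : ℕ} (χ : DirichletCharacter ℂ q) (lam t : ℝ) {x : ℝ}
    (hx : 0 < x) : weightedPrimePowerSum χ lam x t =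
      primePowerSum χ x (((1 / 2 + lam / Real.log x : ℝ) : ℂ) + t * I) / (Real.log x : ℂ) := by
  unfold weightedPrimePowerSum primePowerSum
  rw [Finset.sum_div]
  refine Finset.sum_congr rfl fun n hn ↦ ?_
  have hn1 := (Finset.mem_Icc.mp hn).1
  have hn0 : (n : ℝ) ≠ 0 := by exact_mod_cast (by omega : n ≠ 0)
  rw [Real.log_div hx.ne' hn0, LSeries.term_of_ne_zero (by omega), twistedMangoldt]
  simp only [ofReal_div]
  ring

/-- The exponent has real part at least 4 and Λ(n) ≤ log n, so the sum is dominated by ζ(4); the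
extra 1 fills the unused place n = 1. -/
lemma norm_weightedPrimePowerSum_add_one_le {q : ℕ} (χ : DirichletCharacter ℂ q) {lam t x : ℝ}
    (hx : 1 < x) (h : 7 / 2 ≤ lam / Real.log x) :
    ‖weightedPrimePowerSum χ lam x t‖ + 1 ≤ Real.pi ^ 4 / 90 := by
  have hX : 0 < Real.log x := Real.log_pos hx
  have h1 : 1 ∈ Finset.Icc 1 ⌊x⌋₊ :=
    Finset.mem_Icc.mpr ⟨le_rfl, Nat.le_floor (by exact_mod_cast hx.le)⟩
  have hone : ∑ n ∈ Finset.Icc 1 ⌊x⌋₊, (if n = 1 then (1 : ℝ) else 0) = 1 := by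
    rw [Finset.sum_ite_eq' _ 1, if_pos h1]
  refine le_trans ?_ (sum_le_hasSum (Finset.Icc 1 ⌊x⌋₊) (fun n _ ↦ by positivity) hasSum_zeta_four)
  refine (add_le_add (norm_sum_le _ _) hone.ge).trans ?_
  rw [← Finset.sum_add_distrib]
  refine Finset.sum_le_sum fun n hn ↦ ?_
  obtain ⟨hn1, hnx⟩ := Finset.mem_Icc.mp hn
  rcases hn1.eq_or_lt with rfl | hn1
  · simp
  have hn0 : (0 : ℝ) < n := by exact_mod_cast (by omega : 0 < n)
  have hnx' : (n : ℝ) ≤ x := (Nat.le_floor_iff (by linarith)).mp hnx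
  have hl : 0 < Real.log n := Real.log_pos (by exact_mod_cast hn1)
  have hlx : Real.log (x / n) / Real.log x ≤ 1 := by
    rw [div_le_one hX, Real.log_div (by linarith) hn0.ne']
    linarith
  have hlx0 : 0 ≤ Real.log (x / n) / Real.log x :=
    div_nonneg (Real.log_nonneg ((one_le_div hn0).mpr hnx')) hX.le
  have hpow : (n : ℝ) ^ 4 ≤ ‖(n : ℂ) ^ (((1 / 2 + lam / Real.log x : ℝ) : ℂ) + t * I)‖ := by
    rw [Complex.norm_natCast_cpow_of_pos (by omega), ← Real.rpow_natCast]
    refine Real.rpow_le_rpow_of_exponent_le (by exact_mod_cast hn1.le) ?_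
    simp only [add_re, ofReal_re, mul_re, I_re, mul_zero, ofReal_im, I_im, mul_one, sub_self,
      add_zero, Nat.cast_ofNat]
    linarith
  rw [if_neg hn1.ne', add_zero, norm_mul, norm_div, norm_mul, norm_mul, Complex.norm_real,
    Complex.norm_real, Complex.norm_real, Real.norm_of_nonneg hlx0, Real.norm_of_nonneg hl.le,
    Real.norm_of_nonneg ArithmeticFunction.vonMangoldt_nonneg]
  have hΛ := ArithmeticFunction.vonMangoldt_le_log (n := n)
  have hχ := χ.norm_le_one (n : ZMod q)
  have hp : (0 : ℝ) < n ^ 4 := by positivity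
  calc _ ≤ 1 * Real.log n / ((n : ℝ) ^ 4 * Real.log n) * 1 := by
        gcongr
    _ = _ := by field_simp

/-- Modulo 1 and 2 the unit group is trivial. The purpose is log q ≥ 1, which lets log q absorb
absolute constants when λ/log x is large. -/
lemma three_le_of_ne_one {q : ℕ} [NeZero q] {χ : DirichletCharacter ℂ q} (hχ : χ ≠ 1) : 3 ≤ q := by
  by_contra hq
  have hq0 := NeZero.pos q
  have hs : Subsingleton (ZMod q)ˣ := by
    obtain rfl | rfl : q = 1 ∨ q = 2 := by omega
    · infer_instance
    · exact ⟨by decide⟩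
  exact hχ (MulChar.ext fun a ↦ by rw [Subsingleton.elim a 1]; simp)

lemma log_norm_LFunction_le_of_two_le {q : ℕ} [NeZero q] (χ : DirichletCharacter ℂ q) {s : ℂ}
    (hs : 2 ≤ s.re) : Real.log ‖χ.LFunction s‖ ≤ 0.6452 := by
  have h1 := norm_LFunction_sub_one_le_of_two_le χ hs
  have h2 := one_third_le_norm_LFunction χ hs
  have h3 := norm_sub_norm_le (χ.LFunction s) 1
  rw [norm_one] at h3
  linarith [Real.log_le_sub_one_of_pos (x := ‖χ.LFunction s‖) (by linarith)]

end

theorem proposition2p3 (lam0 : ℝ) (hlam0 : Real.exp (-lam0) = lam0) :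
    ∃ C : ℝ, ∀ (q : ℕ) [NeZero q], GRHModulus q →
      ∀ χ : DirichletCharacter ℂ q, χ ≠ 1 →
      ∀ lam x T t σ : ℝ, lam0 ≤ lam → 2 ≤ x → |t| ≤ T →
        1 / 2 ≤ σ → σ ≤ 1 / 2 + lam / Real.log x →
        χ.LFunction ((σ : ℂ) + (t : ℂ) * Complex.I) ≠ 0 →
        Real.log ‖χ.LFunction ((σ : ℂ) + (t : ℂ) * Complex.I)‖ ≤
          (weightedPrimePowerSum χ lam x t).re
            + (1 + lam) / 2 * ((Real.log (q : ℝ) + Real.posLog T) / Real.log x)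
            + C * (1 / Real.log x) := by
  obtain ⟨C, hC0, hC⟩ := exists_log_norm_LFunction_le hlam0
  refine ⟨C, ?_⟩
  intro q _ h χ hχ lam x T t σ hlam hx htT hσ hσ' h0
  have hX : 0 < Real.log x := Real.log_pos (by linarith)
  have hlampos : 0 < lam := (hlam0 ▸ Real.exp_pos _ : 0 < lam0).trans_le hlam
  set δ := lam / Real.log x with hδ
  have hδX : δ * Real.log x = lam := div_mul_cancel₀ _ hX.ne'
  have hδ0 : 0 < δ := div_pos hlampos hX
  have hQT : Real.posLog t ≤ Real.posLog T := by
    rw [← Real.posLog_abs t]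
    exact Real.posLog_le_posLog (abs_nonneg t) htT
  have hq3 : (3 : ℝ) ≤ q := by exact_mod_cast three_le_of_ne_one hχ
  have hlogq : 1 ≤ Real.log q := by
    rw [Real.le_log_iff_exp_le (by linarith)]
    linarith [Real.exp_one_lt_d9]
  have ht0 : 0 ≤ Real.posLog t := Real.posLog_nonneg
  set Q := Real.log q + Real.posLog T with hQ
  have e : (1 + lam) / 2 * (Q / Real.log x) = 1 / 2 * Q / Real.log x + δ / 2 * Q := by
    rw [← hδX]; field_simp
  rw [e]
  have hres : ((σ : ℂ) + (t : ℂ) * Complex.I).re = σ := by simp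
  have hims : ((σ : ℂ) + (t : ℂ) * Complex.I).im = t := by simp
  have hstep : ∀ d : ℝ, 0 ≤ d → σ + d ≤ 4 →
      Real.log ‖χ.LFunction (σ + t * Complex.I)‖ ≤
        Real.log ‖χ.LFunction (σ + t * Complex.I + d)‖ + d / 2 * Q := by
    intro d hd hd4
    have h1 := h.log_norm_LFunction_le hχ (s := σ + t * Complex.I) (d := d)
      (by rw [hres]; exact hσ)
      hd (by rw [hres]; exact hd4) h0
    rw [hims] at h1
    exact h1.trans (by gcongr; exact add_le_add_right hQT _)
  -- The Gamma comparison is available for real parts up to 4 = 1/2 + 7/2.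
  rcases le_or_gt δ (7 / 2) with hδ1 | hδ1
  · have h1 := hstep (1 / 2 + δ - σ) (by linarith) (by linarith)
    rw [show (σ : ℂ) + t * Complex.I + (1 / 2 + δ - σ : ℝ) = ((1 / 2 + δ : ℝ) : ℂ) + t * Complex.I by
      push_cast; ring] at h1
    have h2 := hC q h χ hχ lam x (((1 / 2 + δ : ℝ) : ℂ) + t * Complex.I) hlam (by linarith)
      (by simp [hδ]) (by simp; linarith)
    have him : (((1 / 2 + δ : ℝ) : ℂ) + t * Complex.I).im = t := by simp
    rw [him] at h2
    have h3 : (weightedPrimePowerSum χ lam x t).re =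
        (primePowerSum χ x (((1 / 2 + δ : ℝ) : ℂ) + t * Complex.I)).re / Real.log x := by
      rw [weightedPrimePowerSum_eq χ lam t (by linarith), Complex.div_ofReal_re]
    have h4 : Real.log ‖χ.LFunction (((1 / 2 + δ : ℝ) : ℂ) + t * Complex.I)‖ ≤
        (weightedPrimePowerSum χ lam x t).re + 1 / 2 * Q / Real.log x + C * (1 / Real.log x) := by
      rw [h3, mul_one_div, ← add_div, ← add_div, le_div_iff₀ hX]
      linarith
    have h5 : (1 / 2 + δ - σ) / 2 * Q ≤ δ / 2 * Q := by
      have : 0 ≤ Q := by linarith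
      gcongr
      linarith
    linarith
  · have hQ1 : 1 ≤ Q := by linarith
    -- Shift to real part 2 at most: 3/4 = (2 - 1/2)/2. Against the available 7/4 · Q a full Q ≥ 1
    -- remains, which exceeds 0.6452 + (ζ(4) - 1).
    have h1 : Real.log ‖χ.LFunction (σ + t * Complex.I)‖ ≤ 0.6452 + 3 / 4 * Q := by
      rcases le_or_gt 2 σ with h2 | h2
      · linarith [log_norm_LFunction_le_of_two_le χ
          (s := σ + t * Complex.I) (by rw [hres]; exact h2)]
      · have h3 := hstep (2 - σ) (by linarith) (by linarith)
        have h4 := log_norm_LFunction_le_of_two_le χ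
          (s := σ + t * Complex.I + (2 - σ : ℝ)) (by simp)
        nlinarith
    have h2 := norm_weightedPrimePowerSum_add_one_le χ (t := t) (by linarith) (hδ ▸ hδ1.le)
    have h3 : Real.pi ^ 4 ≤ 3.15 ^ 4 := by
      have := Real.pi_lt_d2
      exact pow_le_pow_left₀ Real.pi_pos.le this.le 4
    have h4 := (abs_le.mp (Complex.abs_re_le_norm (weightedPrimePowerSum χ lam x t))).1
    have h5 : 0 ≤ 1 / 2 * Q / Real.log x := by positivity
    have h6 : 0 ≤ C * (1 / Real.log x) := by positivity
    have h7 : 7 / 4 * Q ≤ δ / 2 * Q :=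
      mul_le_mul_of_nonneg_right (by linarith) (by linarith)
    norm_num at h3
    linarith
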